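/- Let $C$ be a category with finite limits and let $(T,\mu,\eta)$ be a cartesian monad on $C$: $T$ preserves pullbacks and all naturality squares of $\mu$ and $\eta$ are pullbacks. Applied levelwise, $T$ gives a 2-monad on the 2-category $\mathbf{Cat}(C)$ of internal categories in $C$. A categorical $T$-algebra is a strict algebra for this 2-monad (equivalently, an internal category in the category $Alg_T$ of $T$-algebras); $\mathbf{CAlg}_T$ denotes the 2-category of categorical $T$-algebras, strict morphisms and the internal natural transformations compatible with the actions. A lax morphism $(f,\phi):A\to B$ of categorical $T$-algebras is an internal functor $f:A\to B$ with an internal natural transformation $\phi: b\circ T(f)\Rightarrow f\circ a$ ($a,b$ the actions on $A,B$) whose restriction along $\eta_A$ is the identity of $f$ and whose restriction along $\mu_A$ is the composite of $b\circ T(\phi)$ followed by $\phi\circ T(a)$. A transformation $(f,\phi)\Rightarrow(g,\psi)$ is an internal natural transformation $\alpha:f\Rightarrow g$ such that $\phi$ followed by $\alpha\circ a$ equals $b\circ T(\alpha)$ followed by $\psi$. Let $1$ be the terminal categorical $T$-algebra. An internal $T$-algebra in $A$ is a lax morphism $1\to A$; these form a category $IAlg_T(A)$, and composition with strict morphisms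 and whiskering with their transformations make $IAlg_T:\mathbf{CAlg}_T\to Cat$ a 2-functor. Then: 1. The 2-functor $IAlg_T$ is representable: there are a categorical $T$-algebra $\mathbf H^T$ and isomorphisms of categories $\mathbf{CAlg}_T(\mathbf H^T,A)\cong IAlg_T(A)$ that are strictly 2-natural in $A$. 2. This algebra is characterised by its nerve: a categorical $T$-algebra $H$ represents $IAlg_T$ if and only if its nerve (the simplicial $T$-algebra whose $n$-simplices are the composable strings $x_0\leftarrow x_1\leftarrow\cdots\leftarrow x_n$ and whose face $d_i$ omits $x_i$, so that $d_0$ and $d_1$ of an arrow are its source and its target) is isomorphic, as a simplicial $T$-algebra, to the two-sided bar construction $B_\star(T,T,1)$, that is, to the cotriple resolution of the terminal $T$-algebra for the comonad on $Alg_T$ induced by the free-forgetful adjunction; here $B_n(T,T,1)=T^{n+1}(1)$ and $d_i$ applies the counit to the $i$-th factor counted from the outside. 3. For every categorical $T$-algebra $H$ that represents $IAlg_T$ and every such representation, the canonical internal $T$-algebra $1\to H$ (the one corresponding to the identity of $H$) is a terminal object of $H$: every generalised object $X\to H_0$, $X\in C$, has exactly one generalised arrow $X\to H_1$ to it. In particular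 $H$ is contractible: its nerve in $C$ is simplicially homotopy equivalent to the constant simplicial object at the terminal object of $C$. -/

import Mathlib

open CategoryTheory Limits Bicategory

universe v u v' u'

noncomputable section

namespace CartMonad

/-! ### Internal categories -/

section Internal

variable {C : Type u} [Category.{v} C] [HasPullbacks C]

variable (C) in
/-- The underlying data of a category object: objects, arrows, source, target, identities and
composition of composable pairs (`fst` is applied first, then `snd`). -/
structure CatData where
  ob : C
  mor : C
  src : mor ⟶ ob
  tgt : mor ⟶ ob
  ident : ob ⟶ mor
  comp : pullback tgt src ⟶ mor

/-- The composite of a composable pair of `X`-indexed arrows (first `f`, then `g`). -/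
def CatData.compose (A : CatData C) {X : C} (f g : X ⟶ A.mor) (h : f ≫ A.tgt = g ≫ A.src) :
    X ⟶ A.mor :=
  pullback.lift f g h ≫ A.comp

variable (C) in
/-- A category internal to `C`.  The unit and associativity laws are stated for generalised
elements, that is, for arrows indexed by an arbitrary object `X` of `C`. -/
structure InternalCat extends CatData C where
  ident_src : ident ≫ src = 𝟙 ob
  ident_tgt : ident ≫ tgt = 𝟙 ob
  comp_src : comp ≫ src = pullback.fst tgt src ≫ src
  comp_tgt : comp ≫ tgt = pullback.snd tgt src ≫ tgt
  ident_compose : ∀ {X : C} (f : X ⟶ mor) (h : (f ≫ src ≫ ident) ≫ tgt = f ≫ src),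
    toCatData.compose (f ≫ src ≫ ident) f h = f
  compose_ident : ∀ {X : C} (f : X ⟶ mor) (h : f ≫ tgt = (f ≫ tgt ≫ ident) ≫ src),
    toCatData.compose f (f ≫ tgt ≫ ident) h = f
  compose_assoc : ∀ {X : C} (f g k : X ⟶ mor) (h₁ : f ≫ tgt = g ≫ src) (h₂ : g ≫ tgt = k ≫ src)
    (h₃ : toCatData.compose f g h₁ ≫ tgt = k ≫ src)
    (h₄ : f ≫ tgt = toCatData.compose g k h₂ ≫ src),
    toCatData.compose (toCatData.compose f g h₁) k h₃ =
      toCatData.compose f (toCatData.compose g k h₂) h₄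

namespace InternalCat

attribute [simp] ident_src ident_tgt comp_src comp_tgt ident_compose compose_ident

variable (A : InternalCat C)

@[simp] lemma ident_src_assoc {Z : C} (k : A.ob ⟶ Z) : A.ident ≫ A.src ≫ k = k := by
  rw [← Category.assoc, ident_src, Category.id_comp]

@[simp] lemma ident_tgt_assoc {Z : C} (k : A.ob ⟶ Z) : A.ident ≫ A.tgt ≫ k = k := by
  rw [← Category.assoc, ident_tgt, Category.id_comp]

@[simp] lemma compose_src {X : C} (f g : X ⟶ A.mor) (h : f ≫ A.tgt = g ≫ A.src) :
    A.compose f g h ≫ A.src = f ≫ A.src := by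
  rw [CatData.compose, Category.assoc, comp_src, pullback.lift_fst_assoc]

@[simp] lemma compose_tgt {X : C} (f g : X ⟶ A.mor) (h : f ≫ A.tgt = g ≫ A.src) :
    A.compose f g h ≫ A.tgt = g ≫ A.tgt := by
  rw [CatData.compose, Category.assoc, comp_tgt, pullback.lift_snd_assoc]

lemma precomp_aux {X Y : C} (k : Y ⟶ X) {f g : X ⟶ A.mor} (h : f ≫ A.tgt = g ≫ A.src) :
    (k ≫ f) ≫ A.tgt = (k ≫ g) ≫ A.src := by
  rw [Category.assoc, Category.assoc, h]

@[simp] lemma precomp_compose {X Y : C} (k : Y ⟶ X) (f g : X ⟶ A.mor)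
    (h : f ≫ A.tgt = g ≫ A.src) :
    k ≫ A.compose f g h = A.compose (k ≫ f) (k ≫ g) (A.precomp_aux k h) := by
  unfold CatData.compose
  rw [← Category.assoc]
  congr 1
  apply pullback.hom_ext
  · rw [Category.assoc, pullback.lift_fst, pullback.lift_fst]
  · rw [Category.assoc, pullback.lift_snd, pullback.lift_snd]

lemma compose_congr {X : C} {f f' g g' : X ⟶ A.mor} (hf : f = f') (hg : g = g')
    (h : f ≫ A.tgt = g ≫ A.src) :
    A.compose f g h = A.compose f' g' (by rw [← hf, ← hg, h]) := by
  subst hf hg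
  rfl

/-- Left unit law, with the identity on an arbitrary generalised object. -/
@[simp] lemma ident_compose' {X : C} (x : X ⟶ A.ob) (f : X ⟶ A.mor) (h : (x ≫ A.ident) ≫ A.tgt = f ≫ A.src) :
    A.compose (x ≫ A.ident) f h = f := by
  have hx : x = f ≫ A.src := by simpa using h
  subst hx
  simp

@[simp] lemma compose_ident' {X : C} (x : X ⟶ A.ob) (f : X ⟶ A.mor) (h : f ≫ A.tgt = (x ≫ A.ident) ≫ A.src) :
    A.compose f (x ≫ A.ident) h = f := by
  have hx : f ≫ A.tgt = x := by simpa using h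
  subst hx
  simp

@[simp] lemma ident_compose₂ {X Y : C} (x : X ⟶ Y) (y : Y ⟶ A.ob) (f : X ⟶ A.mor)
    (h : (x ≫ y ≫ A.ident) ≫ A.tgt = f ≫ A.src) : A.compose (x ≫ y ≫ A.ident) f h = f := by
  have := A.ident_compose' (x ≫ y) f (by simpa using h)
  simpa using this

@[simp] lemma compose_ident₂ {X Y : C} (x : X ⟶ Y) (y : Y ⟶ A.ob) (f : X ⟶ A.mor)
    (h : f ≫ A.tgt = (x ≫ y ≫ A.ident) ≫ A.src) : A.compose f (x ≫ y ≫ A.ident) h = f := by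
  have := A.compose_ident' (x ≫ y) f (by simpa using h)
  simpa using this

@[simp] lemma ident_compose₃ {X Y Z : C} (x : X ⟶ Y) (y : Y ⟶ Z) (z : Z ⟶ A.ob) (f : X ⟶ A.mor)
    (h : (x ≫ y ≫ z ≫ A.ident) ≫ A.tgt = f ≫ A.src) :
    A.compose (x ≫ y ≫ z ≫ A.ident) f h = f := by
  have := A.ident_compose' (x ≫ y ≫ z) f (by simpa using h)
  simpa using this

@[simp] lemma compose_ident₃ {X Y Z : C} (x : X ⟶ Y) (y : Y ⟶ Z) (z : Z ⟶ A.ob) (f : X ⟶ A.mor)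
    (h : f ≫ A.tgt = (x ≫ y ≫ z ≫ A.ident) ≫ A.src) :
    A.compose f (x ≫ y ≫ z ≫ A.ident) h = f := by
  have := A.compose_ident' (x ≫ y ≫ z) f (by simpa using h)
  simpa using this

/-- An internal functor. -/
@[ext]
structure IFunctor (A B : InternalCat C) where
  obj : A.ob ⟶ B.ob
  map : A.mor ⟶ B.mor
  map_src : map ≫ B.src = A.src ≫ obj
  map_tgt : map ≫ B.tgt = A.tgt ≫ obj
  ident_map : A.ident ≫ map = obj ≫ B.ident
  compose_map : ∀ {X : C} (f g : X ⟶ A.mor) (h : f ≫ A.tgt = g ≫ A.src)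
    (h' : (f ≫ map) ≫ B.tgt = (g ≫ map) ≫ B.src),
    A.compose f g h ≫ map = B.compose (f ≫ map) (g ≫ map) h'

namespace IFunctor

attribute [simp] map_src map_tgt ident_map

variable {A} {B : InternalCat C} (F : IFunctor A B)

@[simp] lemma map_src_assoc {Z : C} (k : B.ob ⟶ Z) : F.map ≫ B.src ≫ k = A.src ≫ F.obj ≫ k := by
  rw [← Category.assoc, map_src, Category.assoc]

@[simp] lemma map_tgt_assoc {Z : C} (k : B.ob ⟶ Z) : F.map ≫ B.tgt ≫ k = A.tgt ≫ F.obj ≫ k := by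
  rw [← Category.assoc, map_tgt, Category.assoc]

@[simp] lemma ident_map_assoc {Z : C} (k : B.mor ⟶ Z) :
    A.ident ≫ F.map ≫ k = F.obj ≫ B.ident ≫ k := by
  rw [← Category.assoc, ident_map, Category.assoc]

lemma map_aux {X : C} {f g : X ⟶ A.mor} (h : f ≫ A.tgt = g ≫ A.src) :
    (f ≫ F.map) ≫ B.tgt = (g ≫ F.map) ≫ B.src := by
  simp only [Category.assoc, map_tgt, map_src]
  rw [← Category.assoc, h, Category.assoc]

@[simp] lemma compose_map' {X : C} (f g : X ⟶ A.mor) (h : f ≫ A.tgt = g ≫ A.src) :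
    A.compose f g h ≫ F.map = B.compose (f ≫ F.map) (g ≫ F.map) (F.map_aux h) :=
  F.compose_map f g h _

end IFunctor

/-- An internal natural transformation `F ⇒ G`. -/
@[ext]
structure INatTrans {A B : InternalCat C} (F G : IFunctor A B) where
  app : A.ob ⟶ B.mor
  app_src : app ≫ B.src = F.obj
  app_tgt : app ≫ B.tgt = G.obj
  naturality : ∀ (h₁ : F.map ≫ B.tgt = (A.tgt ≫ app) ≫ B.src)
    (h₂ : (A.src ≫ app) ≫ B.tgt = G.map ≫ B.src),
    B.compose F.map (A.tgt ≫ app) h₁ = B.compose (A.src ≫ app) G.map h₂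

namespace INatTrans

attribute [simp] app_src app_tgt

variable {A} {B : InternalCat C} {F G H : IFunctor A B}

@[simp] lemma app_src_assoc (α : INatTrans F G) {Z : C} (k : B.ob ⟶ Z) :
    α.app ≫ B.src ≫ k = F.obj ≫ k := by
  rw [← Category.assoc, app_src]

@[simp] lemma app_tgt_assoc (α : INatTrans F G) {Z : C} (k : B.ob ⟶ Z) :
    α.app ≫ B.tgt ≫ k = G.obj ≫ k := by
  rw [← Category.assoc, app_tgt]

/-- Naturality at a generalised arrow `f : x ⟶ y`. -/
lemma nat' (α : INatTrans F G) {X : C} (f : X ⟶ A.mor) (x y : X ⟶ A.ob)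
    (hx : f ≫ A.src = x) (hy : f ≫ A.tgt = y)
    (h₁ : (f ≫ F.map) ≫ B.tgt = (y ≫ α.app) ≫ B.src)
    (h₂ : (x ≫ α.app) ≫ B.tgt = (f ≫ G.map) ≫ B.src) :
    B.compose (f ≫ F.map) (y ≫ α.app) h₁ = B.compose (x ≫ α.app) (f ≫ G.map) h₂ := by
  subst hx hy
  have := congrArg (fun k => f ≫ k) (α.naturality (by simp) (by simp))
  simpa using this

/-- The identity transformation. -/
def refl (F : IFunctor A B) : INatTrans F F where
  app := F.obj ≫ B.ident
  app_src := by simp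
  app_tgt := by simp
  naturality h₁ h₂ := by
    have e1 := B.compose_ident' (A.tgt ≫ F.obj) F.map (by simp)
    have e2 := B.ident_compose' (A.src ≫ F.obj) F.map (by simp)
    simp only [Category.assoc] at e1 e2
    rw [e1, e2]

/-- Vertical composition. -/
def vcomp (α : INatTrans F G) (β : INatTrans G H) : INatTrans F H where
  app := B.compose α.app β.app (by simp)
  app_src := by simp
  app_tgt := by simp
  naturality h₁ h₂ := by
    simp only [precomp_compose]
    have e1 := B.compose_assoc F.map (A.tgt ≫ α.app) (A.tgt ≫ β.app)
      (by simp) (by simp) (by simp) (by simp)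
    have e2 := B.compose_assoc (A.src ≫ α.app) G.map (A.tgt ≫ β.app)
      (by simp) (by simp) (by simp) (by simp)
    have e3 := B.compose_assoc (A.src ≫ α.app) (A.src ≫ β.app) H.map
      (by simp) (by simp) (by simp) (by simp)
    rw [e3, ← e1, B.compose_congr (α.naturality (by simp) (by simp)) rfl, e2,
      B.compose_congr rfl (β.naturality (by simp) (by simp))]

end INatTrans

instance : CategoryStruct (InternalCat C) where
  Hom := IFunctor
  id A :=
    { obj := 𝟙 _
      map := 𝟙 _
      map_src := by simp
      map_tgt := by simp
      ident_map := by simp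
      compose_map := by intros; simp }
  comp F G :=
    { obj := F.obj ≫ G.obj
      map := F.map ≫ G.map
      map_src := by simp
      map_tgt := by simp
      ident_map := by simp
      compose_map := by
        intro X f g h h'
        rw [← Category.assoc, F.compose_map', G.compose_map']
        simp }

section

variable {A} {B D E : InternalCat C}

@[ext] lemma hom_ext {F G : A ⟶ B} (h₀ : F.obj = G.obj) (h₁ : F.map = G.map) : F = G :=
  IFunctor.ext h₀ h₁

@[simp] lemma id_obj (A : InternalCat C) : IFunctor.obj (𝟙 A) = 𝟙 A.ob := rfl
@[simp] lemma id_map (A : InternalCat C) : IFunctor.map (𝟙 A) = 𝟙 A.mor := rfl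
@[simp] lemma comp_obj (F : A ⟶ B) (G : B ⟶ D) : (F ≫ G).obj = F.obj ≫ G.obj := rfl
@[simp] lemma comp_map (F : A ⟶ B) (G : B ⟶ D) : (F ≫ G).map = F.map ≫ G.map := rfl

instance : Category (A ⟶ B) where
  Hom F G := INatTrans F G
  id F := INatTrans.refl F
  comp α β := INatTrans.vcomp α β
  id_comp _ := INatTrans.ext (B.ident_compose' _ _ _)
  comp_id _ := INatTrans.ext (B.compose_ident' _ _ _)
  assoc _ _ _ := INatTrans.ext (B.compose_assoc _ _ _ _ _ _ _)

@[ext] lemma hom₂_ext {F G : A ⟶ B} {α β : F ⟶ G} (h : α.app = β.app) : α = β :=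
  INatTrans.ext h

@[simp] lemma id_app (F : A ⟶ B) : INatTrans.app (𝟙 F) = F.obj ≫ B.ident := rfl

lemma comp_app_aux {F G H : A ⟶ B} (α : F ⟶ G) (β : G ⟶ H) :
    α.app ≫ B.tgt = β.app ≫ B.src := by rw [α.app_tgt, β.app_src]

@[simp] lemma comp_app {F G H : A ⟶ B} (α : F ⟶ G) (β : G ⟶ H) :
    (α ≫ β).app = B.compose α.app β.app (comp_app_aux α β) := rfl

/-- Equal functors have an identity transformation between them. -/
def eqTrans {F G : A ⟶ B} (h : F.obj = G.obj) (h' : F.map = G.map) : F ⟶ G :=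
  { app := F.obj ≫ B.ident
    app_src := by simp
    app_tgt := by simp [h]
    naturality := by
      intro h₁ h₂
      have e := (INatTrans.refl F).naturality (by simp [INatTrans.refl]) (by simp [INatTrans.refl])
      exact e.trans (B.compose_congr rfl h' _) }

/-- The corresponding invertible 2-cell. -/
def eqIso {F G : A ⟶ B} (h : F.obj = G.obj) (h' : F.map = G.map) : F ≅ G where
  hom := eqTrans h h'
  inv := eqTrans h.symm h'.symm
  hom_inv_id := by
    obtain rfl : F = G := hom_ext h h'
    exact hom₂_ext (B.ident_compose' _ _ _)
  inv_hom_id := by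
    obtain rfl : F = G := hom_ext h h'
    exact hom₂_ext (B.ident_compose' _ _ _)

/-- Whiskering on the left (precomposition with a functor). -/
def whiskerL (F : A ⟶ B) {G H : B ⟶ D} (α : G ⟶ H) : F ≫ G ⟶ F ≫ H :=
  { app := F.obj ≫ α.app
    app_src := by simp
    app_tgt := by simp
    naturality := by
      intro h₁ h₂
      have := α.nat' F.map (A.src ≫ F.obj) (A.tgt ≫ F.obj) (by simp) (by simp) (by simp) (by simp)
      simpa using this }

/-- Whiskering on the right (postcomposition with a functor). -/
def whiskerR {F G : A ⟶ B} (α : F ⟶ G) (H : B ⟶ D) : F ≫ H ⟶ G ≫ H :=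
  { app := α.app ≫ H.map
    app_src := by simp
    app_tgt := by simp
    naturality := by
      intro h₁ h₂
      have := congrArg (fun k => k ≫ H.map) (α.naturality (by simp) (by simp))
      simpa using this }


@[simp] lemma whiskerL_app (F : A ⟶ B) {G H : B ⟶ D} (α : G ⟶ H) :
    (whiskerL F α).app = F.obj ≫ α.app := rfl

@[simp] lemma whiskerR_app {F G : A ⟶ B} (α : F ⟶ G) (H : B ⟶ D) :
    (whiskerR α H).app = α.app ≫ H.map := rfl

@[simp] lemma eqIso_hom_app {F G : A ⟶ B} (h : F.obj = G.obj) (h' : F.map = G.map) :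
    (eqIso h h').hom.app = F.obj ≫ B.ident := rfl

@[simp] lemma eqIso_inv_app {F G : A ⟶ B} (h : F.obj = G.obj) (h' : F.map = G.map) :
    (eqIso h h').inv.app = G.obj ≫ B.ident := rfl

end

/-- The associator (an identity). -/
def assocIso {A B D E : InternalCat C} (F : A ⟶ B) (G : B ⟶ D) (H : D ⟶ E) :
    (F ≫ G) ≫ H ≅ F ≫ (G ≫ H) :=
  eqIso (Category.assoc F.obj G.obj H.obj) (Category.assoc F.map G.map H.map)

/-- The left unitor (an identity). -/
def leftIso {A B : InternalCat C} (F : A ⟶ B) : 𝟙 A ≫ F ≅ F :=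
  eqIso (Category.id_comp F.obj) (Category.id_comp F.map)

/-- The right unitor (an identity). -/
def rightIso {A B : InternalCat C} (F : A ⟶ B) : F ≫ 𝟙 B ≅ F :=
  eqIso (Category.comp_id F.obj) (Category.comp_id F.map)

section

variable {A B D E : InternalCat C} (F : A ⟶ B) (G : B ⟶ D) (H : D ⟶ E)

@[simp] lemma assocIso_hom_app :
    (assocIso F G H).hom.app = (F.obj ≫ G.obj ≫ H.obj) ≫ E.ident := by
  simp [assocIso]
@[simp] lemma assocIso_inv_app :
    (assocIso F G H).inv.app = (F.obj ≫ G.obj ≫ H.obj) ≫ E.ident := by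
  simp [assocIso]
@[simp] lemma leftIso_hom_app : (leftIso F).hom.app = F.obj ≫ B.ident := by simp [leftIso]
@[simp] lemma leftIso_inv_app : (leftIso F).inv.app = F.obj ≫ B.ident := by simp [leftIso]
@[simp] lemma rightIso_hom_app : (rightIso F).hom.app = F.obj ≫ B.ident := by simp [rightIso]
@[simp] lemma rightIso_inv_app : (rightIso F).inv.app = F.obj ≫ B.ident := by simp [rightIso]

end

/-- Internal categories, internal functors and internal natural transformations. -/
instance : Bicategory (InternalCat C) where
  whiskerLeft F _ _ α := whiskerL F α
  whiskerRight α H := whiskerR α H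
  associator F G H := assocIso F G H
  leftUnitor F := leftIso F
  rightUnitor F := rightIso F
  whiskerLeft_id F G := by ext; simp
  whiskerLeft_comp F _ _ _ α β := by ext; simp
  id_whiskerLeft := by intros; ext; simp
  comp_whiskerLeft := by intros; ext; simp
  id_whiskerRight := by intros; ext; simp
  comp_whiskerRight := by intros; ext; simp
  whiskerRight_id := by intros; ext; simp
  whiskerRight_comp := by intros; ext; simp
  whisker_assoc := by intros; ext; simp
  whisker_exchange {_ _ _ f g h i} η θ := by
    ext
    simpa using (θ.nat' η.app f.obj g.obj (by simp) (by simp) (by simp) (by simp)).symm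
  pentagon {_ _ _ _ e} f g h i := by
    ext
    have key := e.ident_compose' (f.obj ≫ g.obj ≫ h.obj ≫ i.obj)
      ((f.obj ≫ g.obj ≫ h.obj ≫ i.obj) ≫ e.ident) (by simp)
    simp only [Category.assoc] at key
    simp [key]
  triangle := by intros; ext; simp

lemma eqToHom_app {A B : InternalCat C} {F G : A ⟶ B} (h : F = G) :
    (eqToHom h).app = F.obj ≫ B.ident := by
  subst h
  simp

instance : Bicategory.Strict (InternalCat C) where
  id_comp _ := hom_ext (Category.id_comp _) (Category.id_comp _)
  comp_id _ := hom_ext (Category.comp_id _) (Category.comp_id _)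
  assoc _ _ _ := hom_ext (Category.assoc _ _ _) (Category.assoc _ _ _)
  leftUnitor_eqToIso F := by
    ext
    exact (leftIso_hom_app F).trans (by simp [eqToHom_app])
  rightUnitor_eqToIso F := by
    ext
    exact (rightIso_hom_app F).trans (by simp [eqToHom_app])
  associator_eqToIso F G H := by
    ext
    exact (assocIso_hom_app F G H).trans (by simp [eqToHom_app])

end InternalCat
end Internal

/-! ### The 2-monad on internal categories induced by a cartesian monad -/

set_option linter.unusedSectionVars false

section TwoMonad

variable {C : Type u} [Category.{v} C] [HasFiniteLimits C]

/-- A monad is cartesian if its functor preserves pullbacks and all naturality squares of its unit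
and multiplication are pullbacks. -/
class IsCartesianMonad (T : Monad C) : Prop where
  preserves : PreservesLimitsOfShape WalkingCospan T.toFunctor
  unit_cartesian : NatTrans.Equifibered T.η
  mul_cartesian : NatTrans.Equifibered T.μ

attribute [instance] IsCartesianMonad.preserves

namespace InternalCat

variable (T : Monad C) [IsCartesianMonad T]

lemma T_isPullback (A : CatData C) :
    IsPullback (T.map (pullback.fst A.tgt A.src)) (T.map (pullback.snd A.tgt A.src))
      (T.map A.tgt) (T.map A.src) :=
  (IsPullback.of_hasPullback A.tgt A.src).map T.toFunctor

/-- `T` applied to the data of a category object; composition is transported along the canonical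
isomorphism `T (A₁ ×_{A₀} A₁) ≅ T A₁ ×_{T A₀} T A₁`. -/
abbrev TData (A : CatData C) : CatData C where
  ob := T.obj A.ob
  mor := T.obj A.mor
  src := T.map A.src
  tgt := T.map A.tgt
  ident := T.map A.ident
  comp := (T_isPullback T A).lift (pullback.fst _ _) (pullback.snd _ _) pullback.condition ≫
    T.map A.comp

lemma T_aux {A : CatData C} {X Y : C} (k : Y ⟶ T.obj X) {f g : X ⟶ A.mor}
    (h : f ≫ A.tgt = g ≫ A.src) :
    (k ≫ T.map f) ≫ T.map A.tgt = (k ≫ T.map g) ≫ T.map A.src := by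
  rw [Category.assoc, Category.assoc, ← T.map_comp, ← T.map_comp, h]

lemma T_compose_lift (A : CatData C) {Y : C} (f g : Y ⟶ T.obj A.mor)
    (h : f ≫ T.map A.tgt = g ≫ T.map A.src) :
    (TData T A).compose f g h = (T_isPullback T A).lift f g h ≫ T.map A.comp := by
  unfold CatData.compose
  change _ ≫ _ ≫ T.map A.comp = _
  rw [← Category.assoc]
  congr 1
  apply (T_isPullback T A).hom_ext
  · rw [Category.assoc, IsPullback.lift_fst, IsPullback.lift_fst]
    exact pullback.lift_fst _ _ _
  · rw [Category.assoc, IsPullback.lift_snd, IsPullback.lift_snd]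
    exact pullback.lift_snd _ _ _

/-- `T` preserves composites of generalised arrows, also after reindexing. -/
lemma T_compose (A : CatData C) {X Y : C} (k : Y ⟶ T.obj X) (f g : X ⟶ A.mor)
    (h : f ≫ A.tgt = g ≫ A.src) :
    (TData T A).compose (k ≫ T.map f) (k ≫ T.map g) (T_aux T k h) = k ≫ T.map (A.compose f g h) := by
  rw [T_compose_lift, CatData.compose, T.map_comp, ← Category.assoc]
  congr 1
  apply (T_isPullback T A).hom_ext
  · rw [IsPullback.lift_fst, Category.assoc, ← T.map_comp, pullback.lift_fst]
  · rw [IsPullback.lift_snd, Category.assoc, ← T.map_comp, pullback.lift_snd]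

/-- Any composable pair of arrows of `T A` comes from the universal composable pair of `A`. -/
lemma T_pair (A : CatData C) {Y : C} (f g : Y ⟶ T.obj A.mor)
    (h : f ≫ T.map A.tgt = g ≫ T.map A.src) :
    ∃ k : Y ⟶ T.obj (pullback A.tgt A.src),
      f = k ≫ T.map (pullback.fst A.tgt A.src) ∧ g = k ≫ T.map (pullback.snd A.tgt A.src) :=
  ⟨(T_isPullback T A).lift f g h, by simp, by simp⟩

/-- Any composable triple of arrows of `T A` comes from a composable triple of `A`. -/
lemma T_triple (A : CatData C) {Y : C} (f g l : Y ⟶ T.obj A.mor)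
    (h : f ≫ T.map A.tgt = g ≫ T.map A.src) (h' : g ≫ T.map A.tgt = l ≫ T.map A.src) :
    ∃ (P : C) (k : Y ⟶ T.obj P) (u v w : P ⟶ A.mor), u ≫ A.tgt = v ≫ A.src ∧
      v ≫ A.tgt = w ≫ A.src ∧ f = k ≫ T.map u ∧ g = k ≫ T.map v ∧ l = k ≫ T.map w := by
  obtain ⟨k, rfl, rfl⟩ := T_pair T A f g h
  have hp := (IsPullback.of_hasPullback (pullback.snd A.tgt A.src ≫ A.tgt) A.src).map T.toFunctor
  obtain ⟨q, hq, rfl⟩ : ∃ q, q ≫ T.map (pullback.fst (pullback.snd A.tgt A.src ≫ A.tgt) A.src) = k ∧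
      q ≫ T.map (pullback.snd (pullback.snd A.tgt A.src ≫ A.tgt) A.src) = l :=
    ⟨hp.lift k l (by simpa using h'), by simp, by simp⟩
  refine ⟨pullback (pullback.snd A.tgt A.src ≫ A.tgt) A.src, q,
    pullback.fst _ _ ≫ pullback.fst _ _, pullback.fst _ _ ≫ pullback.snd _ _,
    pullback.snd _ _, ?_, ?_, ?_, ?_, ?_⟩
  · simp [pullback.condition]
  · simpa using pullback.condition
  · rw [T.map_comp, reassoc_of% hq]
  · rw [T.map_comp, reassoc_of% hq]
  · rfl

/-- The internal category `T A`. -/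
abbrev TObj (A : InternalCat C) : InternalCat C where
  toCatData := TData T A.toCatData
  ident_src := by
    change T.map A.ident ≫ T.map A.src = 𝟙 (T.obj A.ob)
    rw [← T.map_comp, A.ident_src, T.map_id]
  ident_tgt := by
    change T.map A.ident ≫ T.map A.tgt = 𝟙 (T.obj A.ob)
    rw [← T.map_comp, A.ident_tgt, T.map_id]
  comp_src := by
    change (_ ≫ T.map A.comp) ≫ T.map A.src = _
    rw [Category.assoc, ← T.map_comp, A.comp_src, T.map_comp, IsPullback.lift_fst_assoc]
  comp_tgt := by
    change (_ ≫ T.map A.comp) ≫ T.map A.tgt = _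
    rw [Category.assoc, ← T.map_comp, A.comp_tgt, T.map_comp, IsPullback.lift_snd_assoc]
  ident_compose {X} f h := by
    have e := T_compose T A.toCatData f (A.src ≫ A.ident) (𝟙 _) (by simp)
    rw [A.ident_compose'] at e
    simpa using e
  compose_ident {X} f h := by
    have e := T_compose T A.toCatData f (𝟙 _) (A.tgt ≫ A.ident) (by simp)
    rw [A.compose_ident'] at e
    simpa using e
  compose_assoc {X} f g l h₁ h₂ h₃ h₄ := by
    obtain ⟨P, k, u, v, w, h, h', rfl, rfl, rfl⟩ := T_triple T A.toCatData f g l h₁ h₂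
    have e := A.compose_assoc u v w h h' (by simp [h']) (by simp [h])
    have e1 := T_compose T A.toCatData k u v h
    have e2 := T_compose T A.toCatData k v w h'
    have e3 := T_compose T A.toCatData k (A.compose u v h) w (by simp [h'])
    have e4 := T_compose T A.toCatData k u (A.compose v w h') (by simp [h])
    simp only [e1, e2]
    rw [e3, e4, e]

/-- `T` applied to an internal functor. -/
abbrev TMap {A B : InternalCat C} (F : A ⟶ B) : TObj T A ⟶ TObj T B :=
  { obj := T.map F.obj
    map := T.map F.map
    map_src := by rw [← T.map_comp, ← T.map_comp, F.map_src]
    map_tgt := by rw [← T.map_comp, ← T.map_comp, F.map_tgt]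
    ident_map := by rw [← T.map_comp, ← T.map_comp, F.ident_map]
    compose_map := by
      intro X f g h h'
      obtain ⟨k, rfl, rfl⟩ := T_pair T A.toCatData f g h
      have e1 := T_compose T A.toCatData k _ _ pullback.condition
      have e2 := T_compose T B.toCatData k _ _ (F.map_aux (pullback.condition (f := A.tgt)))
      rw [e1, Category.assoc, ← T.map_comp, F.compose_map', ← e2]
      simp only [T.map_comp, Category.assoc] }

/-- `T` applied to an internal natural transformation. -/
abbrev TMap₂ {A B : InternalCat C} {F G : A ⟶ B} (α : F ⟶ G) : TMap T F ⟶ TMap T G :=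
  { app := T.map α.app
    app_src := by rw [← T.map_comp, α.app_src]
    app_tgt := by rw [← T.map_comp, α.app_tgt]
    naturality := by
      intro h₁ h₂
      have e1 := T_compose T B.toCatData (𝟙 _) F.map (A.tgt ≫ α.app) (by simp)
      have e2 := T_compose T B.toCatData (𝟙 _) (A.src ≫ α.app) G.map (by simp)
      rw [α.naturality (by simp) (by simp), ← e2] at e1
      simpa using e1 }

/-- The unit `A ⟶ T A`. -/
abbrev Tη (A : InternalCat C) : A ⟶ TObj T A :=
  { obj := T.η.app A.ob
    map := T.η.app A.mor
    map_src := (T.η.naturality A.src).symm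
    map_tgt := (T.η.naturality A.tgt).symm
    ident_map := T.η.naturality A.ident
    compose_map := by
      intro X f g h h'
      have e := T_compose T A.toCatData (T.η.app X) f g h
      have n1 := T.η.naturality f
      have n2 := T.η.naturality g
      have n3 := T.η.naturality (A.compose f g h)
      simp only [Functor.id_obj, Functor.id_map] at n1 n2 n3
      rw [n3, ← e]
      simp only [n1, n2] }

/-- The multiplication `T (T A) ⟶ T A`. -/
abbrev Tμ (A : InternalCat C) : TObj T (TObj T A) ⟶ TObj T A :=
  { obj := T.μ.app A.ob
    map := T.μ.app A.mor
    map_src := (T.μ.naturality A.src).symm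
    map_tgt := (T.μ.naturality A.tgt).symm
    ident_map := T.μ.naturality A.ident
    compose_map := by
      intro X f g h h'
      obtain ⟨k, rfl, rfl⟩ := T_pair T (TObj T A).toCatData f g h
      obtain ⟨q, h₁, h₂⟩ := T_pair T A.toCatData (pullback.fst (T.map A.tgt) (T.map A.src))
        (pullback.snd (T.map A.tgt) (T.map A.src)) pullback.condition
      have e1 := T_compose T (TObj T A).toCatData k _ _
        (pullback.condition (f := T.map A.tgt) (g := T.map A.src))
      have e2 := T_compose T A.toCatData q _ _ (pullback.condition (f := A.tgt) (g := A.src))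
      have e3 := T_compose T A.toCatData (k ≫ T.map q ≫ T.μ.app _) _ _
        (pullback.condition (f := A.tgt) (g := A.src))
      have n : ∀ {X Y : C} (u : X ⟶ Y), T.map (T.map u) ≫ T.μ.app Y = T.μ.app X ≫ T.map u :=
        fun u => T.μ.naturality u
      rw [e1]
      simp only [h₁, h₂]
      rw [e2]
      simp only [T.map_comp, Category.assoc, n]
      simpa only [Category.assoc] using e3.symm }

end InternalCat
end TwoMonad

/-! ### Categorical `T`-algebras -/

section CategoricalAlgebras

variable {C : Type u} [Category.{v} C] [HasFiniteLimits C] (T : Monad C) [IsCartesianMonad T]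

open InternalCat

/-- A categorical `T`-algebra: a strict algebra for the 2-monad on internal categories. -/
structure CatAlg where
  cat : InternalCat C
  act : TObj T cat ⟶ cat
  unit : Tη T cat ≫ act = 𝟙 cat
  assoc : Tμ T cat ≫ act = TMap T act ≫ act

namespace CatAlg

variable {T}

section

variable (A : CatAlg T)

@[simp] lemma unit_obj : T.η.app A.cat.ob ≫ A.act.obj = 𝟙 _ := congrArg IFunctor.obj A.unit
@[simp] lemma unit_map : T.η.app A.cat.mor ≫ A.act.map = 𝟙 _ := congrArg IFunctor.map A.unit
lemma assoc_obj : T.μ.app A.cat.ob ≫ A.act.obj = T.map A.act.obj ≫ A.act.obj :=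
  congrArg IFunctor.obj A.assoc
lemma assoc_map : T.μ.app A.cat.mor ≫ A.act.map = T.map A.act.map ≫ A.act.map :=
  congrArg IFunctor.map A.assoc

end

/-- A strict morphism of categorical `T`-algebras. -/
@[ext]
structure Hom (A B : CatAlg T) where
  func : A.cat ⟶ B.cat
  comm : TMap T func ≫ B.act = A.act ≫ func

lemma Hom.comm_obj {A B : CatAlg T} (F : Hom A B) :
    T.map F.func.obj ≫ B.act.obj = A.act.obj ≫ F.func.obj := congrArg IFunctor.obj F.comm

lemma Hom.comm_map {A B : CatAlg T} (F : Hom A B) :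
    T.map F.func.map ≫ B.act.map = A.act.map ≫ F.func.map := congrArg IFunctor.map F.comm

/-- A transformation of strict morphisms: an internal natural transformation `α` such that the
whiskered transformations `B.act ∘ T α` and `α ∘ A.act` coincide (they have the same components). -/
@[ext]
structure Hom₂ {A B : CatAlg T} (F G : Hom A B) where
  trans : F.func ⟶ G.func
  comm : (TMap₂ T trans ▷ B.act).app = (A.act ◁ trans).app

lemma Hom₂.comm_app {A B : CatAlg T} {F G : Hom A B} (α : Hom₂ F G) :
    T.map α.trans.app ≫ B.act.map = A.act.obj ≫ α.trans.app := α.comm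

instance : CategoryStruct (CatAlg T) where
  Hom := Hom
  id A :=
    { func := 𝟙 _
      comm := by
        apply hom_ext
        · change T.map (𝟙 _) ≫ A.act.obj = A.act.obj ≫ 𝟙 _
          simp
        · change T.map (𝟙 _) ≫ A.act.map = A.act.map ≫ 𝟙 _
          simp }
  comp {A B D} F G :=
    { func := F.func ≫ G.func
      comm := by
        apply hom_ext
        · change T.map (F.func.obj ≫ G.func.obj) ≫ D.act.obj =
            A.act.obj ≫ F.func.obj ≫ G.func.obj
          rw [T.map_comp, Category.assoc, G.comm_obj, ← Category.assoc, F.comm_obj, Category.assoc]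
        · change T.map (F.func.map ≫ G.func.map) ≫ D.act.map =
            A.act.map ≫ F.func.map ≫ G.func.map
          rw [T.map_comp, Category.assoc, G.comm_map, ← Category.assoc, F.comm_map,
            Category.assoc] }

section

variable {A B D E : CatAlg T}

@[ext] lemma hom_ext' {F G : A ⟶ B} (h : F.func = G.func) : F = G := Hom.ext h

@[simp] lemma id_func (A : CatAlg T) : Hom.func (𝟙 A) = 𝟙 A.cat := rfl
@[simp] lemma comp_func (F : A ⟶ B) (G : B ⟶ D) : (F ≫ G).func = F.func ≫ G.func := rfl

lemma ident_aux (F : Hom A B) :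
    T.map (F.func.obj ≫ B.cat.ident) ≫ B.act.map = A.act.obj ≫ F.func.obj ≫ B.cat.ident := by
  have := B.act.ident_map
  change T.map B.cat.ident ≫ B.act.map = _ at this
  rw [T.map_comp, Category.assoc, this, ← Category.assoc, F.comm_obj, Category.assoc]

instance : Category (A ⟶ B) where
  Hom F G := Hom₂ F G
  id F :=
    { trans := 𝟙 F.func
      comm := ident_aux F }
  comp {F G H} α β :=
    { trans := α.trans ≫ β.trans
      comm := by
        have e := T_compose T B.cat.toCatData (𝟙 _) α.trans.app β.trans.app
          (comp_app_aux α.trans β.trans)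
        have e' : T.map (B.cat.compose α.trans.app β.trans.app (comp_app_aux α.trans β.trans)) =
          (TObj T B.cat).compose (T.map α.trans.app) (T.map β.trans.app) (by
            simpa using T_aux T (𝟙 _) (comp_app_aux α.trans β.trans)) := by
          simpa using e.symm
        change T.map (B.cat.compose α.trans.app β.trans.app _) ≫ B.act.map =
          A.act.obj ≫ B.cat.compose α.trans.app β.trans.app _
        rw [e', B.act.compose_map', precomp_compose]
        exact B.cat.compose_congr α.comm_app β.comm_app _ }
  id_comp _ := Hom₂.ext (Category.id_comp _)
  comp_id _ := Hom₂.ext (Category.comp_id _)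
  assoc _ _ _ := Hom₂.ext (Category.assoc _ _ _)

@[ext] lemma hom₂_ext {F G : A ⟶ B} {α β : F ⟶ G} (h : α.trans = β.trans) : α = β :=
  Hom₂.ext h

@[simp] lemma id_trans (F : A ⟶ B) : Hom₂.trans (𝟙 F) = 𝟙 F.func := rfl
@[simp] lemma comp_trans {F G H : A ⟶ B} (α : F ⟶ G) (β : G ⟶ H) :
    (α ≫ β).trans = α.trans ≫ β.trans := rfl

/-- An invertible 2-cell between strict morphisms from one between the underlying functors whose
components are identities. -/
def idIso {F G : A ⟶ B} (e : F.func ≅ G.func) (h : e.hom.app = F.func.obj ≫ B.cat.ident)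
    (h' : e.inv.app = G.func.obj ≫ B.cat.ident) : F ≅ G where
  hom := { trans := e.hom, comm := by
            change T.map e.hom.app ≫ B.act.map = A.act.obj ≫ e.hom.app
            rw [h, ident_aux] }
  inv := { trans := e.inv, comm := by
            change T.map e.inv.app ≫ B.act.map = A.act.obj ≫ e.inv.app
            rw [h', ident_aux] }
  hom_inv_id := Hom₂.ext e.hom_inv_id
  inv_hom_id := Hom₂.ext e.inv_hom_id

@[simp] lemma idIso_hom_trans {F G : A ⟶ B} (e : F.func ≅ G.func) (h h') :
    (idIso (F := F) (G := G) e h h').hom.trans = e.hom := rfl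
@[simp] lemma idIso_inv_trans {F G : A ⟶ B} (e : F.func ≅ G.func) (h h') :
    (idIso (F := F) (G := G) e h h').inv.trans = e.inv := rfl

end

/-- Whiskering on the left. -/
def whiskerL {A B D : CatAlg T} (F : A ⟶ B) {G H : B ⟶ D} (α : G ⟶ H) : F ≫ G ⟶ F ≫ H :=
  { trans := F.func ◁ α.trans
    comm := by
      change T.map (F.func.obj ≫ α.trans.app) ≫ D.act.map =
        A.act.obj ≫ F.func.obj ≫ α.trans.app
      rw [T.map_comp, Category.assoc, α.comm_app, ← Category.assoc, F.comm_obj, Category.assoc] }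

/-- Whiskering on the right. -/
def whiskerR {A B D : CatAlg T} {F G : A ⟶ B} (α : F ⟶ G) (H : B ⟶ D) : F ≫ H ⟶ G ≫ H :=
  { trans := α.trans ▷ H.func
    comm := by
      change T.map (α.trans.app ≫ H.func.map) ≫ D.act.map =
        A.act.obj ≫ α.trans.app ≫ H.func.map
      rw [T.map_comp, Category.assoc, H.comm_map, ← Category.assoc, α.comm_app, Category.assoc] }

/-- The associator (an identity). -/
def assocIso {A B D E : CatAlg T} (F : A ⟶ B) (G : B ⟶ D) (H : D ⟶ E) :
    (F ≫ G) ≫ H ≅ F ≫ (G ≫ H) :=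
  idIso (α_ F.func G.func H.func) rfl rfl

/-- The left unitor (an identity). -/
def leftIso {A B : CatAlg T} (F : A ⟶ B) : 𝟙 A ≫ F ≅ F :=
  idIso (λ_ F.func) rfl rfl

/-- The right unitor (an identity). -/
def rightIso {A B : CatAlg T} (F : A ⟶ B) : F ≫ 𝟙 B ≅ F :=
  idIso (ρ_ F.func) rfl rfl

/-- The 2-category of categorical `T`-algebras, strict morphisms and transformations. -/
instance : Bicategory (CatAlg T) where
  whiskerLeft F _ _ α := whiskerL F α
  whiskerRight α H := whiskerR α H
  associator F G H := assocIso F G H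
  leftUnitor F := leftIso F
  rightUnitor F := rightIso F
  whiskerLeft_id _ _ := Hom₂.ext (Bicategory.whiskerLeft_id _ _)
  whiskerLeft_comp _ _ _ _ _ _ := Hom₂.ext (Bicategory.whiskerLeft_comp _ _ _)
  id_whiskerLeft _ := Hom₂.ext (Bicategory.id_whiskerLeft _)
  comp_whiskerLeft _ _ _ _ _ := Hom₂.ext (Bicategory.comp_whiskerLeft _ _ _)
  id_whiskerRight _ _ := Hom₂.ext (Bicategory.id_whiskerRight _ _)
  comp_whiskerRight _ _ _ := Hom₂.ext (Bicategory.comp_whiskerRight _ _ _)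
  whiskerRight_id _ := Hom₂.ext (Bicategory.whiskerRight_id _)
  whiskerRight_comp _ _ _ := Hom₂.ext (Bicategory.whiskerRight_comp _ _ _)
  whisker_assoc _ _ _ _ _ := Hom₂.ext (Bicategory.whisker_assoc _ _ _)
  whisker_exchange _ _ := Hom₂.ext (Bicategory.whisker_exchange _ _)
  pentagon _ _ _ _ := Hom₂.ext (Bicategory.pentagon _ _ _ _)
  triangle F G := Hom₂.ext (Bicategory.triangle (Hom.func F) (Hom.func G))

lemma eqToHom_trans_app {A B : CatAlg T} {F G : A ⟶ B} (h : F = G) :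
    (Hom₂.trans (eqToHom h)).app = (Hom.func F).obj ≫ B.cat.ident := by
  subst h
  rfl

lemma iso_eq {A B : CatAlg T} {F G : A ⟶ B} (e : F ≅ G) (h : F = G)
    (h' : e.hom.trans.app = F.func.obj ≫ B.cat.ident) : e = eqToIso h := by
  ext
  rw [h', eqToIso.hom, eqToHom_trans_app]

lemma assoc_eq {A B D E : CatAlg T} (F : A ⟶ B) (G : B ⟶ D) (H : D ⟶ E) :
    (F ≫ G) ≫ H = F ≫ G ≫ H :=
  Hom.ext (Bicategory.Strict.assoc F.func G.func H.func)

lemma id_comp_eq {A B : CatAlg T} (F : A ⟶ B) : 𝟙 A ≫ F = F :=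
  Hom.ext (Bicategory.Strict.id_comp F.func)

lemma comp_id_eq {A B : CatAlg T} (F : A ⟶ B) : F ≫ 𝟙 B = F :=
  Hom.ext (Bicategory.Strict.comp_id F.func)

lemma assocIso_eq {A B D E : CatAlg T} (F : A ⟶ B) (G : B ⟶ D) (H : D ⟶ E) :
    assocIso F G H = eqToIso (assoc_eq F G H) :=
  iso_eq _ _ ((InternalCat.assocIso_hom_app F.func G.func H.func).trans (by simp))

lemma leftIso_eq {A B : CatAlg T} (F : A ⟶ B) : leftIso F = eqToIso (id_comp_eq F) :=
  iso_eq _ _ ((InternalCat.leftIso_hom_app F.func).trans (by simp))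

lemma rightIso_eq {A B : CatAlg T} (F : A ⟶ B) : rightIso F = eqToIso (comp_id_eq F) :=
  iso_eq _ _ ((InternalCat.rightIso_hom_app F.func).trans (by simp))

instance : Bicategory.Strict (CatAlg T) where
  id_comp F := id_comp_eq F
  comp_id F := comp_id_eq F
  assoc F G H := assoc_eq F G H
  leftUnitor_eqToIso F := leftIso_eq F
  rightUnitor_eqToIso F := rightIso_eq F
  associator_eqToIso F G H := assocIso_eq F G H

end CatAlg
end CategoricalAlgebras

section Auxiliary

lemma cat_conj {X Y : Cat.{v, u}} {F F' G G' : X ⟶ Y} (h : F = F') (α : F' ⟶ G') (h' : G' = G)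
    (β : F ⟶ G)
    (e : ∀ x : X, β.toNatTrans.app x = eqToHom (by rw [h]) ≫ α.toNatTrans.app x ≫
      eqToHom (by rw [h'])) :
    β = eqToHom h ≫ α ≫ eqToHom h' := by
  subst h h'
  ext x
  simpa using e x

variable {B : Type u'} [Bicategory.{v, v} B] [Bicategory.Strict B] {H A A' A'' : B}

lemma strict_whiskerRight_id {f g : H ⟶ A} (u : f ⟶ g) :
    u ▷ 𝟙 A = eqToHom (Bicategory.Strict.comp_id f) ≫ u ≫
      eqToHom (Bicategory.Strict.comp_id g).symm := by
  rw [Bicategory.whiskerRight_id, Bicategory.Strict.rightUnitor_eqToIso,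
    Bicategory.Strict.rightUnitor_eqToIso]
  rfl

lemma strict_whiskerRight_comp {f g : H ⟶ A} (u : f ⟶ g) (G : A ⟶ A') (K : A' ⟶ A'') :
    u ▷ (G ≫ K) = eqToHom (Bicategory.Strict.assoc f G K).symm ≫ (u ▷ G) ▷ K ≫
      eqToHom (Bicategory.Strict.assoc g G K) := by
  rw [Bicategory.whiskerRight_comp, Bicategory.Strict.associator_eqToIso,
    Bicategory.Strict.associator_eqToIso]
  rfl

lemma strict_whisker_left (g : H ⟶ A) (f : A ⟶ A') {K K' : A' ⟶ A''} (η : K ⟶ K') :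
    g ◁ (f ◁ η) = eqToHom (Bicategory.Strict.assoc g f K).symm ≫ (g ≫ f) ◁ η ≫
      eqToHom (Bicategory.Strict.assoc g f K') := by
  rw [Bicategory.comp_whiskerLeft, Bicategory.Strict.associator_eqToIso,
    Bicategory.Strict.associator_eqToIso]
  simp

lemma strict_whisker_right (g : H ⟶ A) {f f' : A ⟶ A'} (η : f ⟶ f') (K : A' ⟶ A'') :
    g ◁ (η ▷ K) = eqToHom (Bicategory.Strict.assoc g f K).symm ≫ (g ◁ η) ▷ K ≫
      eqToHom (Bicategory.Strict.assoc g f' K) := by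
  rw [Bicategory.whisker_assoc, Bicategory.Strict.associator_eqToIso,
    Bicategory.Strict.associator_eqToIso]
  simp

end Auxiliary

/-! ### Lax morphisms and internal algebras -/

section Lax

variable {C : Type u} [Category.{v} C] [HasFiniteLimits C] {T : Monad C} [IsCartesianMonad T]

open InternalCat

/-- A lax morphism of categorical `T`-algebras: an internal functor `f` with a transformation
`φ : B.act ∘ T f ⇒ f ∘ A.act`.  The unit axiom says that `φ` restricted along `A ⟶ T A` is the
identity of `f`; the associativity axiom says that `φ` restricted along `T (T A) ⟶ T A` is the
composite of `B.act ∘ T φ` followed by `φ` restricted along `T A.act`. -/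
@[ext]
structure LaxHom (A B : CatAlg T) where
  func : A.cat ⟶ B.cat
  cell : TMap T func ≫ B.act ⟶ A.act ≫ func
  cell_unit : T.η.app A.cat.ob ≫ cell.app = func.obj ≫ B.cat.ident
  cell_assoc : ∀ h : (T.map cell.app ≫ B.act.map) ≫ B.cat.tgt =
      (T.map A.act.obj ≫ cell.app) ≫ B.cat.src,
    T.μ.app A.cat.ob ≫ cell.app =
      B.cat.compose (T.map cell.app ≫ B.act.map) (T.map A.act.obj ≫ cell.app) h

namespace LaxHom

variable {A B D : CatAlg T}

lemma cell_src (f : LaxHom A B) : f.cell.app ≫ B.cat.src = T.map f.func.obj ≫ B.act.obj :=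
  f.cell.app_src

lemma cell_tgt (f : LaxHom A B) : f.cell.app ≫ B.cat.tgt = A.act.obj ≫ f.func.obj :=
  f.cell.app_tgt

lemma act_src (B : CatAlg T) {X : C} (u : X ⟶ B.cat.mor) :
    (T.map u ≫ B.act.map) ≫ B.cat.src = T.map (u ≫ B.cat.src) ≫ B.act.obj := by
  have := B.act.map_src
  change _ = T.map B.cat.src ≫ _ at this
  rw [Category.assoc, this, T.map_comp, Category.assoc]

lemma act_tgt (B : CatAlg T) {X : C} (u : X ⟶ B.cat.mor) :
    (T.map u ≫ B.act.map) ≫ B.cat.tgt = T.map (u ≫ B.cat.tgt) ≫ B.act.obj := by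
  have := B.act.map_tgt
  change _ = T.map B.cat.tgt ≫ _ at this
  rw [Category.assoc, this, T.map_comp, Category.assoc]

lemma act_aux (B : CatAlg T) {X : C} {u w : X ⟶ B.cat.mor} (h : u ≫ B.cat.tgt = w ≫ B.cat.src) :
    (T.map u ≫ B.act.map) ≫ B.cat.tgt = (T.map w ≫ B.act.map) ≫ B.cat.src := by
  rw [act_src, act_tgt, h]

/-- The action is compatible with composition of generalised arrows. -/
lemma act_compose (B : CatAlg T) {X : C} (u w : X ⟶ B.cat.mor)
    (h : u ≫ B.cat.tgt = w ≫ B.cat.src) :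
    T.map (B.cat.compose u w h) ≫ B.act.map =
      B.cat.compose (T.map u ≫ B.act.map) (T.map w ≫ B.act.map) (act_aux B h) := by
  have e := T_compose T B.cat.toCatData (𝟙 _) u w h
  have e' : T.map (B.cat.compose u w h) =
      (TObj T B.cat).compose (T.map u) (T.map w) (by simpa using T_aux T (𝟙 _) h) := by
    simpa using e.symm
  rw [e', B.act.compose_map']

lemma act_ident (B : CatAlg T) {X : C} (x : X ⟶ B.cat.ob) :
    T.map (x ≫ B.cat.ident) ≫ B.act.map = (T.map x ≫ B.act.obj) ≫ B.cat.ident := by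
  have := B.act.ident_map
  change T.map B.cat.ident ≫ B.act.map = _ at this
  rw [T.map_comp, Category.assoc, this, Category.assoc]

lemma cell_aux (f : LaxHom A B) : (T.map f.cell.app ≫ B.act.map) ≫ B.cat.tgt =
      (T.map A.act.obj ≫ f.cell.app) ≫ B.cat.src := by
  rw [act_tgt, cell_tgt, Category.assoc, cell_src, T.map_comp, Category.assoc]

/-- A transformation of lax morphisms `(f, φ) ⇒ (g, ψ)`: an internal natural transformation
`α : f ⇒ g` such that `φ` followed by `α ∘ A.act` equals `B.act ∘ T α` followed by `ψ`. -/
@[ext]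
structure Trans (f g : LaxHom A B) where
  trans : f.func ⟶ g.func
  comm : ∀ (h₁ : f.cell.app ≫ B.cat.tgt = (A.act.obj ≫ trans.app) ≫ B.cat.src)
      (h₂ : (T.map trans.app ≫ B.act.map) ≫ B.cat.tgt = g.cell.app ≫ B.cat.src),
    B.cat.compose f.cell.app (A.act.obj ≫ trans.app) h₁ =
      B.cat.compose (T.map trans.app ≫ B.act.map) g.cell.app h₂

lemma trans_aux₁ (f : LaxHom A B) {g : LaxHom A B} (α : f.func ⟶ g.func) :
    f.cell.app ≫ B.cat.tgt = (A.act.obj ≫ α.app) ≫ B.cat.src := by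
  rw [cell_tgt, Category.assoc, α.app_src]

lemma trans_aux₂ {f : LaxHom A B} (g : LaxHom A B) (α : f.func ⟶ g.func) :
    (T.map α.app ≫ B.act.map) ≫ B.cat.tgt = g.cell.app ≫ B.cat.src := by
  rw [act_tgt, α.app_tgt, cell_src]

instance : Category (LaxHom A B) where
  Hom f g := Trans f g
  id f :=
    { trans := 𝟙 f.func
      comm := by
        intro h₁ h₂
        have e := act_ident B f.func.obj
        simp only [InternalCat.id_app]
        rw [B.cat.compose_congr e rfl, compose_ident₂, ident_compose'] }
  comp {f g l} α β :=
    { trans := α.trans ≫ β.trans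
      comm := by
        intro h₁ h₂
        have a1 := trans_aux₁ f α.trans
        have a2 := trans_aux₂ g α.trans
        have b1 := trans_aux₁ g β.trans
        have b2 := trans_aux₂ l β.trans
        have c := comp_app_aux α.trans β.trans
        have c1 := B.cat.precomp_aux A.act.obj c
        have c2 := act_aux B c
        have e1 := B.cat.compose_assoc f.cell.app (A.act.obj ≫ α.trans.app)
          (A.act.obj ≫ β.trans.app) a1 c1 (by rw [compose_tgt, c1]) (by rw [compose_src, a1])
        have e2 := B.cat.compose_assoc (T.map α.trans.app ≫ B.act.map) g.cell.app
          (A.act.obj ≫ β.trans.app) a2 b1 (by rw [compose_tgt, b1]) (by rw [compose_src, a2])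
        have e3 := B.cat.compose_assoc (T.map α.trans.app ≫ B.act.map)
          (T.map β.trans.app ≫ B.act.map) l.cell.app c2 b2
          (by rw [compose_tgt, b2]) (by rw [compose_src, c2])
        have e4 := act_compose B _ _ c
        have e5 := B.cat.precomp_compose A.act.obj _ _ c
        simp only [InternalCat.comp_app]
        rw [B.cat.compose_congr rfl e5, B.cat.compose_congr e4 rfl, ← e1, e3,
          B.cat.compose_congr (α.comm a1 a2) rfl, e2, B.cat.compose_congr rfl (β.comm b1 b2)] }
  id_comp _ := Trans.ext (Category.id_comp _)
  comp_id _ := Trans.ext (Category.comp_id _)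
  assoc _ _ _ := Trans.ext (Category.assoc _ _ _)

@[ext] lemma trans_ext {f g : LaxHom A B} {α β : f ⟶ g} (h : α.trans = β.trans) : α = β :=
  Trans.ext h

@[simp] lemma id_trans (f : LaxHom A B) : Trans.trans (𝟙 f) = 𝟙 f.func := rfl
@[simp] lemma comp_trans {f g h : LaxHom A B} (α : f ⟶ g) (β : g ⟶ h) :
    (α ≫ β).trans = α.trans ≫ β.trans := rfl

/-- Lax morphisms with the same functor and the same components of the cell are equal. -/
lemma ext' {f g : LaxHom A B} (h₀ : f.func.obj = g.func.obj) (h₁ : f.func.map = g.func.map)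
    (h₂ : f.cell.app = g.cell.app) : f = g := by
  obtain ⟨F, φ, _, _⟩ := f
  obtain ⟨G, ψ, _, _⟩ := g
  obtain rfl : F = G := IFunctor.ext h₀ h₁
  obtain rfl : φ = ψ := INatTrans.ext h₂
  rfl

/-- The composite of a lax morphism with a strict morphism. -/
def post (f : LaxHom A B) (G : B ⟶ D) : LaxHom A D where
  func := f.func ≫ G.func
  cell :=
    { app := f.cell.app ≫ G.func.map
      app_src := by
        change _ = T.map (f.func.obj ≫ G.func.obj) ≫ D.act.obj
        rw [Category.assoc, G.func.map_src, ← Category.assoc, cell_src, T.map_comp,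
          Category.assoc, Category.assoc, G.comm_obj]
      app_tgt := by
        change _ = A.act.obj ≫ f.func.obj ≫ G.func.obj
        rw [Category.assoc, G.func.map_tgt, ← Category.assoc, cell_tgt, Category.assoc]
      naturality := by
        intro h₁ h₂
        have n₁ : (TMap T f.func ≫ B.act).map ≫ B.cat.tgt =
            (T.map A.cat.tgt ≫ f.cell.app) ≫ B.cat.src := by
          rw [IFunctor.map_tgt, Category.assoc, f.cell.app_src]
        have n₂ : (T.map A.cat.src ≫ f.cell.app) ≫ B.cat.tgt =
            (A.act ≫ f.func).map ≫ B.cat.src := by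
          rw [IFunctor.map_src, Category.assoc, f.cell.app_tgt]
        have e := congrArg (fun k => k ≫ G.func.map) (f.cell.naturality n₁ n₂)
        simp only [G.func.compose_map'] at e
        refine (D.cat.compose_congr ?_ ?_ _).trans (e.trans (D.cat.compose_congr ?_ ?_ _))
        · change T.map (f.func.map ≫ G.func.map) ≫ D.act.map =
            (T.map f.func.map ≫ B.act.map) ≫ G.func.map
          rw [T.map_comp, Category.assoc, G.comm_map, Category.assoc]
        · simp only [Category.assoc]
        · simp only [Category.assoc]
        · change (A.act.map ≫ f.func.map) ≫ G.func.map = A.act.map ≫ f.func.map ≫ G.func.map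
          rw [Category.assoc] }
  cell_unit := by
    change T.η.app A.cat.ob ≫ f.cell.app ≫ G.func.map =
      (f.func.obj ≫ G.func.obj) ≫ D.cat.ident
    rw [← Category.assoc, f.cell_unit, Category.assoc, G.func.ident_map, Category.assoc]
  cell_assoc := by
    intro h
    have e := congrArg (fun k => k ≫ G.func.map) (f.cell_assoc f.cell_aux)
    simp only [G.func.compose_map', Category.assoc] at e
    change T.μ.app A.cat.ob ≫ f.cell.app ≫ G.func.map =
      D.cat.compose (T.map (f.cell.app ≫ G.func.map) ≫ D.act.map)
        (T.map A.act.obj ≫ f.cell.app ≫ G.func.map) h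
    rw [e]
    refine D.cat.compose_congr ?_ rfl _
    rw [T.map_comp, Category.assoc, G.comm_map]

/-- Postcomposition with a strict morphism, as a functor between categories of lax morphisms. -/
def postFunctor (A : CatAlg T) {B D : CatAlg T} (G : B ⟶ D) : LaxHom A B ⥤ LaxHom A D where
  obj f := f.post G
  map {f g} α :=
    { trans := α.trans ▷ G.func
      comm := by
        intro h₁ h₂
        have e := congrArg (fun k => k ≫ G.func.map)
          (α.comm (trans_aux₁ f α.trans) (trans_aux₂ g α.trans))
        simp only [G.func.compose_map', Category.assoc] at e
        change D.cat.compose (f.cell.app ≫ G.func.map)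
            (A.act.obj ≫ α.trans.app ≫ G.func.map) h₁ =
          D.cat.compose (T.map (α.trans.app ≫ G.func.map) ≫ D.act.map)
            (g.cell.app ≫ G.func.map) h₂
        rw [e]
        refine D.cat.compose_congr ?_ rfl _
        rw [T.map_comp, Category.assoc, G.comm_map] }
  map_id f := Trans.ext (Bicategory.id_whiskerRight _ _)
  map_comp α β := Trans.ext (Bicategory.comp_whiskerRight _ _ _)

/-- A transformation of strict morphisms acts on lax morphisms by whiskering. -/
def postTrans (A : CatAlg T) {B D : CatAlg T} {G H : B ⟶ D} (β : G ⟶ H) :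
    postFunctor A G ⟶ postFunctor A H where
  app f :=
    { trans := f.func ◁ β.trans
      comm := by
        intro h₁ h₂
        have n₁ : (f.cell.app ≫ G.func.map) ≫ D.cat.tgt =
            ((A.act.obj ≫ f.func.obj) ≫ β.trans.app) ≫ D.cat.src := by
          rw [Category.assoc, G.func.map_tgt, ← Category.assoc, cell_tgt, Category.assoc,
            Category.assoc, Category.assoc, β.trans.app_src]
        have n₂ : ((T.map f.func.obj ≫ B.act.obj) ≫ β.trans.app) ≫ D.cat.tgt =
            (f.cell.app ≫ H.func.map) ≫ D.cat.src := by
          rw [Category.assoc, β.trans.app_tgt, Category.assoc (f.cell.app), H.func.map_src,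
            ← Category.assoc f.cell.app, cell_src]
        have e := β.trans.nat' f.cell.app _ _ f.cell_src f.cell_tgt n₁ n₂
        refine (D.cat.compose_congr rfl ?_ _).trans (e.trans (D.cat.compose_congr ?_ rfl _))
        · change A.act.obj ≫ f.func.obj ≫ β.trans.app = _
          rw [Category.assoc]
        · change _ = T.map (f.func.obj ≫ β.trans.app) ≫ D.act.map
          rw [T.map_comp, Category.assoc, Category.assoc, β.comm_app] }
  naturality f g α := Trans.ext (Bicategory.whisker_exchange α.trans β.trans).symm

end LaxHom

lemma LaxHom.eqToHom_trans_app {A B : CatAlg T} {f g : LaxHom A B} (h : f = g) :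
    (LaxHom.Trans.trans (eqToHom h)).app = f.func.obj ≫ B.cat.ident := by
  subst h
  rfl

lemma LaxHom.eq_conj {A B : CatAlg T} {f f' g g' : LaxHom A B} (h : f = f') (α : f' ⟶ g')
    (h' : g' = g) (β : f ⟶ g)
    (e : (LaxHom.Trans.trans β).app = (LaxHom.Trans.trans α).app) :
    β = eqToHom h ≫ α ≫ eqToHom h' := by
  subst h h'
  ext
  simp [e]

/-- Functors into a category of lax morphisms agree when they agree on functors, cells and
components. -/
lemma LaxHom.functor_ext {D : Type*} [Category D] {A B : CatAlg T} {F G : D ⥤ LaxHom A B}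
    (h₀ : ∀ X, (F.obj X).func.obj = (G.obj X).func.obj)
    (h₁ : ∀ X, (F.obj X).func.map = (G.obj X).func.map)
    (h₂ : ∀ X, (F.obj X).cell.app = (G.obj X).cell.app)
    (h₃ : ∀ {X Y : D} (u : X ⟶ Y), (F.map u).trans.app = (G.map u).trans.app) : F = G := by
  refine CategoryTheory.Functor.ext (fun X => LaxHom.ext' (h₀ X) (h₁ X) (h₂ X)) ?_
  intro X Y u
  ext
  rw [h₃]
  simp only [LaxHom.comp_trans, InternalCat.comp_app, LaxHom.eqToHom_trans_app, compose_ident',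
    ident_compose']

/-- The terminal internal category. -/
abbrev terminalCat (C : Type u) [Category.{v} C] [HasFiniteLimits C] : InternalCat C where
  ob := ⊤_ C
  mor := ⊤_ C
  src := 𝟙 _
  tgt := 𝟙 _
  ident := 𝟙 _
  comp := terminal.from _
  ident_src := by simp
  ident_tgt := by simp
  comp_src := Subsingleton.elim _ _
  comp_tgt := Subsingleton.elim _ _
  ident_compose _ _ := Subsingleton.elim _ _
  compose_ident _ _ := Subsingleton.elim _ _
  compose_assoc _ _ _ _ _ _ _ := Subsingleton.elim _ _

/-- The terminal categorical `T`-algebra. -/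
abbrev terminalAlg (T : Monad C) [IsCartesianMonad T] : CatAlg T where
  cat := terminalCat C
  act :=
    { obj := terminal.from _
      map := terminal.from _
      map_src := Subsingleton.elim _ _
      map_tgt := Subsingleton.elim _ _
      ident_map := Subsingleton.elim _ _
      compose_map _ _ _ _ := Subsingleton.elim _ _ }
  unit := InternalCat.hom_ext (Subsingleton.elim _ _) (Subsingleton.elim _ _)
  assoc := InternalCat.hom_ext (Subsingleton.elim _ _) (Subsingleton.elim _ _)

/-- The 2-functor of internal `T`-algebras: it sends a categorical `T`-algebra `A` to the category
of lax morphisms from the terminal categorical `T`-algebra to `A`. -/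
def IAlg (T : Monad C) [IsCartesianMonad T] : StrictPseudofunctor (CatAlg T) Cat.{v, v} :=
  StrictPseudofunctor.mk''
    { obj A := Cat.of (LaxHom (terminalAlg T) A)
      map G := (LaxHom.postFunctor (terminalAlg T) G).toCatHom
      map₂ β := NatTrans.toCatHom₂ (LaxHom.postTrans (terminalAlg T) β)
      map₂_id G := by
        apply Cat.Hom₂.ext
        apply CategoryTheory.NatTrans.ext
        funext f
        exact LaxHom.trans_ext (Bicategory.whiskerLeft_id (LaxHom.func f) (CatAlg.Hom.func G))
      map₂_comp α β := by
        apply Cat.Hom₂.ext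
        apply CategoryTheory.NatTrans.ext
        funext f
        exact LaxHom.trans_ext (Bicategory.whiskerLeft_comp (LaxHom.func f)
          (CatAlg.Hom₂.trans α) (CatAlg.Hom₂.trans β))
      map_id A := by
        apply Cat.ext
        apply LaxHom.functor_ext
        · intro f
          exact Category.comp_id _
        · intro f
          exact Category.comp_id _
        · intro f
          exact Category.comp_id _
        · intro f g u
          exact Category.comp_id _
      map_comp G H := by
        apply Cat.ext
        apply LaxHom.functor_ext
        · intro f
          exact (Category.assoc _ _ _).symm
        · intro f
          exact (Category.assoc _ _ _).symm
        · intro f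
          exact (Category.assoc _ _ _).symm
        · intro f g u
          exact (Category.assoc _ _ _).symm
      map₂_whisker_left G _ _ β := by
        apply cat_conj
        intro f
        exact LaxHom.eq_conj _ _ _ _ (Category.assoc _ _ _).symm
      map₂_whisker_right β K := by
        apply cat_conj
        intro f
        exact LaxHom.eq_conj _ _ _ _ (Category.assoc _ _ _).symm }

end Lax

/-! ### Representability of strict 2-functors -/

section Representable

variable {B : Type u'} [Bicategory.{v, v} B] [Bicategory.Strict B]

/-- The covariant representable 2-functor `B(H, -)`. -/
def homFunctor (H : B) : StrictPseudofunctor B Cat.{v, v} :=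
  StrictPseudofunctor.mk''
    { obj A := Cat.of (H ⟶ A)
      map G := (Bicategory.postcomp H G).toCatHom
      map₂ β := NatTrans.toCatHom₂ ((Bicategory.postcomposing H _ _).map β)
      map₂_id G := by
        ext f
        exact Bicategory.whiskerLeft_id f G
      map₂_comp α β := by
        ext f
        exact Bicategory.whiskerLeft_comp f α β
      map_id A := by
        apply Cat.ext
        refine CategoryTheory.Functor.ext (fun f => Bicategory.Strict.comp_id f) ?_
        intro f g u
        exact strict_whiskerRight_id u
      map_comp G K := by
        apply Cat.ext
        refine CategoryTheory.Functor.ext (fun f => (Bicategory.Strict.assoc f G K).symm) ?_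
        intro f g u
        exact strict_whiskerRight_comp u G K
      map₂_whisker_left f _ _ η := by
        apply cat_conj
        intro g
        exact strict_whisker_left g f η
      map₂_whisker_right η f := by
        apply cat_conj
        intro g
        exact strict_whisker_right g η f }

/-- A 2-natural isomorphism between strict 2-functors to `Cat`: isomorphisms of categories,
strictly natural with respect to 1-cells and 2-cells. -/
structure TwoNatIso (F G : StrictPseudofunctor B Cat.{v, v}) where
  app (A : B) : F.obj A ≅ G.obj A
  naturality {A A' : B} (f : A ⟶ A') : F.map f ≫ (app A').hom = (app A).hom ≫ G.map f
  naturality₂ {A A' : B} {f g : A ⟶ A'} (α : f ⟶ g) :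
    F.map₂ α ▷ (app A').hom =
      eqToHom (naturality f) ≫ (app A).hom ◁ G.map₂ α ≫ eqToHom (naturality g).symm

end Representable

/-! ### The cotriple resolution -/

section Cotriple

variable {D : Type u} [Category.{v} D] (G : Comonad D) (X : D)

/-- The iterate `Gⁿ X`. -/
def iter : ℕ → D
  | 0 => X
  | n + 1 => G.obj (iter n)

/-- The counit at the outermost factor. -/
def counitAt (n : ℕ) : iter G X (n + 1) ⟶ iter G X n := G.ε.app (iter G X n)

/-- The comultiplication at the outermost factor. -/
def comulAt (n : ℕ) : iter G X (n + 1) ⟶ iter G X (n + 2) := G.δ.app (iter G X n)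

variable {G X} in
/-- `G` applied to an operator between iterates. -/
def underG {n m : ℕ} (f : iter G X n ⟶ iter G X m) : iter G X (n + 1) ⟶ iter G X (m + 1) := G.map f

section

variable {G X}

lemma underG_id (n : ℕ) : underG (𝟙 (iter G X n)) = 𝟙 _ := G.map_id _

lemma underG_comp {n m l : ℕ} (f : iter G X n ⟶ iter G X m) (g : iter G X m ⟶ iter G X l) :
    underG (f ≫ g) = underG f ≫ underG g := G.map_comp _ _

lemma underG_counit {n m : ℕ} (f : iter G X n ⟶ iter G X m) :
    underG f ≫ counitAt G X m = counitAt G X n ≫ f := G.ε.naturality f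

lemma underG_comul {n m : ℕ} (f : iter G X n ⟶ iter G X m) :
    underG f ≫ comulAt G X m = comulAt G X n ≫ underG (underG f) := G.δ.naturality f

lemma comul_counit (n : ℕ) : comulAt G X n ≫ counitAt G X (n + 1) = 𝟙 _ :=
  G.left_counit (iter G X n)

lemma comul_under_counit (n : ℕ) : comulAt G X n ≫ underG (counitAt G X n) = 𝟙 _ :=
  G.right_counit (iter G X n)

lemma comul_coassoc (n : ℕ) :
    comulAt G X n ≫ underG (comulAt G X n) = comulAt G X n ≫ comulAt G X (n + 1) :=
  G.coassoc (iter G X n)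

end

/-- For a monotone map that misses `0`, the induced map to the remaining elements. -/
def dropZero {m n : ℕ} (f : Fin m →o Fin (n + 1)) (h : ∀ i, f i ≠ 0) : Fin m →o Fin n where
  toFun i := (f i).pred (h i)
  monotone' i j hij := by
    simpa using f.monotone hij

/-- Restriction of a monotone map to the nonzero elements of its source. -/
def tailHom {m n : ℕ} (f : Fin (m + 1) →o Fin n) : Fin m →o Fin n where
  toFun i := f i.succ
  monotone' i j hij := f.monotone (by simpa using hij)

lemma ne_zero_of_head {m n : ℕ} (f : Fin (m + 1) →o Fin (n + 1)) (h : f 0 ≠ 0) (i : Fin (m + 1)) :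
    f i ≠ 0 := by
  intro hi
  have := f.monotone (Fin.zero_le i)
  rw [hi] at this
  exact h (Fin.le_zero_iff.mp this)

/-- The operator `Gⁿ X ⟶ Gᵐ X` induced by a monotone map `f : {0,…,m-1} → {0,…,n-1}`.  The `i`-th
factor of `Gⁿ` is sent to as many factors as there are elements in the fibre of `f` over `i`, by
means of the counit (empty fibre) and of iterated comultiplications. -/
def iterMap : (n m : ℕ) → (Fin m →o Fin n) → (iter G X n ⟶ iter G X m)
  | 0, 0, _ => 𝟙 _
  | 0, _ + 1, f => (f 0).elim0
  | n + 1, 0, f => counitAt G X n ≫ iterMap n 0 (dropZero f (fun i => i.elim0))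
  | n + 1, m + 1, f =>
    if h : f 0 = 0 then
      comulAt G X n ≫ underG (iterMap (n + 1) m (tailHom f))
    else
      counitAt G X n ≫ iterMap n (m + 1) (dropZero f (ne_zero_of_head f h))
  termination_by n m => n + m

lemma iterMap_zero (f : Fin 0 →o Fin 0) : iterMap G X 0 0 f = 𝟙 _ := by
  rw [iterMap]

lemma iterMap_skip {n m : ℕ} (f : Fin m →o Fin (n + 1)) (h : ∀ i, f i ≠ 0) :
    iterMap G X (n + 1) m f = counitAt G X n ≫ iterMap G X n m (dropZero f h) := by
  cases m with
  | zero => rw [iterMap]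
  | succ m => rw [iterMap, dif_neg (h 0)]

lemma iterMap_keep {n m : ℕ} (f : Fin (m + 1) →o Fin (n + 1)) (h : f 0 = 0) :
    iterMap G X (n + 1) (m + 1) f =
      comulAt G X n ≫ underG (iterMap G X (n + 1) m (tailHom f)) := by
  rw [iterMap, dif_pos h]

lemma iterMap_id (n : ℕ) : iterMap G X n n OrderHom.id = 𝟙 _ := by
  induction n with
  | zero => exact iterMap_zero G X _
  | succ n ih =>
    have e : dropZero (tailHom (OrderHom.id : Fin (n + 1) →o Fin (n + 1)))
        (fun i => Fin.succ_ne_zero i) = OrderHom.id := by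
      apply OrderHom.ext
      funext i
      exact Fin.pred_succ i (h := Fin.succ_ne_zero i)
    rw [iterMap_keep _ _ _ rfl, iterMap_skip _ _ _ (fun i => Fin.succ_ne_zero i), e, ih,
      Category.comp_id, comul_under_counit]

lemma iterMap_comp (n m l : ℕ) (f : Fin m →o Fin n) (g : Fin l →o Fin m) :
    iterMap G X n l (f.comp g) = iterMap G X n m f ≫ iterMap G X m l g := by
  induction hN : n + m + l using Nat.strong_induction_on generalizing n m l with
  | _ N ih =>
  subst hN
  rcases n with _ | n
  · rcases m with _ | m
    · rcases l with _ | l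
      · rw [iterMap_zero, iterMap_zero, iterMap_zero, Category.comp_id]
      · exact (g 0).elim0
    · exact (f 0).elim0
  by_cases hf : ∀ i, f i ≠ 0
  · have hfg : ∀ i, (f.comp g) i ≠ 0 := fun i => hf (g i)
    have e := ih (n + m + l) (by omega) n m l (dropZero f hf) g rfl
    have e' : dropZero (f.comp g) hfg = (dropZero f hf).comp g := rfl
    rw [iterMap_skip _ _ f hf, iterMap_skip _ _ (f.comp g) hfg, Category.assoc, ← e, e']
  rcases m with _ | m
  · exact absurd (fun i => i.elim0) hf
  have hf0 : f 0 = 0 := by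
    by_contra h
    exact hf (ne_zero_of_head f h)
  by_cases hg : ∀ i, g i ≠ 0
  · have e := ih (n + 1 + m + l) (by omega) (n + 1) m l (tailHom f) (dropZero g hg) rfl
    have e' : (tailHom f).comp (dropZero g hg) = f.comp g := by
      apply OrderHom.ext
      funext i
      exact congrArg f (Fin.succ_pred (g i) (hg i))
    rw [iterMap_skip _ _ g hg, iterMap_keep _ _ f hf0, ← e', e, Category.assoc,
      ← Category.assoc (underG _), underG_counit, Category.assoc, ← Category.assoc (comulAt _ _ _),
      comul_counit, Category.id_comp]
  rcases l with _ | l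
  · exact absurd (fun i => i.elim0) hg
  have hg0 : g 0 = 0 := by
    by_contra h
    exact hg (ne_zero_of_head g h)
  have hfg0 : (f.comp g) 0 = 0 := (congrArg f hg0).trans hf0
  have e := ih (n + 1 + (m + 1) + l) (by omega) (n + 1) (m + 1) l f (tailHom g) rfl
  have e' : tailHom (f.comp g) = f.comp (tailHom g) := rfl
  rw [iterMap_keep _ _ f hf0, iterMap_keep _ _ g hg0, iterMap_keep _ _ (f.comp g) hfg0, e', e,
    iterMap_keep _ _ f hf0, underG_comp, underG_comp, Category.assoc,
    Category.assoc, ← Category.assoc (underG (iterMap G X (n + 1) m (tailHom f))), underG_comul,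
    Category.assoc, ← Category.assoc (comulAt G X n) (underG (comulAt G X n)),
    comul_coassoc, Category.assoc]

/-- The cotriple resolution of `X`: the simplicial object `[n] ↦ Gⁿ⁺¹ X` with faces
`dᵢ = Gⁱ ε Gⁿ⁻ⁱ` and degeneracies `sᵢ = Gⁱ δ Gⁿ⁻ⁱ`. -/
def cotripleResolution : SimplicialObject D where
  obj n := iter G X (n.unop.len + 1)
  map θ := iterMap G X _ _ θ.unop.toOrderHom
  map_id _ := iterMap_id G X _
  map_comp θ ξ := iterMap_comp G X _ _ _ θ.unop.toOrderHom ξ.unop.toOrderHom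

end Cotriple

/-! ### Nerves -/

section Nerve

variable {D : Type u} [Category.{v} D] [HasFiniteLimits D]

/-- Pairs `i ≤ j` in `{0,…,n}`. -/
abbrev Edge (n : ℕ) : Type := {p : Fin (n + 1) × Fin (n + 1) // p.1 ≤ p.2}

/-- Triples `i ≤ j ≤ k` in `{0,…,n}`. -/
abbrev Triple (n : ℕ) : Type :=
  {p : Fin (n + 1) × Fin (n + 1) × Fin (n + 1) // p.1 ≤ p.2.1 ∧ p.2.1 ≤ p.2.2}

namespace Triple

variable {n : ℕ} (t : Triple n)

/-- The edge `i ≤ j` of `i ≤ j ≤ k`. -/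
def ij : Edge n := ⟨(t.1.1, t.1.2.1), t.2.1⟩
/-- The edge `j ≤ k` of `i ≤ j ≤ k`. -/
def jk : Edge n := ⟨(t.1.2.1, t.1.2.2), t.2.2⟩
/-- The edge `i ≤ k` of `i ≤ j ≤ k`. -/
def ik : Edge n := ⟨(t.1.1, t.1.2.2), t.2.1.trans t.2.2⟩

end Triple

/-- The edge `i ≤ i`. -/
def idEdge {n : ℕ} (i : Fin (n + 1)) : Edge n := ⟨(i, i), le_rfl⟩

namespace InternalCat

variable (A : InternalCat D) (n : ℕ)

/-- The product of copies of the object of arrows, indexed by pairs `i ≤ j`. -/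
abbrev edgeObj : D := ∏ᶜ fun _ : Edge n => A.mor

/-- A component of a family of arrows. -/
abbrev edgeπ (e : Edge n) : A.edgeObj n ⟶ A.mor := Pi.π (fun _ : Edge n => A.mor) e

/-- The targets of the arrows `f j k` of a family. -/
abbrev familyTgt : A.edgeObj n ⟶ ∏ᶜ fun _ : Triple n => A.ob :=
  Pi.lift fun t : Triple n => A.edgeπ n t.jk ≫ A.tgt

/-- The sources of the arrows `f i j` of a family. -/
abbrev familySrc : A.edgeObj n ⟶ ∏ᶜ fun _ : Triple n => A.ob :=
  Pi.lift fun t : Triple n => A.edgeπ n t.ij ≫ A.src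

/-- The object of families of arrows `f i j` (for `i ≤ j`) in which the target of `f j k` is the
source of `f i j`. -/
abbrev familyObj : D := equalizer (A.familyTgt n) (A.familySrc n)

/-- The arrow `f i j` of a family. -/
abbrev familyArrow (e : Edge n) : A.familyObj n ⟶ A.mor :=
  equalizer.ι (A.familyTgt n) (A.familySrc n) ≫ A.edgeπ n e

lemma family_cond (t : Triple n) :
    A.familyArrow n t.jk ≫ A.tgt = A.familyArrow n t.ij ≫ A.src := by
  have := congrArg (fun k => k ≫ Pi.π _ t) (equalizer.condition (A.familyTgt n) (A.familySrc n))
  simpa only [familyTgt, familySrc, Category.assoc, Pi.lift_π] using this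

/-- The arrows `f i i` and `f i k` of a family. -/
abbrev nerveL : A.familyObj n ⟶
    (∏ᶜ fun _ : Fin (n + 1) => A.mor) ⨯ (∏ᶜ fun _ : Triple n => A.mor) :=
  prod.lift (Pi.lift fun i : Fin (n + 1) => A.familyArrow n (idEdge i))
    (Pi.lift fun t : Triple n => A.familyArrow n t.ik)

/-- The identities of the objects `x i` and the composites of `f j k` and `f i j`. -/
abbrev nerveR : A.familyObj n ⟶
    (∏ᶜ fun _ : Fin (n + 1) => A.mor) ⨯ (∏ᶜ fun _ : Triple n => A.mor) :=
  prod.lift (Pi.lift fun i : Fin (n + 1) => A.familyArrow n (idEdge i) ≫ A.src ≫ A.ident)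
    (Pi.lift fun t : Triple n =>
      A.compose (A.familyArrow n t.jk) (A.familyArrow n t.ij) (A.family_cond n t))

/-- The object of `n`-simplices of the nerve of `A`, that is, of functors `[n]ᵒᵖ ⟶ A`: families of
arrows `f i j : x j ⟶ x i` for `i ≤ j` with `f i i` an identity and with `f i k` equal to the
composite of `f j k` followed by `f i j`. Equivalently it is the object of composable strings
`x 0 ⟵ x 1 ⟵ ⋯ ⟵ x n`. -/
abbrev nerveObj : D := equalizer (A.nerveL n) (A.nerveR n)

/-- The arrow `f i j` of a simplex. -/
abbrev arrow (e : Edge n) : A.nerveObj n ⟶ A.mor :=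
  equalizer.ι (A.nerveL n) (A.nerveR n) ≫ A.familyArrow n e

variable {n}

lemma arrow_cond (t : Triple n) : A.arrow n t.jk ≫ A.tgt = A.arrow n t.ij ≫ A.src := by
  have := congrArg (fun k => equalizer.ι (A.nerveL n) (A.nerveR n) ≫ k) (A.family_cond n t)
  simpa only [Category.assoc] using this

lemma arrow_ident (i : Fin (n + 1)) :
    A.arrow n (idEdge i) = A.arrow n (idEdge i) ≫ A.src ≫ A.ident := by
  have := congrArg (fun k => k ≫ prod.fst ≫ Pi.π _ i)
    (equalizer.condition (A.nerveL n) (A.nerveR n))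
  simpa only [nerveL, nerveR, Category.assoc, Pi.lift_π, prod.lift_fst_assoc] using this

lemma arrow_comp (t : Triple n) :
    A.arrow n t.ik = A.compose (A.arrow n t.jk) (A.arrow n t.ij) (A.arrow_cond t) := by
  have := congrArg (fun k => k ≫ prod.snd ≫ Pi.π _ t)
    (equalizer.condition (A.nerveL n) (A.nerveR n))
  simpa only [nerveL, nerveR, Category.assoc, Pi.lift_π, prod.lift_snd_assoc,
    precomp_compose] using this

/-- Two generalised simplices with the same arrows are equal. -/
lemma nerve_hom_ext {X : D} {p q : X ⟶ A.nerveObj n}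
    (h : ∀ e, p ≫ A.arrow n e = q ≫ A.arrow n e) : p = q := by
  apply equalizer.hom_ext
  apply equalizer.hom_ext
  apply Pi.hom_ext
  intro e
  have := h e
  simpa only [Category.assoc] using this

/-- A generalised simplex from its arrows. -/
def nerveLift {X : D} (f : Edge n → (X ⟶ A.mor))
    (h₁ : ∀ t : Triple n, f t.jk ≫ A.tgt = f t.ij ≫ A.src)
    (h₂ : ∀ i, f (idEdge i) = f (idEdge i) ≫ A.src ≫ A.ident)
    (h₃ : ∀ t : Triple n, f t.ik = A.compose (f t.jk) (f t.ij) (h₁ t)) : X ⟶ A.nerveObj n :=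
  equalizer.lift
    (equalizer.lift (Pi.lift f) (by
      apply Pi.hom_ext
      intro t
      simpa only [Category.assoc, Pi.lift_π, Pi.lift_π_assoc] using h₁ t)) (by
    apply Limits.prod.hom_ext
    · apply Pi.hom_ext
      intro i
      simpa only [Category.assoc, Pi.lift_π, prod.lift_fst, equalizer.lift_ι_assoc,
        Pi.lift_π_assoc] using h₂ i
    · apply Pi.hom_ext
      intro t
      simpa only [Category.assoc, Pi.lift_π, prod.lift_snd, equalizer.lift_ι_assoc,
        Pi.lift_π_assoc, precomp_compose] using h₃ t)

lemma nerveLift_arrow {X : D} (f : Edge n → (X ⟶ A.mor)) (h₁ h₂ h₃) (e : Edge n) :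
    A.nerveLift f h₁ h₂ h₃ ≫ A.arrow n e = f e := by
  rw [nerveLift, equalizer.lift_ι_assoc, equalizer.lift_ι_assoc, Pi.lift_π]

end InternalCat

/-- A monotone map acts on edges. -/
def mapEdge {m n : ℕ} (θ : Fin (m + 1) →o Fin (n + 1)) (e : Edge m) : Edge n :=
  ⟨(θ e.1.1, θ e.1.2), θ.monotone e.2⟩

/-- A monotone map acts on triples. -/
def mapTriple {m n : ℕ} (θ : Fin (m + 1) →o Fin (n + 1)) (t : Triple m) : Triple n :=
  ⟨(θ t.1.1, θ t.1.2.1, θ t.1.2.2), θ.monotone t.2.1, θ.monotone t.2.2⟩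

/-- A monotone map acts contravariantly on simplices, by reindexing. -/
def InternalCat.nerveMap (A : InternalCat D) {m n : ℕ} (θ : Fin (m + 1) →o Fin (n + 1)) :
    A.nerveObj n ⟶ A.nerveObj m :=
  A.nerveLift (fun e => A.arrow n (mapEdge θ e))
    (fun t => A.arrow_cond (mapTriple θ t))
    (fun i => A.arrow_ident (θ i))
    (fun t => A.arrow_comp (mapTriple θ t))

lemma InternalCat.nerveMap_arrow (A : InternalCat D) {m n : ℕ} (θ : Fin (m + 1) →o Fin (n + 1))
    (e : Edge m) : A.nerveMap θ ≫ A.arrow m e = A.arrow n (mapEdge θ e) :=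
  A.nerveLift_arrow _ _ _ _ e

/-- The nerve of an internal category.  Its `n`-simplices are the composable strings
`x 0 ⟵ x 1 ⟵ ⋯ ⟵ x n` and the `i`-th face omits `x i`; thus the face `d₀` of an arrow is its source
and `d₁` is its target. -/
def InternalCat.nerve (A : InternalCat D) : SimplicialObject D where
  obj n := A.nerveObj n.unop.len
  map θ := A.nerveMap θ.unop.toOrderHom
  map_id n := by
    apply A.nerve_hom_ext
    intro e
    refine (A.nerveMap_arrow _ e).trans ?_
    exact (Category.id_comp _).symm
  map_comp θ ξ := by
    apply A.nerve_hom_ext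
    intro e
    refine (A.nerveMap_arrow _ e).trans ?_
    refine Eq.trans ?_ (Category.assoc _ _ _).symm
    refine Eq.trans ?_ (congrArg (fun k => A.nerveMap _ ≫ k) (A.nerveMap_arrow _ e).symm)
    exact (A.nerveMap_arrow θ.unop.toOrderHom (mapEdge ξ.unop.toOrderHom e)).symm

/-- Two simplicial maps are simplicially homotopic if they are connected by a finite chain of
(combinatorial) simplicial homotopies, in either direction. -/
def SimpliciallyHomotopic {X Y : SimplicialObject D} (f g : X ⟶ Y) : Prop :=
  Relation.EqvGen (fun f g : X ⟶ Y => Nonempty (SimplicialObject.Homotopy f g)) f g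

/-- The constant simplicial object at the terminal object. -/
abbrev point (D : Type u) [Category.{v} D] [HasFiniteLimits D] : SimplicialObject D :=
  (SimplicialObject.const D).obj (⊤_ D)

/-- The unique simplicial map to the point. -/
def toPoint (X : SimplicialObject D) : X ⟶ point D where
  app _ := terminal.from _
  naturality _ _ _ := terminalIsTerminal.hom_ext _ _

/-- An internal category is contractible if its nerve is simplicially homotopy equivalent to the
point. -/
def InternalCat.IsContractible (A : InternalCat D) : Prop :=
  ∃ p : point D ⟶ A.nerve, SimpliciallyHomotopic (toPoint A.nerve ≫ p) (𝟙 A.nerve) ∧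
    SimpliciallyHomotopic (p ≫ toPoint A.nerve) (𝟙 (point D))

/-- A global object `a : 1 ⟶ A` of an internal category is terminal if every generalised object
`x : X ⟶ A` has exactly one (generalised) arrow to it. -/
def InternalCat.IsTerminalObject (A : InternalCat D) (a : ⊤_ D ⟶ A.ob) : Prop :=
  ∀ (X : D) (x : X ⟶ A.ob),
    ∃! f : X ⟶ A.mor, f ≫ A.src = x ∧ f ≫ A.tgt = terminal.from X ≫ a

end Nerve

/-! ### Categorical algebras as internal categories in the category of algebras -/

section Comparison

variable {C : Type u} [Category.{v} C] [HasFiniteLimits C] {T : Monad C} [IsCartesianMonad T]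

instance algebra_hasFiniteLimits : HasFiniteLimits T.Algebra where
  out _ _ _ := hasLimitsOfShape_of_hasLimitsOfShape_createsLimitsOfShape T.forget

namespace CatAlg

variable (A : CatAlg T)

/-- The `T`-algebra of objects. -/
abbrev obAlg : T.Algebra where
  A := A.cat.ob
  a := A.act.obj
  unit := A.unit_obj
  assoc := A.assoc_obj

/-- The `T`-algebra of arrows. -/
abbrev morAlg : T.Algebra where
  A := A.cat.mor
  a := A.act.map
  unit := A.unit_map
  assoc := A.assoc_map

/-- The source, as a map of algebras. -/
abbrev srcHom : A.morAlg ⟶ A.obAlg where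
  f := A.cat.src
  h := A.act.map_src.symm

/-- The target, as a map of algebras. -/
abbrev tgtHom : A.morAlg ⟶ A.obAlg where
  f := A.cat.tgt
  h := A.act.map_tgt.symm

/-- The identities, as a map of algebras. -/
abbrev identHom : A.obAlg ⟶ A.morAlg where
  f := A.cat.ident
  h := A.act.ident_map

lemma composeHom_aux {X : T.Algebra} {f g : X ⟶ A.morAlg} (h : f ≫ A.tgtHom = g ≫ A.srcHom) :
    f.f ≫ A.cat.tgt = g.f ≫ A.cat.src :=
  congrArg Monad.Algebra.Hom.f h

/-- The composite of two composable maps of algebras into the algebra of arrows. -/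
abbrev composeHom {X : T.Algebra} (f g : X ⟶ A.morAlg) (h : f ≫ A.tgtHom = g ≫ A.srcHom) :
    X ⟶ A.morAlg where
  f := A.cat.compose f.f g.f (A.composeHom_aux h)
  h := by
    have e := InternalCat.T_compose T A.cat.toCatData (𝟙 _) f.f g.f (A.composeHom_aux h)
    have e' := congrArg (fun k => k ≫ A.act.map) e
    simp only [Category.id_comp] at e'
    refine e'.symm.trans ((A.act.compose_map' _ _ _).trans ?_)
    refine Eq.trans ?_ (A.cat.precomp_compose _ _ _ _).symm
    exact A.cat.compose_congr f.h g.h _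

/-- The data of the internal category in `T`-algebras corresponding to `A`: all structure maps of
`A` are maps of algebras. -/
abbrev toAlgData : CatData T.Algebra where
  ob := A.obAlg
  mor := A.morAlg
  src := A.srcHom
  tgt := A.tgtHom
  ident := A.identHom
  comp := A.composeHom (pullback.fst _ _) (pullback.snd _ _) pullback.condition

lemma toAlgData_compose {X : T.Algebra} (f g : X ⟶ A.morAlg) (h : f ≫ A.tgtHom = g ≫ A.srcHom) :
    A.toAlgData.compose f g h = A.composeHom f g h := by
  apply Monad.Algebra.Hom.ext
  have e₁ : (pullback.lift f g h).f ≫ (pullback.fst A.tgtHom A.srcHom).f = f.f :=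
    congrArg Monad.Algebra.Hom.f (pullback.lift_fst f g h)
  have e₂ : (pullback.lift f g h).f ≫ (pullback.snd A.tgtHom A.srcHom).f = g.f :=
    congrArg Monad.Algebra.Hom.f (pullback.lift_snd f g h)
  exact (A.cat.precomp_compose _ _ _ _).trans (A.cat.compose_congr e₁ e₂ _)

/-- The internal category in `T`-algebras corresponding to a categorical `T`-algebra. -/
abbrev toAlgCat : InternalCat T.Algebra where
  toCatData := A.toAlgData
  ident_src := Monad.Algebra.Hom.ext A.cat.ident_src
  ident_tgt := Monad.Algebra.Hom.ext A.cat.ident_tgt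
  comp_src := Monad.Algebra.Hom.ext (A.cat.compose_src _ _ _)
  comp_tgt := Monad.Algebra.Hom.ext (A.cat.compose_tgt _ _ _)
  ident_compose f h := (A.toAlgData_compose _ _ h).trans
    (Monad.Algebra.Hom.ext (A.cat.ident_compose f.f (A.composeHom_aux h)))
  compose_ident f h := (A.toAlgData_compose _ _ h).trans
    (Monad.Algebra.Hom.ext (A.cat.compose_ident f.f (A.composeHom_aux h)))
  compose_assoc f g k h₁ h₂ h₃ h₄ := by
    simp only [A.toAlgData_compose _ _ h₁, A.toAlgData_compose _ _ h₂] at h₃ h₄ ⊢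
    rw [A.toAlgData_compose _ _ h₃, A.toAlgData_compose _ _ h₄]
    exact Monad.Algebra.Hom.ext (A.cat.compose_assoc f.f g.f k.f (A.composeHom_aux h₁)
      (A.composeHom_aux h₂) (A.composeHom_aux h₃) (A.composeHom_aux h₄))

/-- The nerve of a categorical `T`-algebra, a simplicial `T`-algebra. -/
def nerve : SimplicialObject T.Algebra := A.toAlgCat.nerve

end CatAlg

/-- The terminal `T`-algebra. -/
def oneAlg (T : Monad C) : T.Algebra where
  A := ⊤_ C
  a := terminal.from _
  unit := Subsingleton.elim _ _
  assoc := Subsingleton.elim _ _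

/-- The two-sided bar construction `B(T, T, 1)`: the cotriple resolution of the terminal
`T`-algebra for the comonad on `T`-algebras induced by the free-forgetful adjunction. -/
def bar (T : Monad C) : SimplicialObject T.Algebra :=
  cotripleResolution T.adj.toComonad (oneAlg T)

/-- The canonical internal `T`-algebra of a representing categorical `T`-algebra: the one that
corresponds to the identity morphism. -/
def canonicalAlgebra {H : CatAlg T} (Φ : TwoNatIso (homFunctor H) (IAlg T)) :
    LaxHom (terminalAlg T) H :=
  (Φ.app H).hom.toFunctor.obj (𝟙 H)

end Comparison

end CartMonad

end

noncomputable section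

open CategoryTheory Limits Bicategory

namespace CartMonad

set_option linter.unusedSectionVars false

/-! ### Naturality and the monad laws, written for arrows. -/

section MonadLemmas

variable {C : Type u} [Category.{v} C] (T : Monad C)

/-! The representing algebra can be read off from what an internal algebra consists of. A lax
morphism from 1 to A is a point x : 1 ⟶ A₀ and a cell φ : T1 ⟶ A₁ subject to four equations. Freely
extended, x and φ become algebra maps T1 ⟶ A₀ and T²1 ⟶ A₁, so the representing object should have
T1 as its objects and T²1 as its arrows, both free. The source and target of φ dictate the source μ
and the target T! (with ! the map T1 ⟶ 1), and the unit axiom dictates the identities Tη. The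
naturality square of μ at ! is a pullback, so the composable pairs form T³1, with projections μ_{T1}
and TT!. The associativity axiom then dictates that composition is Tμ. This is `classifier`; its
category laws are monad identities on T²1, T³1 and T⁴1.

Since all these algebras are free, a strict morphism out of `classifier` is determined by its
restriction along the units. Extension and restriction are mutually inverse functors
(`classify_evalAt`, `evalAt_classify`), and evaluation at `universal` is strictly 2-natural because
it is a composition. This proves representability.

For the nerve, `bar T` has the objects, arrows, identities and composition of `classifier` in low
dimensions (`barLowIso`). It also satisfies the Segal condition, whose squares are naturality
squares of μ (`bar_isPullback`). By induction on the dimension it is therefore the nerve of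
`classifier`. Representing objects are unique up to isomorphism by the Yoneda argument
(`TwoNatIso.exists_iso`), and isomorphisms of nerves come from isomorphisms of categorical algebras
(`CatAlg.exists_iso_of_nerve_iso`). The two facts together give both directions of the
characterisation.

The canonical object of `classifier` is η : 1 ⟶ T1. An arrow with this target factors through
η_{T1}, because the naturality square of η at ! is a pullback. The factor is the source of the
arrow, since η_{T1} followed by μ is the identity. Hence each object has exactly one arrow to it. In
any internal category, a terminal object allows every simplex to be coned off naturally. The cones
supply an explicit simplicial homotopy from the constant map to the identity
(`IsTerminalObject.homotopy`). -/

lemma mu_nat {X Y : C} (f : X ⟶ Y) :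
    T.map (T.map f) ≫ T.μ.app Y = T.μ.app X ≫ T.map f := T.μ.naturality f

lemma mu_nat_assoc {X Y Z : C} (f : X ⟶ Y) (k : T.obj Y ⟶ Z) :
    T.map (T.map f) ≫ T.μ.app Y ≫ k = T.μ.app X ≫ T.map f ≫ k := by
  rw [← Category.assoc, mu_nat, Category.assoc]

lemma eta_nat {X Y : C} (f : X ⟶ Y) :
    T.η.app X ≫ T.map f = f ≫ T.η.app Y := (T.η.naturality f).symm

lemma eta_nat_assoc {X Y Z : C} (f : X ⟶ Y) (k : T.obj Y ⟶ Z) :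
    T.η.app X ≫ T.map f ≫ k = f ≫ T.η.app Y ≫ k := by
  rw [← Category.assoc, eta_nat, Category.assoc]

lemma eta_mu (X : C) : T.η.app (T.obj X) ≫ T.μ.app X = 𝟙 (T.obj X) := T.left_unit X

lemma map_eta_mu (X : C) : T.map (T.η.app X) ≫ T.μ.app X = 𝟙 (T.obj X) := T.right_unit X

lemma mu_assoc (X : C) :
    T.map (T.μ.app X) ≫ T.μ.app X = T.μ.app (T.obj X) ≫ T.μ.app X := T.assoc X

lemma map_map_eq {X Y Z : C} {f : X ⟶ Y} {g : Y ⟶ Z} {h : X ⟶ Z} (e : f ≫ g = h) :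
    T.map f ≫ T.map g = T.map h := by rw [← T.map_comp, e]

end MonadLemmas

/-! ### The classifier of internal algebras -/

section Classifier

variable {C : Type u} [Category.{v} C] [HasFiniteLimits C] (T : Monad C) [IsCartesianMonad T]

open InternalCat

/-- The two cartesianness hypotheses, oriented for lifting. The squares of μ carry composition,
associativity and the Segal condition; those of η serve only the terminal object. -/
lemma mu_isPullback {X Y : C} (f : X ⟶ Y) :
    IsPullback (T.μ.app X) (T.map (T.map f)) (T.map f) (T.μ.app Y) :=
  (IsCartesianMonad.mul_cartesian (T := T) f).flip

lemma eta_isPullback {X Y : C} (f : X ⟶ Y) :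
    IsPullback (T.η.app X) f (T.map f) (T.η.app Y) :=
  (IsCartesianMonad.unit_cartesian (T := T) f).flip

/-- The map to the terminal object. -/
abbrev bang (X : C) : X ⟶ ⊤_ C := terminal.from X

lemma comp_bang {X Y : C} (f : X ⟶ Y) : f ≫ bang Y = bang X := terminal.comp_from f

lemma map_comp_bang {X Y : C} (f : X ⟶ Y) : T.map f ≫ T.map (bang Y) = T.map (bang X) :=
  map_map_eq T (comp_bang f)

lemma bang_self : bang (⊤_ C) = 𝟙 _ := Subsingleton.elim _ _

/-- The composable pairs of arrows of the classifier form the object `T (T (T 1))`. -/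
lemma pair_isPullback :
    IsPullback (T.μ.app (T.obj (⊤_ C))) (T.map (T.map (bang (T.obj (⊤_ C)))))
      (T.map (bang (T.obj (⊤_ C)))) (T.μ.app (⊤_ C)) :=
  mu_isPullback T _

/-- The underlying data of the classifier: its objects are `T 1` and its arrows `T (T 1)`. -/
abbrev classifierData : CatData C where
  ob := T.obj (⊤_ C)
  mor := T.obj (T.obj (⊤_ C))
  src := T.μ.app (⊤_ C)
  tgt := T.map (bang (T.obj (⊤_ C)))
  ident := T.map (T.η.app (⊤_ C))
  comp := (pair_isPullback T).lift (pullback.fst _ _) (pullback.snd _ _) pullback.condition ≫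
    T.map (T.μ.app (⊤_ C))

/-- Replaces the chosen pullback by T³1: any k with the right projections computes the composite. To
verify a law it thus suffices to exhibit such a k. -/
lemma classifier_compose {X : C} (k : X ⟶ T.obj (T.obj (T.obj (⊤_ C))))
    {f g : X ⟶ T.obj (T.obj (⊤_ C))} (hf : k ≫ T.μ.app (T.obj (⊤_ C)) = f)
    (hg : k ≫ T.map (T.map (bang (T.obj (⊤_ C)))) = g)
    (h : f ≫ T.map (bang (T.obj (⊤_ C))) = g ≫ T.μ.app (⊤_ C)) :
    (classifierData T).compose f g h = k ≫ T.map (T.μ.app (⊤_ C)) := by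
  unfold CatData.compose
  rw [← Category.assoc]
  congr 1
  apply (pair_isPullback T).hom_ext
  · rw [Category.assoc, IsPullback.lift_fst, hf]
    exact pullback.lift_fst _ _ _
  · rw [Category.assoc, IsPullback.lift_snd, hg]
    exact pullback.lift_snd _ _ _

lemma classifier_pair {X : C} (f g : X ⟶ T.obj (T.obj (⊤_ C)))
    (h : f ≫ T.map (bang (T.obj (⊤_ C))) = g ≫ T.μ.app (⊤_ C)) :
    ∃ k : X ⟶ T.obj (T.obj (T.obj (⊤_ C))), k ≫ T.μ.app (T.obj (⊤_ C)) = f ∧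
      k ≫ T.map (T.map (bang (T.obj (⊤_ C)))) = g :=
  ⟨(pair_isPullback T).lift f g h, IsPullback.lift_fst _ _ _ _, IsPullback.lift_snd _ _ _ _⟩

/-- The classifier, as an internal category. -/
abbrev classifierCat : InternalCat C where
  toCatData := classifierData T
  ident_src := map_eta_mu T _
  ident_tgt := by
    refine (map_comp_bang T _).trans ?_
    rw [bang_self, T.map_id]
  comp_src := by
    change ((pair_isPullback T).lift _ _ _ ≫ T.map (T.μ.app (⊤_ C))) ≫ T.μ.app (⊤_ C) = _
    rw [Category.assoc, mu_assoc, IsPullback.lift_fst_assoc]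
  comp_tgt := by
    change ((pair_isPullback T).lift _ _ _ ≫ T.map (T.μ.app (⊤_ C))) ≫ T.map (bang _) = _
    have e : T.map (T.μ.app (⊤_ C)) ≫ T.map (bang (T.obj (⊤_ C))) =
        T.map (T.map (bang (T.obj (⊤_ C)))) ≫ T.map (bang (T.obj (⊤_ C))) :=
      (map_comp_bang T _).trans (map_comp_bang T _).symm
    rw [Category.assoc, e, IsPullback.lift_snd_assoc]
  ident_compose f h := by
    -- The pair (identity, f) is a degenerate 2-simplex of the bar construction, with the unit
    -- inserted at the innermost place. The other unit law inserts it one place further out.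
    refine (classifier_compose T (f ≫ T.map (T.map (T.η.app (⊤_ C)))) ?_ ?_ h).trans ?_
    · rw [Category.assoc, mu_nat]
    · rw [Category.assoc, ← T.map_comp, map_comp_bang, bang_self, T.map_id, T.map_id,
        Category.comp_id]
    · rw [Category.assoc, ← T.map_comp, map_eta_mu, T.map_id, Category.comp_id]
  compose_ident f h := by
    refine (classifier_compose T (f ≫ T.map (T.η.app (T.obj (⊤_ C)))) ?_ ?_ h).trans ?_
    · rw [Category.assoc, map_eta_mu, Category.comp_id]
    · rw [Category.assoc, ← T.map_comp, eta_nat, T.map_comp]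
    · rw [Category.assoc, ← T.map_comp, eta_mu, T.map_id, Category.comp_id]
  compose_assoc f g l h₁ h₂ h₃ h₄ := by
    obtain ⟨k₁, hf, hg⟩ := classifier_pair T f g h₁
    obtain ⟨k₂, hg', hl⟩ := classifier_pair T g l h₂
    -- Composable triples form T⁴1: the two pairs share g, and the naturality square of μ at T! is a
    -- pullback. Both bracketings are images of m, and they agree by associativity of μ under T.
    obtain ⟨m, hm₁, hm₂⟩ : ∃ m, m ≫ T.μ.app (T.obj (T.obj (⊤_ C))) = k₁ ∧
        m ≫ T.map (T.map (T.map (bang (T.obj (⊤_ C))))) = k₂ := by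
      have hp := mu_isPullback T (T.map (bang (T.obj (⊤_ C))))
      exact ⟨hp.lift k₁ k₂ (hg.trans hg'.symm), hp.lift_fst _ _ _, hp.lift_snd _ _ _⟩
    have e₁ := classifier_compose T k₁ hf hg h₁
    have e₂ := classifier_compose T k₂ hg' hl h₂
    refine (classifier_compose T (m ≫ T.map (T.map (T.μ.app (⊤_ C)))) ?_ ?_ h₃).trans
      (Eq.trans ?_ (classifier_compose T (m ≫ T.map (T.μ.app (T.obj (⊤_ C)))) ?_ ?_ h₄).symm)
    · rw [e₁, Category.assoc, mu_nat, ← Category.assoc, hm₁]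
    · rw [← hl, ← hm₂, Category.assoc, Category.assoc, ← T.map_comp, ← T.map_comp, ← T.map_comp,
        ← T.map_comp, comp_bang, comp_bang]
    · rw [Category.assoc, Category.assoc, ← T.map_comp, ← T.map_comp, mu_assoc]
    · rw [Category.assoc, mu_assoc, ← Category.assoc, hm₁, hf]
    · rw [e₂, ← hm₂, Category.assoc, Category.assoc, ← T.map_comp, ← T.map_comp, mu_nat]

/-- The classifier of internal `T`-algebras. -/
abbrev classifier : CatAlg T where
  cat := classifierCat T
  act :=
    { obj := T.μ.app (⊤_ C)
      map := T.μ.app (T.obj (⊤_ C))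
      map_src := (mu_assoc T _).symm
      map_tgt := (mu_nat T _).symm
      ident_map := mu_nat T _
      compose_map := by
        intro X f g h h'
        obtain ⟨k, rfl, rfl⟩ := T_pair T (classifierData T) f g h
        -- q represents the universal composable pair by an element of T³1. Hence k followed by Tq
        -- lies over T⁴1, and one multiplication gives the element of T³1 for the image pair.
        obtain ⟨q, h₁, h₂⟩ := classifier_pair T
          (pullback.fst (T.map (bang (T.obj (⊤_ C)))) (T.μ.app (⊤_ C))) (pullback.snd _ _)
          pullback.condition
        have e₁ := T_compose T (classifierData T) k _ _ pullback.condition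
        have e₂ := classifier_compose T q h₁ h₂ pullback.condition
        refine (congrArg (· ≫ T.μ.app (T.obj (⊤_ C))) e₁).trans ?_
        dsimp only
        rw [e₂]
        refine Eq.trans ?_ (classifier_compose T (k ≫ T.map q ≫ T.μ.app _) ?_ ?_ h').symm
        · simp only [T.map_comp, Category.assoc, mu_nat]
        · simp only [Category.assoc]
          rw [← h₁, T.map_comp, Category.assoc, mu_assoc]
        · simp only [Category.assoc]
          rw [← h₂, T.map_comp, Category.assoc, mu_nat] }
  unit := InternalCat.hom_ext (eta_mu T _) (eta_mu T _)
  assoc := InternalCat.hom_ext (mu_assoc T _).symm (mu_assoc T _).symm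

end Classifier

/-! ### Strict morphisms out of the classifier -/

section Universal

variable {C : Type u} [Category.{v} C] [HasFiniteLimits C] {T : Monad C} [IsCartesianMonad T]

open InternalCat

/-- The uniqueness half of the universal property of a free algebra. It applies alike to the
objects, the arrows and the transformation components of strict morphisms out of the classifier. -/
lemma free_hom_eq {X Z : C} {a : T.obj Z ⟶ Z} {f : T.obj X ⟶ Z}
    (hf : T.map f ≫ a = T.μ.app X ≫ f) : f = T.map (T.η.app X ≫ f) ≫ a := by
  rw [T.map_comp, Category.assoc, hf, ← Category.assoc, map_eta_mu]
  exact (Category.id_comp f).symm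

namespace LaxHom

/-- The only arrow of the terminal category is an identity, so the action on arrows carries no
information. -/
lemma map_of_terminal {A : CatAlg T} (f : LaxHom (terminalAlg T) A) :
    f.func.map = f.func.obj ≫ A.cat.ident := by
  have := f.func.ident_map
  rwa [Category.id_comp] at this

/-- Lax morphisms out of the terminal algebra with the same object and the same cell are equal. -/
lemma ext_of_terminal {A : CatAlg T} {f g : LaxHom (terminalAlg T) A}
    (h₀ : f.func.obj = g.func.obj) (h₂ : f.cell.app = g.cell.app) : f = g :=
  ext' h₀ (by rw [map_of_terminal, map_of_terminal, h₀]) h₂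

/-- The lax morphism out of the terminal algebra given by an object and a cell. -/
def ofPoint (A : CatAlg T) (x : ⊤_ C ⟶ A.cat.ob) (φ : T.obj (⊤_ C) ⟶ A.cat.mor)
    (h₁ : φ ≫ A.cat.src = T.map x ≫ A.act.obj) (h₂ : φ ≫ A.cat.tgt = bang _ ≫ x)
    (h₃ : T.η.app (⊤_ C) ≫ φ = x ≫ A.cat.ident)
    (h₄ : ∀ h, T.μ.app (⊤_ C) ≫ φ =
      A.cat.compose (T.map φ ≫ A.act.map) (T.map (bang (T.obj (⊤_ C))) ≫ φ) h) :
    LaxHom (terminalAlg T) A where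
  func :=
    { obj := x
      map := x ≫ A.cat.ident
      map_src := by simp
      map_tgt := by simp
      ident_map := by simp
      compose_map := by
        intro X f g h h'
        refine Eq.trans ?_ (A.cat.ident_compose₂ f x _ h').symm
        exact congrArg (· ≫ x ≫ A.cat.ident) (Subsingleton.elim _ g) }
  cell :=
    { app := φ
      app_src := h₁
      app_tgt := h₂
      naturality := by
        intro n₁ n₂
        -- The terminal category has only identity arrows, so each side composes φ with an identity.
        refine (A.cat.compose_congr (act_ident A x) rfl _).trans ?_
        rw [A.cat.ident_compose']
        exact (A.cat.compose_ident₂ _ x _ n₂).symm }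
  cell_unit := h₃
  cell_assoc := h₄

end LaxHom

variable (T) in
/-- The universal internal `T`-algebra, in the classifier. -/
def universal : LaxHom (terminalAlg T) (classifier T) :=
  LaxHom.ofPoint (classifier T) (T.η.app (⊤_ C)) (T.η.app (T.obj (⊤_ C)))
    ((eta_mu T _).trans (map_eta_mu T _).symm) (eta_nat T _)
    (eta_nat T (T.η.app (⊤_ C))).symm (by
      intro h
      -- The first arrow of the pair reduces to 𝟙 of T²1 and the second is T! followed by η. The
      -- unit at T²1 projects to both, and naturality of η rewrites its composite as μ followed by
      -- η.
      refine Eq.trans ?_ (classifier_compose T (T.η.app (T.obj (T.obj (⊤_ C)))) ?_ ?_ h).symm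
      · exact (eta_nat T _).symm
      · exact (eta_mu T _).trans (map_eta_mu T _).symm
      · exact eta_nat T _)

namespace CatAlg

/-- Strict morphisms with the same action on objects and arrows are equal. -/
lemma hom_ext_obj_map {A B : CatAlg T} {F G : A ⟶ B} (h₀ : F.func.obj = G.func.obj)
    (h₁ : F.func.map = G.func.map) : F = G :=
  Hom.ext (InternalCat.hom_ext h₀ h₁)

/-- Functors into a category of strict morphisms agree when they agree on underlying data. -/
lemma functor_ext {D : Type*} [Category D] {A B : CatAlg T} {F G : D ⥤ (A ⟶ B)}
    (h₀ : ∀ X, (F.obj X).func.obj = (G.obj X).func.obj)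
    (h₁ : ∀ X, (F.obj X).func.map = (G.obj X).func.map)
    (h₃ : ∀ {X Y : D} (u : X ⟶ Y), (F.map u).trans.app = (G.map u).trans.app) : F = G := by
  refine CategoryTheory.Functor.ext (fun X => hom_ext_obj_map (h₀ X) (h₁ X)) ?_
  intro X Y u
  ext
  rw [h₃]
  simp only [comp_trans, InternalCat.comp_app, eqToHom_trans_app, compose_ident',
    ident_compose']

end CatAlg

/-- The strict morphism out of the classifier that corresponds to an internal algebra. -/
def classify {A : CatAlg T} (f : LaxHom (terminalAlg T) A) : classifier T ⟶ A where
  func :=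
    { obj := T.map f.func.obj ≫ A.act.obj
      map := T.map f.cell.app ≫ A.act.map
      map_src := by
        rw [LaxHom.act_src, f.cell_src, T.map_comp, Category.assoc, ← A.assoc_obj, mu_nat_assoc]
      map_tgt := by
        rw [LaxHom.act_tgt, f.cell_tgt, T.map_comp, Category.assoc]
      ident_map := by
        rw [← Category.assoc, ← T.map_comp]
        refine (congrArg (fun k => T.map k ≫ A.act.map) f.cell_unit).trans ?_
        exact LaxHom.act_ident A _
      compose_map := by
        intro X g l h h'
        obtain ⟨k, hg, hl⟩ := classifier_pair T g l h
        -- The associativity axiom of the cell is an equation over T²1. Extended freely it becomes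
        -- one over T³1, the object of composable pairs, and reindexing along k specialises it to g
        -- and l.
        have e := congrArg (fun k => T.map k ≫ A.act.map) (f.cell_assoc f.cell_aux)
        dsimp only at e
        rw [LaxHom.act_compose A _ _ f.cell_aux] at e
        have e' := congrArg (fun l => k ≫ l) e
        simp only [precomp_compose] at e'
        refine (congrArg (· ≫ T.map f.cell.app ≫ A.act.map)
          (classifier_compose T k hg hl h)).trans ?_
        refine Eq.trans ?_ (e'.trans (A.cat.compose_congr ?_ ?_ _))
        · simp only [T.map_comp, Category.assoc]
        · rw [← hg, T.map_comp, Category.assoc, ← A.assoc_map, mu_nat_assoc, Category.assoc]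
        · rw [← hl, T.map_comp, Category.assoc, Category.assoc] }
  comm := by
    apply InternalCat.hom_ext
    · change T.map (T.map f.func.obj ≫ A.act.obj) ≫ A.act.obj =
        T.μ.app _ ≫ T.map f.func.obj ≫ A.act.obj
      rw [T.map_comp, Category.assoc, ← A.assoc_obj, mu_nat_assoc]
    · change T.map (T.map f.cell.app ≫ A.act.map) ≫ A.act.map =
        T.μ.app _ ≫ T.map f.cell.app ≫ A.act.map
      rw [T.map_comp, Category.assoc, ← A.assoc_map, mu_nat_assoc]

/-- The action of `classify` on transformations. -/
def classify₂ {A : CatAlg T} {f g : LaxHom (terminalAlg T) A} (α : f ⟶ g) :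
    classify f ⟶ classify g where
  trans :=
    { app := T.map α.trans.app ≫ A.act.map
      app_src := by
        rw [LaxHom.act_src, α.trans.app_src]
        rfl
      app_tgt := by
        rw [LaxHom.act_tgt, α.trans.app_tgt]
        rfl
      naturality := by
        intro h₁ h₂
        -- The compatibility of α with the cells is an equation over T1; its free extension over T²1
        -- is naturality at the universal arrow.
        have e := congrArg (fun k => T.map k ≫ A.act.map)
          (α.comm (LaxHom.trans_aux₁ f α.trans) (LaxHom.trans_aux₂ g α.trans))
        dsimp only at e
        rw [LaxHom.act_compose A _ _ (LaxHom.trans_aux₁ f α.trans),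
          LaxHom.act_compose A _ _ (LaxHom.trans_aux₂ g α.trans)] at e
        refine Eq.trans (A.cat.compose_congr rfl ?_ _) (e.trans (A.cat.compose_congr ?_ rfl _))
        · rw [T.map_comp, Category.assoc]
        · rw [T.map_comp, Category.assoc, ← A.assoc_map, mu_nat_assoc] }
  comm := by
    change T.map (T.map α.trans.app ≫ A.act.map) ≫ A.act.map =
      T.μ.app _ ≫ T.map α.trans.app ≫ A.act.map
    rw [T.map_comp, Category.assoc, ← A.assoc_map, mu_nat_assoc]

variable (T) in
/-- Internal algebras yield strict morphisms out of the classifier, functorially. -/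
def classifyFunctor (A : CatAlg T) : LaxHom (terminalAlg T) A ⥤ (classifier T ⟶ A) where
  obj f := classify f
  map α := classify₂ α
  map_id f := by
    ext
    exact LaxHom.act_ident A _
  map_comp α β := by
    ext
    exact LaxHom.act_compose A _ _ (comp_app_aux α.trans β.trans)

/-- Evaluation of strict morphisms at an internal algebra. -/
def evalAt {H : CatAlg T} (w : LaxHom (terminalAlg T) H) (A : CatAlg T) :
    (H ⟶ A) ⥤ LaxHom (terminalAlg T) A where
  obj F := w.post F
  map α := (LaxHom.postTrans (terminalAlg T) α).app w
  map_id F := LaxHom.trans_ext (Bicategory.whiskerLeft_id w.func F.func)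
  map_comp α β := LaxHom.trans_ext (Bicategory.whiskerLeft_comp w.func α.trans β.trans)

/-- An internal algebra is universal if evaluation at it is an isomorphism of categories. -/
def IsUniversal {H : CatAlg T} (w : LaxHom (terminalAlg T) H) : Prop :=
  ∀ A, IsIso (evalAt w A).toCatHom

/-- Extending freely and then restricting along η changes nothing, by naturality of η and the unit
law of the action. The same computation serves points, cells and transformations. -/
lemma classify_evalAt (A : CatAlg T) :
    classifyFunctor T A ⋙ evalAt (universal T) A = 𝟭 _ := by
  have key : ∀ {X Z : C} {a : T.obj Z ⟶ Z} (x : X ⟶ Z), T.η.app Z ≫ a = 𝟙 Z →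
      T.η.app X ≫ T.map x ≫ a = x := by
    intro X Z a x ha
    rw [eta_nat_assoc, ha, Category.comp_id]
  apply LaxHom.functor_ext
  · exact fun f => key f.func.obj A.unit_obj
  · intro f
    rw [LaxHom.map_of_terminal, LaxHom.map_of_terminal]
    exact congrArg (· ≫ A.cat.ident) (key f.func.obj A.unit_obj)
  · exact fun f => key f.cell.app A.unit_map
  · exact fun α => key α.trans.app A.unit_map

/-- Strictness says that objects, arrows and components are algebra maps out of free algebras, so
they are recovered from their restrictions along η. -/
lemma evalAt_classify (A : CatAlg T) :
    evalAt (universal T) A ⋙ classifyFunctor T A = 𝟭 _ := by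
  apply CatAlg.functor_ext
  · exact fun F => (free_hom_eq F.comm_obj).symm
  · exact fun F => (free_hom_eq F.comm_map).symm
  · exact fun α => (free_hom_eq α.comm_app).symm

lemma isUniversal_universal : IsUniversal (universal T) := fun A =>
  ⟨(classifyFunctor T A).toCatHom, Cat.ext (evalAt_classify A), Cat.ext (classify_evalAt A)⟩

/-- A universal internal algebra represents the 2-functor of internal algebras. -/
def IsUniversal.twoNatIso {H : CatAlg T} {w : LaxHom (terminalAlg T) H} (hw : IsUniversal w) :
    TwoNatIso (homFunctor H) (IAlg T) where
  app A := @asIso _ _ _ _ _ (hw A)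
  -- Evaluation composes the fixed `w` with a strict morphism, so strict naturality on 1-cells and
  -- 2-cells is associativity of composition in `C`.
  naturality {A A'} F := by
    apply Cat.ext
    apply LaxHom.functor_ext
    · exact fun G => (Category.assoc _ _ _).symm
    · exact fun G => (Category.assoc _ _ _).symm
    · exact fun G => (Category.assoc _ _ _).symm
    · exact fun β => (Category.assoc _ _ _).symm
  naturality₂ {A A'} F G α := by
    apply cat_conj
    intro K
    exact LaxHom.eq_conj _ _ _ _ (Category.assoc _ _ _).symm

end Universal

/-! ### Uniqueness of representing objects -/

section Yoneda

variable {B : Type u'} [Bicategory.{v, v} B] [Bicategory.Strict B] {H K : B}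
  {F : StrictPseudofunctor B Cat.{v, v}}

/-- The Yoneda computation: with g an identity, Φ is determined on 1-cells by its universal element.
-/
lemma TwoNatIso.obj_comp (Φ : TwoNatIso (homFunctor H) F) {A A' : B} (g : H ⟶ A) (f : A ⟶ A') :
    (Φ.app A').hom.toFunctor.obj (g ≫ f) =
      (F.map f).toFunctor.obj ((Φ.app A).hom.toFunctor.obj g) :=
  congrArg (fun k : (homFunctor H).obj A ⟶ F.obj A' => k.toFunctor.obj g) (Φ.naturality f)

lemma TwoNatIso.obj_injective (Φ : TwoNatIso (homFunctor H) F) {A : B} {f g : H ⟶ A}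
    (h : (Φ.app A).hom.toFunctor.obj f = (Φ.app A).hom.toFunctor.obj g) : f = g := by
  have e : ∀ k : H ⟶ A, (Φ.app A).inv.toFunctor.obj ((Φ.app A).hom.toFunctor.obj k) = k :=
    fun k => congrArg (fun j : (homFunctor H).obj A ⟶ (homFunctor H).obj A => j.toFunctor.obj k)
      (Φ.app A).hom_inv_id
  rw [← e f, h, e g]

lemma TwoNatIso.obj_surjective (Φ : TwoNatIso (homFunctor H) F) {A : B} (x : F.obj A) :
    ∃ f : H ⟶ A, (Φ.app A).hom.toFunctor.obj f = x :=
  ⟨(Φ.app A).inv.toFunctor.obj x,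
    congrArg (fun j => (Cat.Hom.toFunctor j).obj x) (Φ.app A).inv_hom_id⟩

/-- Representing objects are unique up to isomorphism, compatibly with the universal elements. -/
lemma TwoNatIso.exists_iso (Φ : TwoNatIso (homFunctor H) F) (Ψ : TwoNatIso (homFunctor K) F) :
    ∃ (e : K ⟶ H) (e' : H ⟶ K), e ≫ e' = 𝟙 K ∧ e' ≫ e = 𝟙 H ∧
      (F.map e).toFunctor.obj ((Ψ.app K).hom.toFunctor.obj (𝟙 K)) =
        (Φ.app H).hom.toFunctor.obj (𝟙 H) := by
  -- Each 1-cell is chosen to carry one universal element to the other. Both composites then fix a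
  -- universal element, hence are identities by injectivity.
  obtain ⟨e, he⟩ := Ψ.obj_surjective ((Φ.app H).hom.toFunctor.obj (𝟙 H))
  obtain ⟨e', he'⟩ := Φ.obj_surjective ((Ψ.app K).hom.toFunctor.obj (𝟙 K))
  refine ⟨e, e', ?_, ?_, ?_⟩
  · apply Ψ.obj_injective
    rw [Ψ.obj_comp, he, ← Φ.obj_comp, Bicategory.Strict.id_comp, he']
  · apply Φ.obj_injective
    rw [Φ.obj_comp, he', ← Ψ.obj_comp, Bicategory.Strict.id_comp, he]
  · rw [← Ψ.obj_comp, Bicategory.Strict.id_comp, he]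

end Yoneda

/-! ### Transport of universal algebras, and the terminal object of the classifier. -/

section Transport

variable {C : Type u} [Category.{v} C] [HasFiniteLimits C] {T : Monad C} [IsCartesianMonad T]

open InternalCat

/-- Universality asks for isomorphisms of hom-categories, not equivalences, so the composite must be
the identity functor on the nose; this is checked on underlying maps. -/
lemma precomp_comp_precomp {H K : CatAlg T} {e : H ⟶ K} {e' : K ⟶ H} (h : e ≫ e' = 𝟙 H)
    (A : CatAlg T) : precomp A e' ⋙ precomp A e = 𝟭 (H ⟶ A) := by
  have h₀ : e.func.obj ≫ e'.func.obj = 𝟙 _ := congrArg (fun k => (CatAlg.Hom.func k).obj) h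
  have h₁ : e.func.map ≫ e'.func.map = 𝟙 _ := congrArg (fun k => (CatAlg.Hom.func k).map) h
  have key : ∀ {X Y Z : C} (i : X ⟶ Y) (j : Y ⟶ X) (k : X ⟶ Z), i ≫ j = 𝟙 _ → i ≫ j ≫ k = k := by
    intro X Y Z i j k hij
    rw [← Category.assoc, hij, Category.id_comp]
  apply CatAlg.functor_ext
  · exact fun F => key _ _ F.func.obj h₀
  · exact fun F => key _ _ F.func.map h₁
  · exact fun α => key _ _ α.trans.app h₀

/-- The image of a universal internal algebra under an isomorphism is universal. -/
lemma IsUniversal.post {H K : CatAlg T} {w : LaxHom (terminalAlg T) H} (hw : IsUniversal w)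
    (e : H ⟶ K) (e' : K ⟶ H) (h : e ≫ e' = 𝟙 H) (h' : e' ≫ e = 𝟙 K) : IsUniversal (w.post e) := by
  intro A
  have : IsIso (precomp A e).toCatHom :=
    ⟨(precomp A e').toCatHom, Cat.ext (precomp_comp_precomp h' A),
      Cat.ext (precomp_comp_precomp h A)⟩
  have := hw A
  -- Evaluation at the image of `w` factors as precomposition with the isomorphism followed by
  -- evaluation at `w`, both invertible.
  have e : (evalAt (w.post e) A).toCatHom = (precomp A e).toCatHom ≫ (evalAt w A).toCatHom := by
    apply Cat.ext
    apply LaxHom.functor_ext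
    · exact fun G => Category.assoc _ _ _
    · exact fun G => Category.assoc _ _ _
    · exact fun G => Category.assoc _ _ _
    · exact fun β => Category.assoc _ _ _
  rw [e]
  infer_instance

/-- Every representing object is isomorphic to the classifier, and the isomorphism takes the
universal internal algebra to the canonical one. -/
lemma exists_iso_classifier {H : CatAlg T} (Φ : TwoNatIso (homFunctor H) (IAlg T)) :
    ∃ (e : classifier T ⟶ H) (e' : H ⟶ classifier T), e ≫ e' = 𝟙 _ ∧ e' ≫ e = 𝟙 H ∧
      canonicalAlgebra Φ = (universal T).post e := by
  obtain ⟨e, e', h, h', hc⟩ := Φ.exists_iso isUniversal_universal.twoNatIso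
  refine ⟨e, e', h, h', hc.symm.trans (congrArg (fun k => LaxHom.post k e) ?_)⟩
  -- For the classifier itself the canonical algebra is `universal` composed with the identity,
  -- which equals `universal`.
  exact LaxHom.ext_of_terminal (Category.comp_id _) (Category.comp_id _)

/-- The universal internal algebra is a terminal object of the classifier. -/
lemma isTerminalObject_universal :
    (classifier T).cat.IsTerminalObject (universal T).func.obj := by
  intro X x
  -- The unit at T1 is the universal arrow to the canonical object: its source is 𝟙 by the unit law,
  -- its target is constant at η by naturality.
  refine ⟨x ≫ T.η.app (T.obj (⊤_ C)), ⟨?_, ?_⟩, ?_⟩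
  · exact (Category.assoc _ _ _).trans ((congrArg (x ≫ ·) (eta_mu T _)).trans (Category.comp_id x))
  · refine (Category.assoc _ _ _).trans ((congrArg (x ≫ ·) (eta_nat T _)).trans ?_)
    rw [← Category.assoc, comp_bang]
    rfl
  · rintro f ⟨h₁, h₂⟩
    -- The only use of cartesianness of η: the condition on the target of f makes f factor through
    -- the unit at T1, and the source of f then identifies the factor l with x.
    have hp := eta_isPullback T (bang (T.obj (⊤_ C)))
    obtain ⟨l, hl⟩ : ∃ l, l ≫ T.η.app (T.obj (⊤_ C)) = f :=
      ⟨hp.lift f (bang X) h₂, hp.lift_fst _ _ _⟩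
    have hx : l = x := by
      rw [← h₁, ← hl]
      exact ((Category.assoc _ _ _).trans
        ((congrArg (l ≫ ·) (eta_mu T _)).trans (Category.comp_id _))).symm
    rw [← hl, hx]

/-- Isomorphisms of internal categories preserve terminal objects. -/
lemma InternalCat.IsTerminalObject.of_iso {A B : InternalCat C} {a : ⊤_ C ⟶ A.ob}
    (ha : A.IsTerminalObject a) (e : A ⟶ B) (e' : B ⟶ A) (h : e ≫ e' = 𝟙 A) (h' : e' ≫ e = 𝟙 B) :
    B.IsTerminalObject (a ≫ e.obj) := by
  have h₀ : e.obj ≫ e'.obj = 𝟙 _ := congrArg IFunctor.obj h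
  have h₀' : e'.obj ≫ e.obj = 𝟙 _ := congrArg IFunctor.obj h'
  have h₁' : e'.map ≫ e.map = 𝟙 _ := congrArg IFunctor.map h'
  intro X x
  obtain ⟨f, ⟨hs, ht⟩, hu⟩ := ha X (x ≫ e'.obj)
  refine ⟨f ≫ e.map, ⟨?_, ?_⟩, ?_⟩
  · rw [Category.assoc, e.map_src, reassoc_of% hs, h₀', Category.comp_id]
  · rw [Category.assoc, e.map_tgt, reassoc_of% ht]
  · rintro g ⟨hs', ht'⟩
    have := hu (g ≫ e'.map) ⟨by rw [Category.assoc, e'.map_src, reassoc_of% hs'], by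
      rw [Category.assoc, e'.map_tgt, reassoc_of% ht', h₀, Category.comp_id]⟩
    rw [← this, Category.assoc, h₁', Category.comp_id]

end Transport

/-! ### The nerve is fully faithful -/

section NerveFunctor

variable {D : Type u} [Category.{v} D] [HasFiniteLimits D]

open Opposite Simplicial

namespace InternalCat

variable (A : InternalCat D) {n : ℕ}

/-- The arrow `f i j` of a simplex. -/
def arr (n : ℕ) (e : Edge n) : A.nerveObj n ⟶ A.mor := A.arrow n e

lemma arr_cond (t : Triple n) : A.arr n t.jk ≫ A.tgt = A.arr n t.ij ≫ A.src := A.arrow_cond t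

lemma arr_ident (i : Fin (n + 1)) :
    A.arr n (idEdge i) = A.arr n (idEdge i) ≫ A.src ≫ A.ident := A.arrow_ident i

lemma arr_comp (t : Triple n) :
    A.arr n t.ik = A.compose (A.arr n t.jk) (A.arr n t.ij) (A.arr_cond t) := A.arrow_comp t

lemma arr_ext {X : D} {p q : X ⟶ A.nerveObj n} (h : ∀ e, p ≫ A.arr n e = q ≫ A.arr n e) : p = q :=
  A.nerve_hom_ext h

lemma nerveLift_arr {X : D} (f : Edge n → (X ⟶ A.mor)) (h₁ h₂ h₃) (e : Edge n) :
    A.nerveLift f h₁ h₂ h₃ ≫ A.arr n e = f e := A.nerveLift_arrow f h₁ h₂ h₃ e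

lemma nerveMap_arr {m n : ℕ} (θ : Fin (m + 1) →o Fin (n + 1)) (e : Edge m) :
    A.nerveMap θ ≫ A.arr m e = A.arr n (mapEdge θ e) := A.nerveMap_arrow θ e

/-- The `i`-th vertex of a simplex. -/
def vertex (n : ℕ) (i : Fin (n + 1)) : A.nerveObj n ⟶ A.ob := A.arr n (idEdge i) ≫ A.src

lemma arr_idEdge (i : Fin (n + 1)) : A.arr n (idEdge i) = A.vertex n i ≫ A.ident :=
  (A.arr_ident i).trans (Category.assoc _ _ _).symm

lemma arr_src (e : Edge n) : A.arr n e ≫ A.src = A.vertex n e.1.2 := by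
  -- The triple i ≤ j ≤ j compares the source of the edge with the target of the identity at j.
  have h := A.arr_cond ⟨(e.1.1, e.1.2, e.1.2), e.2, le_rfl⟩
  refine h.symm.trans ?_
  refine (congrArg (· ≫ A.tgt) (A.arr_idEdge e.1.2)).trans ?_
  rw [Category.assoc, ident_tgt, Category.comp_id]

lemma arr_tgt (e : Edge n) : A.arr n e ≫ A.tgt = A.vertex n e.1.1 :=
  A.arr_cond ⟨(e.1.1, e.1.1, e.1.2), le_rfl, e.2⟩

lemma nerveMap_vertex {m n : ℕ} (θ : Fin (m + 1) →o Fin (n + 1)) (i : Fin (m + 1)) :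
    A.nerveMap θ ≫ A.vertex m i = A.vertex n (θ i) := by
  unfold vertex
  rw [← Category.assoc, nerveMap_arr]
  rfl

lemma nerveMap_comp {l m n : ℕ} (θ : Fin (m + 1) →o Fin (n + 1)) (ξ : Fin (l + 1) →o Fin (m + 1)) :
    A.nerveMap θ ≫ A.nerveMap ξ = A.nerveMap (θ.comp ξ) := by
  apply A.arr_ext
  intro e
  rw [Category.assoc, nerveMap_arr, nerveMap_arr, nerveMap_arr]
  rfl

/-- The inclusion of the edge `i ≤ j` of `{0,…,n}`. -/
def edgeHom (e : Edge n) : Fin 2 →o Fin (n + 1) where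
  toFun := ![e.1.1, e.1.2]
  monotone' := by
    intro i j h
    fin_cases i <;> fin_cases j
    · exact le_rfl
    · exact e.2
    · exact absurd h (by decide)
    · exact le_rfl

/-- The edge `0 ≤ 1` of `{0,…,n+1}`. -/
def edge01 (n : ℕ) : Edge (n + 1) := ⟨(0, Fin.succ 0), Fin.zero_le _⟩

/-- Every edge is restricted from the universal 1-simplex, which lets naturality reduce questions
about edges to dimension 1. -/
lemma nerveMap_edgeHom (e : Edge n) : A.nerveMap (edgeHom e) ≫ A.arr 1 (edge01 0) =
    A.arr n e := A.nerveMap_arr _ _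

/-- The inclusion of `{1,…,n+1}` into `{0,…,n+1}`. -/
def succHom (n : ℕ) : Fin (n + 1) →o Fin (n + 2) where
  toFun := Fin.succ
  monotone' _ _ h := Fin.succ_le_succ_iff.mpr h

/-- An `n+1`-simplex is determined by its zeroth face and its first edge. -/
lemma nerve_hom_ext_succ {X : D} {p q : X ⟶ A.nerveObj (n + 1)}
    (h : p ≫ A.nerveMap (succHom n) = q ≫ A.nerveMap (succHom n))
    (h' : p ≫ A.arr (n + 1) (edge01 n) = q ≫ A.arr (n + 1) (edge01 n)) : p = q := by
  have hs : ∀ (i j : Fin (n + 1)) (hij : i ≤ j),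
      p ≫ A.arr (n + 1) ⟨(i.succ, j.succ), Fin.succ_le_succ_iff.mpr hij⟩ =
        q ≫ A.arr (n + 1) ⟨(i.succ, j.succ), Fin.succ_le_succ_iff.mpr hij⟩ := by
    intro i j hij
    have := congrArg (· ≫ A.arr n ⟨(i, j), hij⟩) h
    rw [Category.assoc, Category.assoc, nerveMap_arr] at this
    exact this
  apply A.arr_ext
  rintro ⟨⟨i, j⟩, hij⟩
  induction i using Fin.cases with
  | zero =>
    induction j using Fin.cases with
    | zero =>
      -- The edge at the vertex 0 is an identity, and that vertex is the target of the first edge.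
      have e : ∀ r : X ⟶ A.nerveObj (n + 1), r ≫ A.arr (n + 1) ⟨(0, 0), hij⟩ =
          (r ≫ A.arr (n + 1) (edge01 n)) ≫ A.tgt ≫ A.ident := by
        intro r
        rw [Category.assoc]
        refine congrArg (r ≫ ·) ((A.arr_idEdge 0).trans ?_)
        rw [← Category.assoc, arr_tgt]
        rfl
      rw [e p, e q, h']
    | succ j =>
      -- An edge from 0 to a later vertex passes through vertex 1: it is an edge of the zeroth face
      -- followed by the first edge.
      have e := A.arr_comp (n := n + 1)
        ⟨(0, Fin.succ 0, j.succ), Fin.zero_le _, Fin.succ_le_succ_iff.mpr (Fin.zero_le j)⟩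
      refine (congrArg (p ≫ ·) e).trans (Eq.trans ?_ (congrArg (q ≫ ·) e).symm)
      rw [precomp_compose, precomp_compose]
      exact A.compose_congr (hs 0 j (Fin.zero_le _)) h' _
  | succ i =>
    induction j using Fin.cases with
    | zero => exact absurd hij (by simp)
    | succ j => exact hs i j (Fin.succ_le_succ_iff.mp hij)

/-! ### Extending a simplex by one arrow. -/

section Cons

variable {X : D} (p : X ⟶ A.nerveObj n) (g : X ⟶ A.mor) (h : g ≫ A.src = p ≫ A.vertex n 0)

include h in
lemma cons_aux (k : Fin (n + 1)) :
    (p ≫ A.arr n ⟨(0, k), Fin.zero_le k⟩) ≫ A.tgt = g ≫ A.src := by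
  rw [Category.assoc, arr_tgt, h]

/-- The vertices of the string obtained by extending a simplex by an arrow out of its zeroth
vertex. -/
def consVertex : Fin (n + 2) → (X ⟶ A.ob) := Fin.cases (g ≫ A.tgt) (fun i => p ≫ A.vertex n i)

/-- The arrows of the string obtained by extending a simplex by an arrow out of its zeroth
vertex. -/
def consArrow : (i j : Fin (n + 2)) → i ≤ j → (X ⟶ A.mor) :=
  Fin.cases
    (Fin.cases (fun _ => g ≫ A.tgt ≫ A.ident)
      (fun k _ => A.compose (p ≫ A.arr n ⟨(0, k), Fin.zero_le k⟩) g (A.cons_aux p g h k)))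
    (fun i => Fin.cases (fun hi => absurd hi (by simp))
      (fun j hij => p ≫ A.arr n ⟨(i, j), Fin.succ_le_succ_iff.mp hij⟩))

lemma consArrow_src (i j : Fin (n + 2)) (hij : i ≤ j) :
    A.consArrow p g h i j hij ≫ A.src = A.consVertex p g j := by
  induction i using Fin.cases with
  | zero =>
    induction j using Fin.cases with
    | zero =>
      change (g ≫ A.tgt ≫ A.ident) ≫ A.src = g ≫ A.tgt
      simp
    | succ j =>
      refine (A.compose_src _ _ _).trans ?_
      rw [Category.assoc, arr_src]
      rfl
  | succ i =>
    induction j using Fin.cases with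
    | zero => exact absurd hij (by simp)
    | succ j =>
      change (p ≫ A.arr n _) ≫ A.src = p ≫ A.vertex n j
      rw [Category.assoc, arr_src]

lemma consArrow_tgt (i j : Fin (n + 2)) (hij : i ≤ j) :
    A.consArrow p g h i j hij ≫ A.tgt = A.consVertex p g i := by
  induction i using Fin.cases with
  | zero =>
    induction j using Fin.cases with
    | zero =>
      change (g ≫ A.tgt ≫ A.ident) ≫ A.tgt = g ≫ A.tgt
      simp
    | succ j => exact A.compose_tgt _ _ _
  | succ i =>
    induction j using Fin.cases with
    | zero => exact absurd hij (by simp)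
    | succ j =>
      change (p ≫ A.arr n _) ≫ A.tgt = p ≫ A.vertex n i
      rw [Category.assoc, arr_tgt]

lemma consArrow_self (i : Fin (n + 2)) :
    A.consArrow p g h i i le_rfl = A.consVertex p g i ≫ A.ident := by
  induction i using Fin.cases with
  | zero => exact (Category.assoc _ _ _).symm
  | succ i => exact (congrArg (p ≫ ·) (A.arr_idEdge i)).trans (Category.assoc _ _ _).symm

/-- Only triples starting at the new vertex with i < j need an argument, and there it is
associativity; the others follow from a unit law or from the composition law of p. -/
lemma consArrow_comp (i j k : Fin (n + 2)) (hij : i ≤ j) (hjk : j ≤ k) (hc) :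
    A.consArrow p g h i k (hij.trans hjk) =
      A.compose (A.consArrow p g h j k hjk) (A.consArrow p g h i j hij) hc := by
  -- Treating i = j separately rules out j = 0 afterwards, so the edge from j to k lies in the old
  -- simplex.
  rcases eq_or_ne i j with rfl | hne
  · refine Eq.trans ?_ (A.compose_congr rfl (A.consArrow_self p g h i).symm
      (by rw [consArrow_tgt]; simp))
    rw [A.compose_ident']
  induction j using Fin.cases with
  | zero => exact absurd (Fin.le_zero_iff.mp hij) hne
  | succ j =>
    induction k using Fin.cases with
    | zero => exact absurd hjk (by simp)
    | succ k =>
      have hjk' := Fin.succ_le_succ_iff.mp hjk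
      induction i using Fin.cases with
      | zero =>
        have e := congrArg (p ≫ ·) (A.arr_comp ⟨(0, j, k), Fin.zero_le j, hjk'⟩)
        rw [precomp_compose] at e
        refine (A.compose_congr e rfl _).trans ?_
        exact A.compose_assoc _ _ _ _ (A.cons_aux p g h j) _ _
      | succ i =>
        have e := congrArg (p ≫ ·)
          (A.arr_comp ⟨(i, j, k), Fin.succ_le_succ_iff.mp hij, hjk'⟩)
        rw [precomp_compose] at e
        exact e

/-- The simplex obtained by extending a simplex by an arrow out of its zeroth vertex. -/
def cons : X ⟶ A.nerveObj (n + 1) :=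
  A.nerveLift (fun e => A.consArrow p g h e.1.1 e.1.2 e.2)
    (fun t => (A.consArrow_tgt p g h _ _ _).trans (A.consArrow_src p g h _ _ _).symm)
    (fun i => by
      rw [← Category.assoc, consArrow_src]
      exact A.consArrow_self p g h i)
    (fun t => A.consArrow_comp p g h _ _ _ _ _ _)

lemma cons_arr01 : A.cons p g h ≫ A.arr (n + 1) (edge01 n) = g := by
  refine (A.nerveLift_arr _ _ _ _ _).trans ?_
  refine (A.compose_congr (congrArg (p ≫ ·) (A.arr_idEdge 0)) rfl _).trans ?_
  exact A.ident_compose₂ _ _ _ _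

lemma cons_succ : A.cons p g h ≫ A.nerveMap (succHom n) = p := by
  apply A.arr_ext
  rintro ⟨⟨i, j⟩, hij⟩
  rw [Category.assoc, nerveMap_arr]
  exact A.nerveLift_arr _ _ _ _ _

lemma cons_arr_succ (i j : Fin (n + 1)) (hij : i ≤ j) :
    A.cons p g h ≫ A.arr (n + 1) ⟨(i.succ, j.succ), Fin.succ_le_succ_iff.mpr hij⟩ =
      p ≫ A.arr n ⟨(i, j), hij⟩ :=
  A.nerveLift_arr _ _ _ _ _

end Cons

/-- The `0`-simplex given by an object. -/
def point {X : D} (x : X ⟶ A.ob) : X ⟶ A.nerveObj 0 :=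
  A.nerveLift (fun _ => x ≫ A.ident) (fun _ => by simp) (fun _ => by simp)
    (fun _ => (A.compose_ident' _ _ _).symm)

lemma point_arr {X : D} (x : X ⟶ A.ob) (e : Edge 0) : A.point x ≫ A.arr 0 e = x ≫ A.ident :=
  A.nerveLift_arr _ _ _ _ _

lemma point_vertex {X : D} (x : X ⟶ A.ob) (i : Fin 1) : A.point x ≫ A.vertex 0 i = x := by
  unfold vertex
  rw [← Category.assoc, point_arr, Category.assoc, ident_src, Category.comp_id]

lemma nerve_hom_ext_zero {X : D} {p q : X ⟶ A.nerveObj 0}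
    (h : p ≫ A.vertex 0 0 = q ≫ A.vertex 0 0) : p = q := by
  apply A.arr_ext
  intro e
  obtain rfl : e = idEdge 0 :=
    Subtype.ext (Prod.ext (Subsingleton.elim (α := Fin 1) _ _)
      (Subsingleton.elim (α := Fin 1) _ _))
  rw [arr_idEdge, reassoc_of% h]

/-- Together with `point_vertex`, this identifies the 0-simplices with the objects; `arr_segment`
and `segment_arr` do the same for arrows. -/
lemma vertex_zero_point : A.vertex 0 0 ≫ A.point (𝟙 _) = 𝟙 _ :=
  A.nerve_hom_ext_zero (by rw [Category.assoc, point_vertex, Category.comp_id, Category.id_comp])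

/-- The `1`-simplex given by an arrow. -/
def segment {X : D} (g : X ⟶ A.mor) : X ⟶ A.nerveObj 1 :=
  A.cons (A.point (g ≫ A.src)) g (A.point_vertex _ _).symm

lemma segment_arr {X : D} (g : X ⟶ A.mor) : A.segment g ≫ A.arr 1 (edge01 0) = g :=
  A.cons_arr01 _ _ _

lemma nerve_hom_ext_one {X : D} {p q : X ⟶ A.nerveObj 1}
    (h : p ≫ A.arr 1 (edge01 0) = q ≫ A.arr 1 (edge01 0)) : p = q := by
  apply A.nerve_hom_ext_succ _ h
  apply A.nerve_hom_ext_zero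
  rw [Category.assoc, Category.assoc, nerveMap_vertex]
  have e := congrArg (· ≫ A.src) h
  rw [Category.assoc, Category.assoc, arr_src] at e
  exact e

lemma arr_segment : A.arr 1 (edge01 0) ≫ A.segment (𝟙 _) = 𝟙 _ :=
  A.nerve_hom_ext_one (by rw [Category.assoc, segment_arr, Category.comp_id, Category.id_comp])

end InternalCat

/-! ### Functors between internal categories and maps between their nerves. -/

namespace InternalCat

variable {A B E : InternalCat D}

/-- The action of an internal functor on `n`-simplices. -/
def nerveHomApp (F : A ⟶ B) (n : ℕ) : A.nerveObj n ⟶ B.nerveObj n :=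
  B.nerveLift (fun e => A.arr n e ≫ F.map)
    (fun t => F.map_aux (A.arr_cond t))
    (fun i => by
      rw [Category.assoc, F.map_src_assoc, ← F.ident_map, ← Category.assoc A.src,
        ← Category.assoc (A.arr n (idEdge i)), ← A.arr_ident i])
    (fun t => by rw [A.arr_comp t, F.compose_map'])

lemma nerveHomApp_arr (F : A ⟶ B) (n : ℕ) (e : Edge n) :
    nerveHomApp F n ≫ B.arr n e = A.arr n e ≫ F.map :=
  B.nerveLift_arr _ _ _ _ _

lemma nerveHomApp_naturality (F : A ⟶ B) {m n : ℕ} (θ : Fin (m + 1) →o Fin (n + 1)) :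
    A.nerveMap θ ≫ nerveHomApp F m = nerveHomApp F n ≫ B.nerveMap θ := by
  apply B.arr_ext
  intro e
  rw [Category.assoc, Category.assoc, nerveHomApp_arr, nerveMap_arr, nerveHomApp_arr,
    ← Category.assoc, nerveMap_arr]

/-- An internal functor acts on nerves. -/
def nerveHom (F : A ⟶ B) : A.nerve ⟶ B.nerve where
  app n := nerveHomApp F n.unop.len
  naturality _ _ θ := nerveHomApp_naturality F θ.unop.toOrderHom

lemma nerveHom_id : nerveHom (𝟙 A) = 𝟙 A.nerve := by
  apply NatTrans.ext
  funext n
  apply A.arr_ext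
  intro e
  exact (nerveHomApp_arr _ _ e).trans ((Category.comp_id _).trans (Category.id_comp _).symm)

lemma nerveHomApp_comp (F : A ⟶ B) (G : B ⟶ E) (n : ℕ) :
    nerveHomApp (F ≫ G) n = nerveHomApp F n ≫ nerveHomApp G n := by
  apply E.arr_ext
  intro e
  rw [Category.assoc, nerveHomApp_arr, nerveHomApp_arr, ← Category.assoc, nerveHomApp_arr,
    Category.assoc, comp_map]

lemma nerveHom_comp (F : A ⟶ B) (G : B ⟶ E) : nerveHom (F ≫ G) = nerveHom F ≫ nerveHom G :=
  NatTrans.ext (funext fun n => nerveHomApp_comp F G n.unop.len)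

/-- A component of a map of nerves. -/
def nApp (p : A.nerve ⟶ B.nerve) (n : ℕ) : A.nerveObj n ⟶ B.nerveObj n := p.app (op ⦋n⦌)

lemma nApp_naturality (p : A.nerve ⟶ B.nerve) {m n : ℕ} (θ : Fin (m + 1) →o Fin (n + 1)) :
    A.nerveMap θ ≫ nApp p m = nApp p n ≫ B.nerveMap θ :=
  p.naturality (SimplexCategory.mkHom θ).op

/-- The action on objects of a map of nerves. -/
def nerveHomObj (p : A.nerve ⟶ B.nerve) : A.ob ⟶ B.ob :=
  A.point (𝟙 _) ≫ nApp p 0 ≫ B.vertex 0 0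

/-- The action on arrows of a map of nerves. -/
def nerveHomMap (p : A.nerve ⟶ B.nerve) : A.mor ⟶ B.mor :=
  A.segment (𝟙 _) ≫ nApp p 1 ≫ B.arr 1 (edge01 0)

lemma nApp_vertex (p : A.nerve ⟶ B.nerve) {n : ℕ} (i : Fin (n + 1)) :
    nApp p n ≫ B.vertex n i = A.vertex n i ≫ nerveHomObj p := by
  let θ : Fin (0 + 1) →o Fin (n + 1) := ⟨fun _ => i, fun _ _ _ => le_rfl⟩
  have e₁ : A.nerveMap θ ≫ A.vertex 0 0 = A.vertex n i := A.nerveMap_vertex θ 0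
  have e₂ : B.nerveMap θ ≫ B.vertex 0 0 = B.vertex n i := B.nerveMap_vertex θ 0
  unfold nerveHomObj
  rw [← e₁, ← e₂, ← Category.assoc, ← nApp_naturality, Category.assoc, Category.assoc,
    reassoc_of% A.vertex_zero_point]

/-- Naturality along the inclusion of an edge reduces this to 1-simplices, so a map of nerves is
governed by its effect on arrows in every dimension. -/
lemma nApp_arr (p : A.nerve ⟶ B.nerve) {n : ℕ} (e : Edge n) :
    nApp p n ≫ B.arr n e = A.arr n e ≫ nerveHomMap p := by
  unfold nerveHomMap
  rw [← A.nerveMap_edgeHom, ← B.nerveMap_edgeHom, ← Category.assoc, ← nApp_naturality,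
    Category.assoc, Category.assoc, reassoc_of% A.arr_segment]

/-- The internal functor underlying a map of nerves. -/
def ofNerveHom (p : A.nerve ⟶ B.nerve) : A ⟶ B :=
  { obj := nerveHomObj p
    map := nerveHomMap p
    map_src := by
      have e := congrArg (fun k => A.segment (𝟙 _) ≫ k ≫ B.src) (nApp_arr p (edge01 0))
      rw [Category.assoc, arr_src, nApp_vertex, Category.assoc,
        reassoc_of% (A.segment_arr (𝟙 A.mor))] at e
      rw [← e, ← Category.assoc]
      refine congrArg (· ≫ nerveHomObj p) ?_
      have e' := congrArg (· ≫ A.src) (A.segment_arr (𝟙 A.mor))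
      rw [Category.assoc, arr_src, Category.id_comp] at e'
      exact e'
    map_tgt := by
      have e := congrArg (fun k => A.segment (𝟙 _) ≫ k ≫ B.tgt) (nApp_arr p (edge01 0))
      rw [Category.assoc, arr_tgt, nApp_vertex, Category.assoc,
        reassoc_of% (A.segment_arr (𝟙 A.mor))] at e
      rw [← e, ← Category.assoc]
      refine congrArg (· ≫ nerveHomObj p) ?_
      have e' := congrArg (· ≫ A.tgt) (A.segment_arr (𝟙 A.mor))
      rw [Category.assoc, arr_tgt, Category.id_comp] at e'
      exact e'
    ident_map := by
      have e := congrArg (A.point (𝟙 _) ≫ ·) (nApp_arr p (idEdge (0 : Fin 1)))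
      rw [arr_idEdge, reassoc_of% (nApp_vertex p (0 : Fin 1)),
        reassoc_of% (A.point_vertex (𝟙 A.ob) 0), arr_idEdge, Category.assoc,
        reassoc_of% (A.point_vertex (𝟙 A.ob) 0)] at e
      exact e.symm
    compose_map := by
      intro X f g h h'
      have hv : g ≫ A.src = A.segment f ≫ A.vertex 1 0 := by
        have e := congrArg (· ≫ A.tgt) (A.segment_arr f)
        rw [Category.assoc, arr_tgt] at e
        rw [← h, ← e]
        rfl
      -- A composable pair is a 2-simplex whose long edge is the composite. Since p respects all
      -- three edges, the composition law of the image simplex is the claim.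
      let s : X ⟶ A.nerveObj 2 := A.cons (A.segment f) g hv
      let t : Triple 2 := ⟨(0, 1, 2), by decide, by decide⟩
      have h₁ : s ≫ A.arr 2 t.jk = f :=
        (A.cons_arr_succ _ _ hv 0 1 (by decide)).trans (A.segment_arr f)
      have h₂ : s ≫ A.arr 2 t.ij = g := A.cons_arr01 _ _ hv
      have h₃ : s ≫ A.arr 2 t.ik = A.compose f g h := by
        rw [A.arr_comp t, precomp_compose]
        exact A.compose_congr h₁ h₂ _
      rw [← h₃, Category.assoc, ← nApp_arr, B.arr_comp t, precomp_compose, precomp_compose]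
      refine B.compose_congr ?_ ?_ _
      · rw [nApp_arr, ← Category.assoc, h₁]
      · rw [nApp_arr, ← Category.assoc, h₂] }

lemma ofNerveHom_id : ofNerveHom (𝟙 A.nerve) = 𝟙 A := by
  apply hom_ext
  · refine Eq.trans ?_ (A.point_vertex (𝟙 _) 0)
    exact congrArg (_ ≫ ·) (Category.id_comp _)
  · refine Eq.trans ?_ (A.segment_arr (𝟙 _))
    exact congrArg (_ ≫ ·) (Category.id_comp _)

/-- Functoriality of `ofNerveHom` alone turns an isomorphism of nerves into an isomorphism of
internal categories. -/
lemma ofNerveHom_comp (p : A.nerve ⟶ B.nerve) (q : B.nerve ⟶ E.nerve) :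
    ofNerveHom (p ≫ q) = ofNerveHom p ≫ ofNerveHom q := by
  apply hom_ext
  · change A.point _ ≫ (nApp p 0 ≫ nApp q 0) ≫ E.vertex 0 0 =
      (A.point _ ≫ nApp p 0 ≫ B.vertex 0 0) ≫ nerveHomObj q
    rw [Category.assoc, Category.assoc, Category.assoc, nApp_vertex]
  · change A.segment _ ≫ (nApp p 1 ≫ nApp q 1) ≫ E.arr 1 (edge01 0) =
      (A.segment _ ≫ nApp p 1 ≫ B.arr 1 (edge01 0)) ≫ nerveHomMap q
    rw [Category.assoc, Category.assoc, Category.assoc, nApp_arr]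

/-- Isomorphic internal categories have isomorphic nerves. -/
def nerveIso (e : A ⟶ B) (e' : B ⟶ A) (h : e ≫ e' = 𝟙 A) (h' : e' ≫ e = 𝟙 B) :
    A.nerve ≅ B.nerve where
  hom := nerveHom e
  inv := nerveHom e'
  hom_inv_id := by rw [← nerveHom_comp, h, nerveHom_id]
  inv_hom_id := by rw [← nerveHom_comp, h', nerveHom_id]

lemma ofNerveHom_hom_inv (i : A.nerve ≅ B.nerve) :
    ofNerveHom i.hom ≫ ofNerveHom i.inv = 𝟙 A :=
  (ofNerveHom_comp i.hom i.inv).symm.trans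
    ((congrArg ofNerveHom i.hom_inv_id).trans ofNerveHom_id)

end InternalCat

end NerveFunctor

/-! ### Strict morphisms and nerves of categorical algebras -/

section AlgebraNerve

variable {C : Type u} [Category.{v} C] [HasFiniteLimits C] {T : Monad C} [IsCartesianMonad T]

open InternalCat

namespace CatAlg

variable {A B E : CatAlg T}

/-- A strict morphism, as a functor between internal categories in algebras. -/
def toAlgHom (F : A ⟶ B) : A.toAlgCat ⟶ B.toAlgCat :=
  { obj := { f := F.func.obj, h := F.comm_obj }
    map := { f := F.func.map, h := F.comm_map }
    map_src := Monad.Algebra.Hom.ext F.func.map_src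
    map_tgt := Monad.Algebra.Hom.ext F.func.map_tgt
    ident_map := Monad.Algebra.Hom.ext F.func.ident_map
    compose_map := by
      intro X f g h h'
      refine (congrArg (· ≫ _) (A.toAlgData_compose f g h)).trans
        (Eq.trans ?_ (B.toAlgData_compose _ _ h').symm)
      exact Monad.Algebra.Hom.ext (F.func.compose_map' _ _ (A.composeHom_aux h)) }

/-- The map of algebras out of a free algebra that extends a generalised arrow. -/
def extendArrow {X : C} (f : X ⟶ A.cat.mor) : T.free.obj X ⟶ A.morAlg where
  f := T.map f ≫ A.act.map
  h := by
    change T.map (T.map f ≫ A.act.map) ≫ A.act.map = T.μ.app X ≫ T.map f ≫ A.act.map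
    rw [T.map_comp, Category.assoc, ← A.assoc_map, mu_nat_assoc]

lemma eta_extendArrow {X : C} (f : X ⟶ A.cat.mor) : T.η.app X ≫ (extendArrow f).f = f := by
  change T.η.app X ≫ T.map f ≫ A.act.map = f
  rw [eta_nat_assoc, A.unit_map]
  exact Category.comp_id f

lemma extendArrow_aux {X : C} {f g : X ⟶ A.cat.mor} (h : f ≫ A.cat.tgt = g ≫ A.cat.src) :
    extendArrow f ≫ A.tgtHom = extendArrow g ≫ A.srcHom :=
  Monad.Algebra.Hom.ext (LaxHom.act_aux A h)

/-- The strict morphism underlying a functor between internal categories in algebras. -/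
def ofAlgHom (G : A.toAlgCat ⟶ B.toAlgCat) : A ⟶ B where
  func :=
    { obj := G.obj.f
      map := G.map.f
      map_src := congrArg Monad.Algebra.Hom.f G.map_src
      map_tgt := congrArg Monad.Algebra.Hom.f G.map_tgt
      ident_map := congrArg Monad.Algebra.Hom.f G.ident_map
      compose_map := by
        intro X f g h h'
        -- G preserves composites only of algebra maps, whereas f and g are arbitrary arrows of `C`.
        -- They are extended to the free algebra on X, composed there, and restricted back along η.
        have hx := extendArrow_aux h
        have e := (congrArg (· ≫ G.map) (A.toAlgData_compose _ _ hx)).symm.trans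
          ((G.compose_map' _ _ hx).trans (B.toAlgData_compose _ _ _))
        have e' := congrArg (fun k => T.η.app X ≫ Monad.Algebra.Hom.f k) e
        refine Eq.trans ?_ (e'.trans ?_)
        · refine Eq.trans ?_ (Category.assoc _ _ _)
          refine congrArg (· ≫ G.map.f) ?_
          refine Eq.trans ?_ (A.cat.precomp_compose _ _ _ _).symm
          exact A.cat.compose_congr (eta_extendArrow f).symm (eta_extendArrow g).symm _
        · refine (B.cat.precomp_compose _ _ _ _).trans (B.cat.compose_congr ?_ ?_ _)
          · exact (Category.assoc _ _ _).symm.trans (congrArg (· ≫ G.map.f) (eta_extendArrow f))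
          · exact (Category.assoc _ _ _).symm.trans (congrArg (· ≫ G.map.f) (eta_extendArrow g)) }
  comm := InternalCat.hom_ext G.obj.h G.map.h

/-- Isomorphic categorical algebras have isomorphic nerves. -/
lemma nonempty_nerve_iso (e : A ⟶ B) (e' : B ⟶ A) (h : e ≫ e' = 𝟙 A) (h' : e' ≫ e = 𝟙 B) :
    Nonempty (A.nerve ≅ B.nerve) :=
  -- `toAlgHom` preserves identities and composites definitionally, so the two equations transfer
  -- without further work.
  ⟨nerveIso (toAlgHom e) (toAlgHom e') (congrArg toAlgHom h) (congrArg toAlgHom h')⟩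

/-- Categorical algebras with isomorphic nerves are isomorphic. -/
lemma exists_iso_of_nerve_iso (i : A.nerve ≅ B.nerve) :
    ∃ (e : A ⟶ B) (e' : B ⟶ A), e ≫ e' = 𝟙 A ∧ e' ≫ e = 𝟙 B :=
  ⟨ofAlgHom (ofNerveHom i.hom), ofAlgHom (ofNerveHom i.inv),
    congrArg ofAlgHom (ofNerveHom_hom_inv i), congrArg ofAlgHom (ofNerveHom_hom_inv i.symm)⟩

end CatAlg

end AlgebraNerve

/-! ### Simplicial objects that are nerves -/

section Segal

variable {D : Type u} [Category.{v} D] [HasFiniteLimits D]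

open InternalCat Opposite Simplicial

/-- The action of a monotone map on a simplicial object. -/
def simpMap (X : SimplicialObject D) {m n : ℕ} (θ : Fin (m + 1) →o Fin (n + 1)) :
    X.obj (op ⦋n⦌) ⟶ X.obj (op ⦋m⦌) :=
  X.map (SimplexCategory.mkHom θ).op

lemma simpMap_comp (X : SimplicialObject D) {l m n : ℕ} (θ : Fin (m + 1) →o Fin (n + 1))
    (ξ : Fin (l + 1) →o Fin (m + 1)) : simpMap X θ ≫ simpMap X ξ = simpMap X (θ.comp ξ) :=
  (X.map_comp _ _).symm

/-- The inclusion of the vertex `i` of `{0,…,n}`. -/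
def vertexHom (n : ℕ) (i : Fin (n + 1)) : Fin (0 + 1) →o Fin (n + 1) :=
  ⟨fun _ => i, fun _ _ _ => le_rfl⟩

/-- The inclusion of the triangle `i ≤ j ≤ k` of `{0,…,n}`. -/
def tripleHom {n : ℕ} (t : Triple n) : Fin (2 + 1) →o Fin (n + 1) where
  toFun := ![t.1.1, t.1.2.1, t.1.2.2]
  monotone' := by
    intro i j h
    fin_cases i <;> fin_cases j
    · exact le_rfl
    · exact t.2.1
    · exact t.2.1.trans t.2.2
    · exact absurd h (by decide)
    · exact le_rfl
    · exact t.2.2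
    · exact absurd h (by decide)
    · exact absurd h (by decide)
    · exact le_rfl

/-- The triangle `0 ≤ 1 ≤ 2`. -/
def triple012 : Triple 2 := ⟨(0, 1, 2), by decide, by decide⟩

lemma orderHom_one_ext {n : ℕ} {f g : Fin (1 + 1) →o Fin (n + 1)} (h₀ : f 0 = g 0)
    (h₁ : f 1 = g 1) : f = g := by
  apply OrderHom.ext
  funext i
  fin_cases i
  · exact h₀
  · exact h₁

/-- A simplicial object `X` and an internal category `A` that agree in low dimensions. -/
structure LowIso (X : SimplicialObject D) (A : InternalCat D) where
  e₀ : X.obj (op ⦋0⦌) ≅ A.ob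
  e₁ : X.obj (op ⦋1⦌) ≅ A.mor
  src : e₁.hom ≫ A.src = simpMap X (vertexHom 1 1) ≫ e₀.hom
  tgt : e₁.hom ≫ A.tgt = simpMap X (vertexHom 1 0) ≫ e₀.hom
  ident : e₀.hom ≫ A.ident = simpMap X ⟨fun _ => 0, fun _ _ _ => le_rfl⟩ ≫ e₁.hom
  comp : ∀ h, A.compose (simpMap X (edgeHom triple012.jk) ≫ e₁.hom)
    (simpMap X (edgeHom triple012.ij) ≫ e₁.hom) h = simpMap X (edgeHom triple012.ik) ≫ e₁.hom

namespace LowIso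

variable {X : SimplicialObject D} {A : InternalCat D} (L : LowIso X A)

/-- The arrow of `A` given by an edge of a simplex of `X`. -/
def edge {n : ℕ} (e : Edge n) : X.obj (op ⦋n⦌) ⟶ A.mor := simpMap X (edgeHom e) ≫ L.e₁.hom

lemma edge_src {n : ℕ} (e : Edge n) :
    L.edge e ≫ A.src = simpMap X (vertexHom n e.1.2) ≫ L.e₀.hom := by
  rw [edge, Category.assoc, L.src, ← Category.assoc, simpMap_comp]
  rfl

lemma edge_tgt {n : ℕ} (e : Edge n) :
    L.edge e ≫ A.tgt = simpMap X (vertexHom n e.1.1) ≫ L.e₀.hom := by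
  rw [edge, Category.assoc, L.tgt, ← Category.assoc, simpMap_comp]
  rfl

lemma simpMap_edge {m n : ℕ} (θ : Fin (m + 1) →o Fin (n + 1)) (e : Edge m) :
    simpMap X θ ≫ L.edge e = L.edge (mapEdge θ e) := by
  rw [edge, ← Category.assoc, simpMap_comp, edge]
  refine congrArg (fun k => simpMap X k ≫ L.e₁.hom) (orderHom_one_ext rfl rfl)

/-- The comparison map to the nerve, in each dimension. -/
def toNerveApp (n : ℕ) : X.obj (op ⦋n⦌) ⟶ A.nerveObj n :=
  A.nerveLift (fun e => L.edge e)
    (fun t => (L.edge_tgt _).trans (L.edge_src t.ij).symm)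
    (fun i => by
      rw [← Category.assoc, edge_src, Category.assoc, L.ident, ← Category.assoc, simpMap_comp, edge]
      exact congrArg (fun k => simpMap X k ≫ L.e₁.hom) (orderHom_one_ext rfl rfl))
    (fun t => by
      -- The composition law is known for the triangle 0 ≤ 1 ≤ 2 and is restricted along the
      -- inclusion of t.
      have h₁ : L.edge triple012.jk ≫ A.tgt = L.edge triple012.ij ≫ A.src :=
        (L.edge_tgt _).trans (L.edge_src triple012.ij).symm
      have e := (A.precomp_compose (simpMap X (tripleHom t)) _ _ h₁).symm.trans
        (congrArg (simpMap X (tripleHom t) ≫ ·) (L.comp h₁))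
      refine (L.simpMap_edge (tripleHom t) triple012.ik).symm.trans (e.symm.trans ?_)
      exact A.compose_congr (L.simpMap_edge (tripleHom t) triple012.jk)
        (L.simpMap_edge (tripleHom t) triple012.ij) _)

lemma toNerveApp_arr {n : ℕ} (e : Edge n) : L.toNerveApp n ≫ A.arr n e = L.edge e :=
  A.nerveLift_arr _ _ _ _ _

lemma toNerveApp_naturality {m n : ℕ} (θ : Fin (m + 1) →o Fin (n + 1)) :
    simpMap X θ ≫ L.toNerveApp m = L.toNerveApp n ≫ A.nerveMap θ := by
  apply A.arr_ext
  intro e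
  rw [Category.assoc, Category.assoc, toNerveApp_arr, nerveMap_arr, toNerveApp_arr, simpMap_edge]

/-- The comparison map to the nerve. -/
def toNerve : X ⟶ A.nerve where
  app n := L.toNerveApp n.unop.len
  naturality _ _ θ := L.toNerveApp_naturality θ.unop.toOrderHom

/-- Induction on n: by the Segal pullback a simplex of X is its zeroth face together with its first
edge, and by `nerve_hom_ext_succ` these also determine a simplex of the nerve. The inverse is the
lift of the face and edge of the nerve, pulled back through the isomorphisms already known. -/
lemma isIso_toNerveApp
    (h : ∀ n, IsPullback (simpMap X (succHom n)) (simpMap X (edgeHom (edge01 n)))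
      (simpMap X (vertexHom n 0)) (simpMap X (vertexHom 1 1))) (n : ℕ) :
    IsIso (L.toNerveApp n) := by
  induction n with
  | zero =>
    have e : L.toNerveApp 0 ≫ A.vertex 0 0 = L.e₀.hom := by
      unfold vertex
      refine (Category.assoc _ _ _).symm.trans ?_
      refine (congrArg (· ≫ A.src) (L.toNerveApp_arr (idEdge 0))).trans ?_
      rw [edge_src]
      refine Eq.trans (congrArg (· ≫ L.e₀.hom) ?_) (Category.id_comp _)
      refine Eq.trans ?_ (X.map_id _)
      refine congrArg (fun k => simpMap X k) (OrderHom.ext _ _ (funext fun i => ?_))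
      exact Subsingleton.elim (α := Fin 1) _ _
    refine ⟨A.vertex 0 0 ≫ L.e₀.inv, ?_, ?_⟩
    · rw [reassoc_of% e, Iso.hom_inv_id]
    · apply A.nerve_hom_ext_zero
      rw [Category.assoc, Category.assoc, e, Iso.inv_hom_id, Category.comp_id, Category.id_comp]
  | succ n ih =>
    obtain ⟨s, hs⟩ : ∃ s : A.nerveObj (n + 1) ⟶ X.obj (op ⦋n⦌),
        s ≫ L.toNerveApp n = A.nerveMap (succHom n) :=
      ⟨A.nerveMap (succHom n) ≫ inv (L.toNerveApp n), by
        rw [Category.assoc, IsIso.inv_hom_id, Category.comp_id]⟩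
    obtain ⟨g, hg⟩ : ∃ g : A.nerveObj (n + 1) ⟶ X.obj (op ⦋1⦌),
        g ≫ L.e₁.hom = A.arr (n + 1) (edge01 n) :=
      ⟨A.arr (n + 1) (edge01 n) ≫ L.e₁.inv, by
        rw [Category.assoc, Iso.inv_hom_id, Category.comp_id]⟩
    have hv : L.toNerveApp n ≫ A.vertex n 0 = simpMap X (vertexHom n 0) ≫ L.e₀.hom := by
      unfold vertex
      refine (Category.assoc _ _ _).symm.trans ?_
      refine (congrArg (· ≫ A.src) (L.toNerveApp_arr (idEdge 0))).trans ?_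
      rw [edge_src]
      rfl
    -- The zeroth vertex of the face and the source of the first edge are both vertex 1 of the given
    -- simplex.
    have hsg : s ≫ simpMap X (vertexHom n 0) = g ≫ simpMap X (vertexHom 1 1) := by
      rw [← cancel_mono L.e₀.hom, Category.assoc, Category.assoc, ← hv, ← L.src,
        reassoc_of% hs, reassoc_of% hg, nerveMap_vertex, arr_src]
      rfl
    refine ⟨(h n).lift s g hsg, ?_, ?_⟩
    · apply (h n).hom_ext
      · rw [Category.assoc, IsPullback.lift_fst, Category.id_comp, ← cancel_mono (L.toNerveApp n),
          Category.assoc, hs, toNerveApp_naturality]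
      · rw [Category.assoc, IsPullback.lift_snd, Category.id_comp, ← cancel_mono L.e₁.hom,
          Category.assoc, hg, toNerveApp_arr]
        rfl
    · apply A.nerve_hom_ext_succ
      · rw [Category.assoc, ← toNerveApp_naturality, IsPullback.lift_fst_assoc, hs,
          Category.id_comp]
      · rw [Category.assoc, toNerveApp_arr, edge, IsPullback.lift_snd_assoc, hg, Category.id_comp]

/-- A simplicial object that satisfies the Segal condition is the nerve of any internal category
that it agrees with in low dimensions. -/
lemma nonempty_iso_nerve (L : LowIso X A)
    (h : ∀ n, IsPullback (simpMap X (succHom n)) (simpMap X (edgeHom (edge01 n)))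
      (simpMap X (vertexHom n 0)) (simpMap X (vertexHom 1 1))) : Nonempty (X ≅ A.nerve) := by
  have : ∀ n, IsIso (L.toNerve.app n) := fun n => L.isIso_toNerveApp h n.unop.len
  have : IsIso L.toNerve := NatIso.isIso_of_isIso_app _
  exact ⟨asIso L.toNerve⟩

end LowIso

end Segal

/-! ### The bar construction is the nerve of the classifier -/

section IterMap

open InternalCat

variable {D : Type u} [Category.{v} D] (G : Comonad D) (X : D)

/-- If `0` is the only element over `0`, then the operator is `G` applied to the operator of the
remaining elements. -/
lemma iterMap_keep_one {n m : ℕ} (f : Fin (m + 1) →o Fin (n + 1)) (h : f 0 = 0)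
    (h' : ∀ i, tailHom f i ≠ 0) :
    iterMap G X (n + 1) (m + 1) f = underG (iterMap G X n m (dropZero (tailHom f) h')) := by
  rw [iterMap_keep G X f h, iterMap_skip G X _ h', underG_comp, ← Category.assoc,
    comul_under_counit, Category.id_comp]

lemma dropZero_succ {m n : ℕ} (f : Fin m →o Fin (n + 1)) (h : ∀ i, f i ≠ 0) (i : Fin m) :
    (dropZero f h i).succ = f i := Fin.succ_pred _ (h i)

lemma iterMap_eq_id {n : ℕ} (f : Fin n →o Fin n) (h : ∀ i, f i = i) :
    iterMap G X n n f = 𝟙 _ := by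
  obtain rfl : f = OrderHom.id := OrderHom.ext _ _ (funext h)
  exact iterMap_id G X n

/-- Omitting 0 empties only the fibre of the outermost factor, so the operator is a single counit.
-/
lemma iterMap_eq_counit {n : ℕ} (f : Fin n →o Fin (n + 1)) (h : ∀ i, f i = i.succ) :
    iterMap G X (n + 1) n f = counitAt G X n := by
  have h₀ : ∀ i, f i ≠ 0 := fun i => by rw [h]; exact Fin.succ_ne_zero i
  rw [iterMap_skip G X f h₀, iterMap_eq_id, Category.comp_id]
  intro i
  exact Fin.succ_injective _ ((dropZero_succ f h₀ i).trans (h i))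

/-- An unspecified k suffices: in the application its codomain is the terminal algebra, so it is
unique. -/
lemma exists_iterMap_vertex_zero (n : ℕ) (f : Fin 1 →o Fin (n + 1)) (h : f 0 = 0) :
    ∃ k : iter G X n ⟶ iter G X 0, iterMap G X (n + 1) 1 f = underG k :=
  ⟨_, iterMap_keep_one G X f h (fun i => i.elim0)⟩

lemma exists_iterMap_edge01 (n : ℕ) (f : Fin 2 →o Fin (n + 2)) (h₀ : f 0 = 0) (h₁ : f 1 = 1) :
    ∃ k : iter G X n ⟶ iter G X 0, iterMap G X (n + 2) 2 f = underG (underG k) := by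
  have h' : ∀ i, tailHom f i ≠ 0 := by
    intro i
    obtain rfl : i = 0 := Subsingleton.elim _ _
    change f 1 ≠ 0
    rw [h₁]
    exact Fin.succ_ne_zero (0 : Fin (n + 1))
  obtain ⟨k, hk⟩ := exists_iterMap_vertex_zero G X n (dropZero (tailHom f) h')
    (Fin.succ_injective _ ((dropZero_succ (tailHom f) h' 0).trans h₁))
  exact ⟨k, by rw [iterMap_keep_one G X f h₀ h', hk]⟩

lemma iterMap_const : iterMap G X 1 2 ⟨fun _ => 0, fun _ _ _ => le_rfl⟩ = comulAt G X 0 := by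
  rw [iterMap_keep G X _ rfl, iterMap_eq_id, underG_id, Category.comp_id]
  exact fun i => Subsingleton.elim (α := Fin 1) _ _

/-- The face omitting 1 applies the counit one factor inside; in the bar construction it becomes the
composition Tμ of the classifier. -/
lemma iterMap_edge02 (f : Fin 2 →o Fin 3) (h₀ : f 0 = 0) (h₁ : f 1 = 2) :
    iterMap G X 3 2 f = underG (counitAt G X 1) := by
  have h' : ∀ i, tailHom f i ≠ 0 := by
    intro i
    obtain rfl : i = 0 := Subsingleton.elim _ _
    change f 1 ≠ 0
    rw [h₁]
    decide
  rw [iterMap_keep_one G X f h₀ h', iterMap_eq_counit]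
  intro i
  obtain rfl : i = 0 := Subsingleton.elim _ _
  exact Fin.succ_injective _ ((dropZero_succ (tailHom f) h' 0).trans h₁)

end IterMap

/-! ### The Segal condition and the low dimensions of the bar construction. -/

section Bar

open InternalCat Opposite Simplicial

variable {C : Type u} [Category.{v} C] [HasFiniteLimits C] (T : Monad C) [IsCartesianMonad T]

/-- The comonad on `T`-algebras. -/
abbrev algComonad : Comonad T.Algebra := T.adj.toComonad

lemma counitAt_f (n : ℕ) :
    (counitAt (algComonad T) (oneAlg T) (n + 1)).f =
      T.μ.app (iter (algComonad T) (oneAlg T) n).A := by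
  change (T.adj.counit.app (T.free.obj (iter (algComonad T) (oneAlg T) n).A)).f = _
  simp [Monad.adj]
  exact Category.id_comp _

lemma comulAt_f :
    (comulAt (algComonad T) (oneAlg T) 0).f = T.map (T.η.app (⊤_ C)) := by
  change T.map (T.adj.unit.app (⊤_ C)) = _
  simp [Monad.adj]
  exact congrArg (fun j => T.map j) (Category.comp_id _)

lemma to_iter_zero_f {A : T.Algebra} (k : A ⟶ iter (algComonad T) (oneAlg T) 0) :
    k.f = bang A.A := Subsingleton.elim (α := A.A ⟶ ⊤_ C) _ _

/-- The forgetful functor reflects pullbacks, and the underlying square is the naturality square of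
μ at the map underlying k. -/
lemma iter_isPullback {n : ℕ}
    (k : iter (algComonad T) (oneAlg T) n ⟶ iter (algComonad T) (oneAlg T) 0) :
    IsPullback (counitAt (algComonad T) (oneAlg T) (n + 1)) (underG (underG k)) (underG k)
      (counitAt (algComonad T) (oneAlg T) 1) := by
  apply IsPullback.of_map T.forget (underG_counit (underG k)).symm
  change IsPullback (counitAt (algComonad T) (oneAlg T) (n + 1)).f (T.map (T.map k.f)) (T.map k.f)
    (counitAt (algComonad T) (oneAlg T) (0 + 1)).f
  rw [counitAt_f, counitAt_f]
  exact mu_isPullback T k.f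

/-- The bar construction satisfies the Segal condition. -/
lemma bar_isPullback (n : ℕ) :
    IsPullback (simpMap (bar T) (succHom n)) (simpMap (bar T) (edgeHom (edge01 n)))
      (simpMap (bar T) (vertexHom n 0)) (simpMap (bar T) (vertexHom 1 1)) := by
  obtain ⟨k, hk⟩ := exists_iterMap_edge01 (algComonad T) (oneAlg T) n (edgeHom (edge01 n)) rfl rfl
  obtain ⟨k', hk'⟩ := exists_iterMap_vertex_zero (algComonad T) (oneAlg T) n (vertexHom n 0) rfl
  -- Both are maps into the terminal algebra, so the square of operators is of the form treated in
  -- `iter_isPullback`.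
  obtain rfl : k = k' :=
    Monad.Algebra.Hom.ext ((to_iter_zero_f T k).trans (to_iter_zero_f T k').symm)
  have e₁ := iterMap_eq_counit (algComonad T) (oneAlg T) (succHom n) (fun _ => rfl)
  have e₂ := iterMap_eq_counit (algComonad T) (oneAlg T) (vertexHom 1 1)
    (fun i => by obtain rfl : i = 0 := Subsingleton.elim (α := Fin 1) _ _; rfl)
  have h := iter_isPullback T k
  rw [← hk, ← hk', ← e₁, ← e₂] at h
  exact h

/-- The bar construction agrees with the classifier in low dimensions. -/
def barLowIso : LowIso (bar T) (classifier T).toAlgCat where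
  e₀ := Iso.refl (T.free.obj (⊤_ C))
  e₁ := Iso.refl (T.free.obj (T.obj (⊤_ C)))
  src := by
    have e := iterMap_eq_counit (algComonad T) (oneAlg T) (vertexHom 1 1)
      (fun i => by obtain rfl : i = 0 := Subsingleton.elim (α := Fin 1) _ _; rfl)
    refine (Category.id_comp _).trans (Eq.trans ?_ (Category.comp_id _).symm)
    refine Eq.trans ?_ e.symm
    exact Monad.Algebra.Hom.ext (counitAt_f T 0).symm
  tgt := by
    obtain ⟨k, hk⟩ := exists_iterMap_vertex_zero (algComonad T) (oneAlg T) 1 (vertexHom 1 0) rfl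
    refine (Category.id_comp _).trans (Eq.trans ?_ (Category.comp_id _).symm)
    refine Eq.trans ?_ hk.symm
    exact Monad.Algebra.Hom.ext (congrArg (fun j => T.map j) (to_iter_zero_f T k)).symm
  ident := by
    have e := iterMap_const (algComonad T) (oneAlg T)
    refine (Category.id_comp _).trans (Eq.trans ?_ (Category.comp_id _).symm)
    refine Eq.trans ?_ e.symm
    exact Monad.Algebra.Hom.ext (comulAt_f T).symm
  comp h := by
    refine ((classifier T).toAlgData_compose _ _ h).trans ?_
    apply Monad.Algebra.Hom.ext
    obtain ⟨k, hk⟩ := exists_iterMap_edge01 (algComonad T) (oneAlg T) 1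
      (edgeHom triple012.ij) rfl rfl
    have e₁ := iterMap_eq_counit (algComonad T) (oneAlg T) (edgeHom triple012.jk)
      (fun i => by fin_cases i <;> rfl)
    have e₂ := iterMap_edge02 (algComonad T) (oneAlg T) (edgeHom triple012.ik) rfl rfl
    have f₁ := (congrArg Monad.Algebra.Hom.f e₁).trans (counitAt_f T 1)
    have f₂ := (congrArg Monad.Algebra.Hom.f e₂).trans
      (congrArg (fun j => T.map j) (counitAt_f T 0))
    have f₃ := (congrArg Monad.Algebra.Hom.f hk).trans
      (congrArg (fun j => T.map (T.map j)) (to_iter_zero_f T k))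
    -- The 2-simplices are T³1 itself: the edges 1 ≤ 2, 0 ≤ 1 and 0 ≤ 2 are μ_{T1}, TT! and Tμ.
    -- Hence the identity of T³1 represents the pair.
    refine (classifier_compose T (𝟙 _) ?_ ?_ _).trans ?_
    · exact (Category.id_comp _).trans (f₁.symm.trans (Category.comp_id _).symm)
    · exact (Category.id_comp _).trans (f₃.symm.trans (Category.comp_id _).symm)
    · exact (Category.id_comp _).trans (f₂.symm.trans (Category.comp_id _).symm)

lemma nonempty_bar_iso_nerve : Nonempty (bar T ≅ (classifier T).nerve) :=
  LowIso.nonempty_iso_nerve (barLowIso T) (bar_isPullback T)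

end Bar

/-! ### Contractibility -/

section Contractible

variable {D : Type u} [Category.{v} D] [HasFiniteLimits D]

open InternalCat Opposite Simplicial

/-- The extension of a monotone map by a new least element. -/
def liftHom {m n : ℕ} (θ : Fin (m + 1) →o Fin (n + 1)) : Fin (m + 2) →o Fin (n + 2) where
  toFun := Fin.cases 0 (fun i => (θ i).succ)
  monotone' := by
    intro i j h
    induction i using Fin.cases with
    | zero => exact Fin.zero_le _
    | succ i =>
      induction j using Fin.cases with
      | zero => exact absurd h (by simp)
      | succ j => exact Fin.succ_le_succ_iff.mpr (θ.monotone (Fin.succ_le_succ_iff.mp h))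

/-- The `i`-th face inclusion. -/
def faceHom {n : ℕ} (i : Fin (n + 2)) : Fin (n + 1) →o Fin (n + 2) :=
  (SimplexCategory.δ i).toOrderHom

/-- The `i`-th degeneracy. -/
def degenHom {n : ℕ} (i : Fin (n + 1)) : Fin (n + 2) →o Fin (n + 1) :=
  (SimplexCategory.σ i).toOrderHom

/-- The map that sends the elements up to `i` to `0` and fixes the others. -/
def collapseHom {n : ℕ} (i : Fin (n + 1)) : Fin (n + 2) →o Fin (n + 2) where
  toFun k := if k.val ≤ i.val then 0 else k
  monotone' := by
    intro k l h
    have h' : k.val ≤ l.val := h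
    dsimp only
    split_ifs
    · exact le_rfl
    · exact Fin.zero_le _
    · omega
    · exact h

lemma faceHom_val {n : ℕ} (i : Fin (n + 2)) (k : Fin (n + 1)) :
    (faceHom i k).val = if k.val < i.val then k.val else k.val + 1 := by
  change (Fin.succAbove i k).val = _
  unfold Fin.succAbove
  split_ifs with h h' h'
  · rfl
  · exact absurd h h'
  · exact absurd h' h
  · rfl

lemma degenHom_val {n : ℕ} (i : Fin (n + 1)) (k : Fin (n + 2)) :
    (degenHom i k).val = if k.val ≤ i.val then k.val else k.val - 1 := by
  change (Fin.predAbove i k).val = _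
  unfold Fin.predAbove
  split_ifs with h h' h'
  · exact absurd h (not_lt.mpr h')
  · rfl
  · rfl
  · exact absurd (not_le.mp h') h

lemma collapseHom_val {n : ℕ} (i : Fin (n + 1)) (k : Fin (n + 2)) :
    (collapseHom i k).val = if k.val ≤ i.val then 0 else k.val := by
  change (if k.val ≤ i.val then (0 : Fin (n + 2)) else k).val = _
  split_ifs <;> rfl

/-- Adjoining a least element shifts the index of a face by one; this is the shift incurred when a
face moves past a cone. -/
lemma liftHom_faceHom {n : ℕ} (i : Fin (n + 2)) : liftHom (faceHom i) = faceHom i.succ := by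
  apply OrderHom.ext
  funext k
  apply Fin.ext
  rw [faceHom_val]
  induction k using Fin.cases with
  | zero => exact (if_pos (Fin.succ_pos i)).symm
  | succ k =>
    change (faceHom i k).val + 1 = _
    rw [faceHom_val, Fin.val_succ, Fin.val_succ]
    split_ifs <;> omega

lemma liftHom_degenHom {n : ℕ} (i : Fin (n + 1)) : liftHom (degenHom i) = degenHom i.succ := by
  apply OrderHom.ext
  funext k
  apply Fin.ext
  rw [degenHom_val]
  induction k using Fin.cases with
  | zero => exact (if_pos (Nat.zero_le _)).symm
  | succ k =>
    change (degenHom i k).val + 1 = _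
    rw [degenHom_val, Fin.val_succ, Fin.val_succ]
    split_ifs <;> omega

namespace InternalCat

variable {A : InternalCat D}

/-- The unique arrow to a terminal object. -/
def IsTerminalObject.to {a : ⊤_ D ⟶ A.ob} (ha : A.IsTerminalObject a) {X : D} (x : X ⟶ A.ob) :
    X ⟶ A.mor := (ha X x).choose

namespace IsTerminalObject

variable {a : ⊤_ D ⟶ A.ob} (ha : A.IsTerminalObject a)

lemma to_src {X : D} (x : X ⟶ A.ob) : ha.to x ≫ A.src = x := (ha X x).choose_spec.1.1

lemma to_tgt {X : D} (x : X ⟶ A.ob) : ha.to x ≫ A.tgt = terminal.from X ≫ a :=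
  (ha X x).choose_spec.1.2

/-- The cone on a simplex, with vertex the terminal object. -/
def cone (n : ℕ) : A.nerveObj n ⟶ A.nerveObj (n + 1) :=
  A.cons (𝟙 _) (ha.to (A.vertex n 0)) (by rw [to_src, Category.id_comp])

lemma cone_succ (n : ℕ) : ha.cone n ≫ A.nerveMap (succHom n) = 𝟙 _ := A.cons_succ _ _ _

lemma cone_arr01 (n : ℕ) : ha.cone n ≫ A.arr (n + 1) (edge01 n) = ha.to (A.vertex n 0) :=
  A.cons_arr01 _ _ _

lemma cone_vertex_zero (n : ℕ) : ha.cone n ≫ A.vertex (n + 1) 0 = terminal.from _ ≫ a := by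
  have e := congrArg (· ≫ A.tgt) (ha.cone_arr01 n)
  rw [Category.assoc, arr_tgt, to_tgt] at e
  exact e

/-- Both sides have the same zeroth face. Their first edges have the same source and the target a,
hence coincide by uniqueness of arrows to a terminal object. -/
lemma cone_naturality {m n : ℕ} (θ : Fin (m + 1) →o Fin (n + 1)) :
    A.nerveMap θ ≫ ha.cone m = ha.cone n ≫ A.nerveMap (liftHom θ) := by
  apply A.nerve_hom_ext_succ
  · have e : (liftHom θ).comp (succHom m) = (succHom n).comp θ := rfl
    rw [Category.assoc, Category.assoc, cone_succ, nerveMap_comp, e, ← nerveMap_comp,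
      ← Category.assoc (ha.cone n), cone_succ, Category.comp_id, Category.id_comp]
  · rw [Category.assoc, Category.assoc, cone_arr01, nerveMap_arr]
    apply (ha _ (A.vertex n (θ 0))).unique
    · constructor
      · rw [Category.assoc, to_src, nerveMap_vertex]
      · rw [Category.assoc, to_tgt, ← Category.assoc, terminal.comp_from]
    · constructor
      · rw [Category.assoc, arr_src]
        have e : A.vertex (n + 1) (mapEdge (liftHom θ) (edge01 m)).1.2 =
            A.nerveMap (succHom n) ≫ A.vertex n (θ 0) := (A.nerveMap_vertex (succHom n) (θ 0)).symm
        rw [e, ← Category.assoc, cone_succ, Category.id_comp]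
      · rw [Category.assoc, arr_tgt]
        exact ha.cone_vertex_zero n

/-- The simplicial map to the nerve given by a terminal object. -/
def basepoint (_ : A.IsTerminalObject a) : CartMonad.point D ⟶ A.nerve where
  app n := A.point a ≫ A.nerveMap (⟨fun _ => 0, fun _ _ _ => le_rfl⟩ :
    Fin (n.unop.len + 1) →o Fin (0 + 1))
  naturality m n θ := by
    refine (Category.id_comp _).trans (Eq.symm ?_)
    refine (Category.assoc _ _ _).trans (congrArg (A.point a ≫ ·) ?_)
    exact A.nerveMap_comp _ θ.unop.toOrderHom

/-- Writes the constant map as a restriction of the cone, the common form in which the homotopy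
identities are compared. -/
lemma toPoint_basepoint_app (n : ℕ) :
    (toPoint A.nerve ≫ ha.basepoint).app (op ⦋n⦌) =
      ha.cone n ≫ A.nerveMap ⟨fun _ => 0, fun _ _ _ => le_rfl⟩ := by
  change terminal.from (A.nerveObj n) ≫ A.point a ≫ A.nerveMap _ = _
  apply A.arr_ext
  intro e
  rw [Category.assoc, Category.assoc, Category.assoc, nerveMap_arr, nerveMap_arr, point_arr,
    ← Category.assoc, ← ha.cone_vertex_zero n, Category.assoc]
  exact congrArg (ha.cone n ≫ ·) (A.arr_idEdge 0).symm

lemma nerveMap_cone_nerveMap {l m n : ℕ} (θ : Fin (m + 1) →o Fin (n + 1))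
    (ξ : Fin (l + 1) →o Fin (m + 2)) :
    A.nerveMap θ ≫ ha.cone m ≫ A.nerveMap ξ = ha.cone n ≫ A.nerveMap ((liftHom θ).comp ξ) := by
  rw [← Category.assoc, cone_naturality, Category.assoc, nerveMap_comp]

lemma cone_nerveMap_nerveMap {l m n : ℕ} (θ : Fin (m + 1) →o Fin (n + 2))
    (ξ : Fin (l + 1) →o Fin (m + 1)) :
    (ha.cone n ≫ A.nerveMap θ) ≫ A.nerveMap ξ = ha.cone n ≫ A.nerveMap (θ.comp ξ) := by
  rw [Category.assoc, nerveMap_comp]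

/-- The components of the homotopy from the constant map at a terminal object to the identity. -/
def homotopyApp {n : ℕ} (i : Fin (n + 1)) : A.nerveObj n ⟶ A.nerveObj (n + 1) :=
  -- The resulting string consists of i + 1 copies of the terminal object followed by the vertices x
  -- i, …, x n.
  ha.cone n ≫ A.nerveMap (collapseHom i)

/-- Naturality of the cone brings both sides to the form of a cone followed by a reindexing, so a
homotopy identity becomes an equality of monotone maps, checked on values. -/
lemma homotopyApp_faceHom {n : ℕ} {i j : Fin (n + 2)} {j' : Fin (n + 1)}
    {f : Fin (n + 3)}
    (h : ∀ k, (collapseHom j (faceHom f k)).val = (faceHom i.succ (collapseHom j' k)).val) :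
    ha.homotopyApp j ≫ A.nerveMap (faceHom f) = A.nerveMap (faceHom i) ≫ ha.homotopyApp j' := by
  have e : (collapseHom j).comp (faceHom f) = (faceHom i.succ).comp (collapseHom j') :=
    OrderHom.ext _ _ (funext fun k => Fin.ext (h k))
  rw [homotopyApp, homotopyApp, cone_nerveMap_nerveMap, nerveMap_cone_nerveMap, liftHom_faceHom, e]

lemma homotopyApp_degenHom {n : ℕ} {i j : Fin (n + 1)} {j' : Fin (n + 2)}
    {f : Fin (n + 2)}
    (h : ∀ k, (collapseHom j (degenHom f k)).val = (degenHom i.succ (collapseHom j' k)).val) :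
    ha.homotopyApp j ≫ A.nerveMap (degenHom f) = A.nerveMap (degenHom i) ≫ ha.homotopyApp j' := by
  have e : (collapseHom j).comp (degenHom f) = (degenHom i.succ).comp (collapseHom j') :=
    OrderHom.ext _ _ (funext fun k => Fin.ext (h k))
  rw [homotopyApp, homotopyApp, cone_nerveMap_nerveMap, nerveMap_cone_nerveMap, liftHom_degenHom, e]

/-- The homotopy from the constant map at a terminal object to the identity. -/
def homotopy : SimplicialObject.Homotopy (toPoint A.nerve ≫ ha.basepoint) (𝟙 A.nerve) where
  h i := ha.homotopyApp i
  h_zero_comp_δ_zero n := by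
    -- For i = 0 nothing is collapsed, and the zeroth face removes the cone point: this end is the
    -- identity.
    have e : (collapseHom (0 : Fin (n + 1))).comp (faceHom 0) = succHom n := by
      apply OrderHom.ext
      funext k
      apply Fin.ext
      change (collapseHom (0 : Fin (n + 1)) (faceHom 0 k)).val = k.succ.val
      rw [collapseHom_val, faceHom_val, Fin.val_succ]
      simp
    refine (ha.cone_nerveMap_nerveMap (collapseHom 0) (faceHom 0)).trans ?_
    rw [e]
    exact ha.cone_succ n
  h_last_comp_δ_last n := by
    -- For i = n only the last vertex survives the collapse, and the last face removes it: this end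
    -- is constant.
    have e : (collapseHom (Fin.last n)).comp (faceHom (Fin.last (n + 1))) =
        ⟨fun _ => 0, fun _ _ _ => le_rfl⟩ := by
      apply OrderHom.ext
      funext k
      apply Fin.ext
      change (collapseHom (Fin.last n) (faceHom (Fin.last (n + 1)) k)).val = 0
      rw [collapseHom_val, faceHom_val, Fin.val_last, Fin.val_last]
      split_ifs <;> omega
    refine (ha.cone_nerveMap_nerveMap (collapseHom (Fin.last n)) (faceHom (Fin.last (n + 1)))).trans
      ?_
    rw [e]
    exact (ha.toPoint_basepoint_app n).symm
  h_succ_comp_δ_castSucc_of_lt {n} i j hij := by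
    apply ha.homotopyApp_faceHom
    intro k
    have : i.val ≤ j.val := hij
    rw [collapseHom_val, faceHom_val, faceHom_val, collapseHom_val, Fin.val_succ, Fin.val_succ,
      Fin.val_castSucc]
    split_ifs <;> omega
  h_succ_comp_δ_castSucc_succ {n} j := by
    refine (ha.cone_nerveMap_nerveMap (collapseHom j.succ) (faceHom j.castSucc.succ)).trans
      (Eq.trans ?_
        (ha.cone_nerveMap_nerveMap (collapseHom j.castSucc) (faceHom j.castSucc.succ)).symm)
    -- The two collapsing maps differ only at the index j + 1, which the face omits.
    congr 2
    apply OrderHom.ext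
    funext k
    apply Fin.ext
    change (collapseHom j.succ (faceHom j.castSucc.succ k)).val =
      (collapseHom j.castSucc (faceHom j.castSucc.succ k)).val
    rw [collapseHom_val, faceHom_val, collapseHom_val, faceHom_val, Fin.val_succ, Fin.val_succ,
      Fin.val_castSucc]
    split_ifs <;> omega
  h_castSucc_comp_δ_succ_of_lt {n} i j hji := by
    apply ha.homotopyApp_faceHom
    intro k
    have : j.val < i.val := hji
    rw [collapseHom_val, faceHom_val, faceHom_val, collapseHom_val, Fin.val_succ,
      Fin.val_castSucc]
    split_ifs <;> omega
  h_comp_σ_castSucc_of_le {n} i j hij := by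
    apply ha.homotopyApp_degenHom
    intro k
    have : i.val ≤ j.val := hij
    rw [collapseHom_val, degenHom_val, degenHom_val, collapseHom_val, Fin.val_succ, Fin.val_succ,
      Fin.val_castSucc]
    split_ifs <;> omega
  h_comp_σ_succ_of_lt {n} i j hji := by
    apply ha.homotopyApp_degenHom
    intro k
    have : j.val ≤ i.val := hji
    rw [collapseHom_val, degenHom_val, degenHom_val, collapseHom_val, Fin.val_succ,
      Fin.val_castSucc]
    split_ifs <;> omega

/-- An internal category with a terminal object is contractible. -/
lemma isContractible (ha : A.IsTerminalObject a) : A.IsContractible :=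
  ⟨ha.basepoint, Relation.EqvGen.rel _ _ ⟨ha.homotopy⟩, by
    have e : ha.basepoint ≫ toPoint A.nerve = 𝟙 (CartMonad.point D) :=
      NatTrans.ext (funext fun _ => terminalIsTerminal.hom_ext _ _)
    rw [e]
    exact Relation.EqvGen.refl _⟩

end IsTerminalObject
end InternalCat
end Contractible

end CartMonad

end

/-! ### Assembly of the three claims. -/

open CartMonad in
theorem mainTheorem7 {C : Type u} [Category.{v} C] [HasFiniteLimits C]
    (T : CategoryTheory.Monad C) [CartMonad.IsCartesianMonad T] :
    (∃ H : CartMonad.CatAlg T,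
      Nonempty (CartMonad.TwoNatIso (CartMonad.homFunctor H) (CartMonad.IAlg T))) ∧
    (∀ H : CartMonad.CatAlg T,
      Nonempty (CartMonad.TwoNatIso (CartMonad.homFunctor H) (CartMonad.IAlg T)) ↔
        Nonempty (H.nerve ≅ CartMonad.bar T)) ∧
    (∀ (H : CartMonad.CatAlg T)
      (Φ : CartMonad.TwoNatIso (CartMonad.homFunctor H) (CartMonad.IAlg T)),
      H.cat.IsTerminalObject (CartMonad.canonicalAlgebra Φ).func.obj ∧
        H.cat.IsContractible) := by
  refine ⟨⟨classifier T, ⟨isUniversal_universal.twoNatIso⟩⟩, fun H => ⟨?_, ?_⟩, fun H Φ => ?_⟩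
  · rintro ⟨Φ⟩
    obtain ⟨e, e', h, h', -⟩ := exists_iso_classifier Φ
    obtain ⟨i⟩ := CatAlg.nonempty_nerve_iso e' e h' h
    obtain ⟨j⟩ := nonempty_bar_iso_nerve T
    exact ⟨i ≪≫ j.symm⟩
  · rintro ⟨i⟩
    obtain ⟨j⟩ := nonempty_bar_iso_nerve T
    obtain ⟨e, e', h, h'⟩ := CatAlg.exists_iso_of_nerve_iso (i ≪≫ j)
    -- The inverse e' goes from the classifier to H and carries the universal algebra to a universal
    -- one in H.
    exact ⟨(isUniversal_universal.post e' e h' h).twoNatIso⟩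
  · obtain ⟨e, e', h, h', hc⟩ := exists_iso_classifier Φ
    have ht : H.cat.IsTerminalObject (canonicalAlgebra Φ).func.obj := by
      -- For an arbitrary representation the canonical algebra is the image of `universal` under e,
      -- so its terminality is inherited from the classifier.
      rw [hc]
      exact isTerminalObject_universal.of_iso e.func e'.func
        (congrArg CatAlg.Hom.func h) (congrArg CatAlg.Hom.func h')
    exact ⟨ht, ht.isContractible⟩
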